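/- Let $\varphi\in C_c^\infty((\frac34,\frac83))$ be real valued with $\sum_{j\in\mathbb Z}\varphi(2^{-j}\tau)=1$ for all $\tau>0$. Write $x=(x_h,x_3)\in\mathbb R^2\times\mathbb R$, $\xi=(\xi_h,\xi_3)$, and let $$\Delta_k a=\mathcal F^{-1}(\varphi(2^{-k}|\xi|)\hat a),\quad \Delta^h_k a=\mathcal F^{-1}(\varphi(2^{-k}|\xi_h|)\hat a),\quad \Delta^v_l a=\mathcal F^{-1}(\varphi(2^{-l}|\xi_3|)\hat a),\quad S^h_k a=\sum_{k'\le k-1}\Delta^h_{k'}a .$$ Define the following spaces of (complex valued) tempered distributions on $\mathbb R^3$. * For $2\le p<\infty$, $B^{-1+\frac2p,\frac12}_p$ is the completion of $\mathcal S(\mathbb R^3)$ for the norm $$\|a\|_{B^{-1+\frac2p,\frac12}_p}=\sum_{l\in\mathbb Z}2^{\frac l2}\Big(\sum_{k\ge l-1}2^{(-2+\frac4p)k}\|\Delta^h_k\Delta^v_l a\|^2_{L^p_h(L^2_v)}\Big)^{\frac12}+\sum_{j\in\mathbb Z}2^{\frac j2}\|S^h_{j-1}\Delta^v_j a\|_{L^2(\mathbb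 R^3)},$$ that is, the set of limits in $\mathcal S'(\mathbb R^3)$ of Cauchy sequences $(a_n)$ of Schwartz functions, with the norm $\lim_n\|a_n\|$ (the infimum of the limits over such sequences). Moreover $B^{0,\frac12}:=B^{0,\frac12}_2$. * For $q\in\{2,\infty\}$, $\dot B^{-1}_{\infty,q}$ is the space of $f\in\mathcal S'(\mathbb R^3)$ with $f=\sum_{k\in\mathbb Z}\Delta_k f$ in $\mathcal S'$ and $\|f\|_{\dot B^{-1}_{\infty,q}}:=\big\|(2^{-k}\|\Delta_k f\|_{L^\infty})_k\big\|_{\ell^q(\mathbb Z)}<\infty$. * $BMO^{-1}$ (the Koch–Tataru space) is the space of $f\in\mathcal S'(\mathbb R^3)$ with $$\|f\|_{BMO^{-1}}:=\sup_{k\in\mathbb Z}2^{-k}\|\Delta_k f\|_{L^\infty}+\sup_{x\in\mathbb R^3,\,R>0}R^{-\frac32}\Big(\int_{[0,R^2]\times B(x,R)}|e^{t\Delta}f(y)|^2\,dy\,dt\Big)^{\frac12}<\infty,$$ where $B(x,R)$ is the closed ball. * $C^{-1}$ is the homogeneous Hölder space of order $-1$: the space of $f\in\mathcal S'(\mathbb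 R^3)$ with $\|f\|_{C^{-1}}:=\sup_{t>0}t^{\frac12}\|e^{t\Delta}f\|_{L^\infty}<\infty$. **Proposition.** Let $2\le p<\infty$. The completion $B^{-1+\frac2p,\frac12}_p$ is indeed a space of tempered distributions: every sequence of Schwartz functions that is Cauchy for its norm converges in $\mathcal S'(\mathbb R^3)$, and if the limit is $0$ then the norms tend to $0$. Moreover there are continuous embeddings (inclusions, with a bound on the norms) $$B^{0,\frac12}\subset B^{-1+\frac2p,\frac12}_p\subset\dot B^{-1}_{\infty,2}\subset BMO^{-1}\subset\dot B^{-1}_{\infty,\infty}=C^{-1},$$ the last equality being one of sets, with equivalent norms. -/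

import Mathlib

open MeasureTheory Filter Topology
open scoped ENNReal NNReal SchwartzMap

noncomputable section

namespace AnisoNS

/-- The physical (and frequency) space `ℝ³`. Coordinates `0, 1` are horizontal, `2` is vertical. -/
abbrev R3 : Type := EuclideanSpace ℝ (Fin 3)

/-! ### Dyadic decomposition -/

/-- `φ ∈ 𝒟((3/4, 8/3))` with `∑_{j ∈ ℤ} φ(2^{-j} τ) = 1` for every `τ > 0`. -/
structure IsDyadicCutoff (φ : ℝ → ℝ) : Prop where
  contDiff : ContDiff ℝ (⊤ : ℕ∞) φ
  hasCompactSupport : HasCompactSupport φ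
  tsupport_subset : tsupport φ ⊆ Set.Ioo (3 / 4 : ℝ) (8 / 3)
  hasSum : ∀ τ : ℝ, 0 < τ → HasSum (fun j : ℤ => φ ((2 : ℝ) ^ (-j) * τ)) 1

/-- The horizontal part `ξ_h = (ξ₁, ξ₂)` of `ξ`. -/
def horizontal : R3 →L[ℝ] EuclideanSpace ℝ (Fin 2) :=
  LinearMap.toContinuousLinearMap
    { toFun := fun ξ => !₂[ξ 0, ξ 1]
      map_add' := fun x y => by ext i; fin_cases i <;> simp
      map_smul' := fun c x => by ext i; fin_cases i <;> simp }

/- Mathlib's Fourier transform is `𝓕 f ξ = ∫ e^{-2πi x·ξ} f x dx`; the angular frequency of the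
usual transform `∫ e^{-i x·ξ} f x dx` is `2π` times Mathlib's variable, hence the factor `2π`. -/

/-- Symbol `φ(2^{-k}|ξ|)` of the isotropic block `Δ_k`. -/
def isoSymbol (φ : ℝ → ℝ) (k : ℤ) (ξ : R3) : ℂ :=
  (φ ((2 : ℝ) ^ (-k) * (2 * Real.pi * ‖ξ‖)) : ℝ)

/-- Symbol `φ(2^{-k}|ξ_h|)` of the horizontal block `Δ^h_k`. -/
def horSymbol (φ : ℝ → ℝ) (k : ℤ) (ξ : R3) : ℂ :=
  (φ ((2 : ℝ) ^ (-k) * (2 * Real.pi * ‖horizontal ξ‖)) : ℝ)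

/-- Symbol `φ(2^{-l}|ξ₃|)` of the vertical block `Δ^v_l`. -/
def verSymbol (φ : ℝ → ℝ) (l : ℤ) (ξ : R3) : ℂ :=
  (φ ((2 : ℝ) ^ (-l) * (2 * Real.pi * |ξ 2|)) : ℝ)

/- The three symbols are smooth of temperate growth, so that Mathlib's Fourier multipliers with
these symbols are the genuine ones (they are `0` by convention for other symbols). -/

lemma hasTemperateGrowth_radial {V : Type} [NormedAddCommGroup V] [InnerProductSpace ℝ V]
    [FiniteDimensional ℝ V] {φ : ℝ → ℝ} (hφ : IsDyadicCutoff φ) {c : ℝ} (hc : 0 < c) :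
    (fun v : V => φ (c * ‖v‖)).HasTemperateGrowth := by
  apply HasCompactSupport.hasTemperateGrowth
  · apply HasCompactSupport.of_support_subset_isCompact
      (isCompact_closedBall (0 : V) ((8 / 3) / c))
    intro v hv
    have h1 := hφ.tsupport_subset (subset_tsupport φ hv)
    rw [mem_closedBall_zero_iff, le_div_iff₀ hc, mul_comm]
    exact h1.2.le
  · rw [contDiff_iff_contDiffAt]
    intro v
    by_cases hv : v = 0
    · subst hv
      have h0 : (fun v : V => φ (c * ‖v‖)) =ᶠ[𝓝 0] fun _ => 0 := by
        have hcont : Tendsto (fun v : V => c * ‖v‖) (𝓝 0) (𝓝 0) := by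
          have : Continuous (fun v : V => c * ‖v‖) := by fun_prop
          simpa using this.tendsto 0
        filter_upwards [hcont.eventually (gt_mem_nhds (show (0 : ℝ) < 3 / 4 by norm_num))]
          with w hw
        by_contra hne
        exact absurd (hφ.tsupport_subset (subset_tsupport φ hne)).1 (not_lt.mpr hw.le)
      exact contDiffAt_const.congr_of_eventuallyEq h0
    · exact hφ.contDiff.contDiffAt.comp v (contDiffAt_const.mul (contDiffAt_norm ℝ hv))

lemma hasTemperateGrowth_isoSymbol {φ : ℝ → ℝ} (hφ : IsDyadicCutoff φ) (k : ℤ) :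
    (isoSymbol φ k).HasTemperateGrowth := by
  have h := hasTemperateGrowth_radial (V := R3) hφ
    (show (0 : ℝ) < (2 : ℝ) ^ (-k) * (2 * Real.pi) by positivity)
  have h2 := Function.HasTemperateGrowth.comp Function.Complex.hasTemperateGrowth_ofReal h
  have e : isoSymbol φ k =
      Complex.ofReal ∘ fun v : R3 => φ ((2 : ℝ) ^ (-k) * (2 * Real.pi) * ‖v‖) := by
    funext ξ
    simp only [isoSymbol, Function.comp_apply, mul_assoc]
  rw [e]
  exact h2

lemma hasTemperateGrowth_horSymbol {φ : ℝ → ℝ} (hφ : IsDyadicCutoff φ) (k : ℤ) :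
    (horSymbol φ k).HasTemperateGrowth := by
  have h := hasTemperateGrowth_radial (V := EuclideanSpace ℝ (Fin 2)) hφ
    (show (0 : ℝ) < (2 : ℝ) ^ (-k) * (2 * Real.pi) by positivity)
  have h2 := Function.HasTemperateGrowth.comp Function.Complex.hasTemperateGrowth_ofReal (h.comp horizontal.hasTemperateGrowth)
  have e : horSymbol φ k = Complex.ofReal ∘
      (fun v => φ ((2 : ℝ) ^ (-k) * (2 * Real.pi) * ‖v‖)) ∘ horizontal := by
    funext ξ
    simp only [horSymbol, Function.comp_apply, mul_assoc]
  rw [e]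
  exact h2

lemma hasTemperateGrowth_verSymbol {φ : ℝ → ℝ} (hφ : IsDyadicCutoff φ) (l : ℤ) :
    (verSymbol φ l).HasTemperateGrowth := by
  have h := hasTemperateGrowth_radial (V := ℝ) hφ
    (show (0 : ℝ) < (2 : ℝ) ^ (-l) * (2 * Real.pi) by positivity)
  have h2 := Function.HasTemperateGrowth.comp Function.Complex.hasTemperateGrowth_ofReal
    (h.comp (EuclideanSpace.proj (𝕜 := ℝ) (2 : Fin 3) : R3 →L[ℝ] ℝ).hasTemperateGrowth)
  have e : verSymbol φ l = Complex.ofReal ∘ (fun v => φ ((2 : ℝ) ^ (-l) * (2 * Real.pi) * ‖v‖)) ∘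
      (EuclideanSpace.proj (𝕜 := ℝ) (2 : Fin 3) : R3 →L[ℝ] ℝ) := by
    funext ξ
    simp only [verSymbol, Function.comp_apply, mul_assoc, Real.norm_eq_abs]
    rfl
  rw [e]
  exact h2

/-- `Δ_k` on tempered distributions. -/
def isoBlock (φ : ℝ → ℝ) (k : ℤ) : 𝓢'(R3, ℂ) →L[ℂ] 𝓢'(R3, ℂ) :=
  TemperedDistribution.fourierMultiplierCLM ℂ (isoSymbol φ k)

/-- `Δ^h_k` on Schwartz functions. -/
def horBlock (φ : ℝ → ℝ) (k : ℤ) : 𝓢(R3, ℂ) →L[ℂ] 𝓢(R3, ℂ) :=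
  SchwartzMap.fourierMultiplierCLM ℂ (horSymbol φ k)

/-- `Δ^v_l` on Schwartz functions. -/
def verBlock (φ : ℝ → ℝ) (l : ℤ) : 𝓢(R3, ℂ) →L[ℂ] 𝓢(R3, ℂ) :=
  SchwartzMap.fourierMultiplierCLM ℂ (verSymbol φ l)

/-- `S^h_k a = ∑_{k' ≤ k - 1} Δ^h_{k'} a` (the series converges absolutely at every point). -/
def horLow (φ : ℝ → ℝ) (k : ℤ) (a : 𝓢(R3, ℂ)) (x : R3) : ℂ :=
  ∑' k' : {k' : ℤ // k' ≤ k - 1}, horBlock φ k' a x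

/-! ### Normed spaces of tempered distributions -/

/-- A set of tempered distributions on `ℝ³` with a `[0, ∞]`-valued norm. -/
structure DistSpace where
  carrier : Set 𝓢'(R3, ℂ)
  nrm : 𝓢'(R3, ℂ) → ℝ≥0∞

/-- Continuous embedding: inclusion, with a bound on the norms. -/
def DistSpace.EmbedsIn (X Y : DistSpace) : Prop :=
  X.carrier ⊆ Y.carrier ∧ ∃ C : ℝ≥0, ∀ u ∈ X.carrier, Y.nrm u ≤ C * X.nrm u

/-- Equality as sets, with equivalent norms. -/
def DistSpace.Equivalent (X Y : DistSpace) : Prop :=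
  X.EmbedsIn Y ∧ Y.EmbedsIn X

/-! ### The anisotropic spaces `B^{-1+2/p, 1/2}_p` -/

/-- The mixed norm of `L^p_h(L^2_v)`. -/
def mixedNorm (p : ℝ) (f : R3 → ℂ) : ℝ≥0∞ :=
  (∫⁻ y : ℝ × ℝ, (∫⁻ z : ℝ, ‖f !₂[y.1, y.2, z]‖ₑ ^ 2) ^ (p / 2)) ^ (1 / p)

/-- The norm of `B^{-1+2/p, 1/2}_p` on Schwartz functions. -/
def anisoNorm (φ : ℝ → ℝ) (p : ℝ) (a : 𝓢(R3, ℂ)) : ℝ≥0∞ :=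
  (∑' l : ℤ, (2 : ℝ≥0∞) ^ ((l : ℝ) / 2) *
    (∑' k : {k : ℤ // l - 1 ≤ k}, (2 : ℝ≥0∞) ^ ((-2 + 4 / p) * ((k : ℤ) : ℝ)) *
      mixedNorm p (horBlock φ k (verBlock φ l a)) ^ 2) ^ (1 / 2 : ℝ)) +
  ∑' j : ℤ, (2 : ℝ≥0∞) ^ ((j : ℝ) / 2) * eLpNorm (horLow φ (j - 1) (verBlock φ j a)) 2 volume

/-- Cauchy sequences of Schwartz functions for the norm of `B^{-1+2/p, 1/2}_p`. -/
def IsAnisoCauchy (φ : ℝ → ℝ) (p : ℝ) (a : ℕ → 𝓢(R3, ℂ)) : Prop :=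
  ∀ ε : ℝ≥0∞, 0 < ε → ∃ N : ℕ, ∀ m ≥ N, ∀ n ≥ N, anisoNorm φ p (a m - a n) ≤ ε

/-- The sequence of Schwartz functions `a` tends to `u` in the space of tempered distributions. -/
def TendstoDist (a : ℕ → 𝓢(R3, ℂ)) (u : 𝓢'(R3, ℂ)) : Prop :=
  Tendsto (fun n => (a n : 𝓢'(R3, ℂ))) atTop (𝓝 u)

/-- The completion of `𝓢(ℝ³)` for `anisoNorm φ p` can be identified with a space of tempered
distributions: every Cauchy sequence converges in `𝓢'`, and a Cauchy sequence that tends to `0`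
in `𝓢'` tends to `0` in norm (so that it represents the zero element of the completion). -/
def AnisoCompletionIsDistributional (φ : ℝ → ℝ) (p : ℝ) : Prop :=
  ∀ a : ℕ → 𝓢(R3, ℂ), IsAnisoCauchy φ p a →
    (∃ u : 𝓢'(R3, ℂ), TendstoDist a u) ∧
    (TendstoDist a 0 → Tendsto (fun n => anisoNorm φ p (a n)) atTop (𝓝 0))

/-- `B^{-1+2/p, 1/2}_p`: the completion of `𝓢(ℝ³)`, as a space of tempered distributions. Its
elements are the limits in `𝓢'` of Cauchy sequences `a`, and the norm of the limit is
`lim ‖a n‖` (it does not depend on the sequence). -/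
def anisoBesov (φ : ℝ → ℝ) (p : ℝ) : DistSpace where
  carrier := {u | ∃ a : ℕ → 𝓢(R3, ℂ), IsAnisoCauchy φ p a ∧ TendstoDist a u}
  nrm u := ⨅ (a : ℕ → 𝓢(R3, ℂ)) (_ : IsAnisoCauchy φ p a ∧ TendstoDist a u),
    limsup (fun n => anisoNorm φ p (a n)) atTop

/-! ### Homogeneous Besov spaces `Ḃ^{-1}_{∞,q}` -/

/-- The `L^∞` norm of a tempered distribution; it is `∞` if the distribution is not a bounded
function. -/
def supNorm (u : 𝓢'(R3, ℂ)) : ℝ≥0∞ :=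
  ⨅ (g : Lp ℂ ∞ (volume : Measure R3)) (_ : (g : 𝓢'(R3, ℂ)) = u), ‖g‖ₑ

/-- `‖u‖ = ‖ (2^{-k} ‖Δ_k u‖_{L^∞})_k ‖_{ℓ^q(ℤ)}`. -/
def besovNorm (φ : ℝ → ℝ) (q : ℝ≥0∞) (u : 𝓢'(R3, ℂ)) : ℝ≥0∞ :=
  if q = ∞ then ⨆ k : ℤ, (2 : ℝ≥0∞) ^ (-k) * supNorm (isoBlock φ k u)
  else (∑' k : ℤ, ((2 : ℝ≥0∞) ^ (-k) * supNorm (isoBlock φ k u)) ^ q.toReal) ^ (1 / q.toReal)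

/-- The homogeneous Besov space `Ḃ^{-1}_{∞,q}`, in its usual realization in `𝓢'`: distributions
of finite norm that are the sum of their dyadic blocks (this excludes the polynomials, on which
the norm vanishes). -/
def besov (φ : ℝ → ℝ) (q : ℝ≥0∞) : DistSpace where
  carrier := {u | HasSum (fun k : ℤ => isoBlock φ k u) u ∧ besovNorm φ q u < ∞}
  nrm := besovNorm φ q

/-! ### The heat flow on tempered distributions -/

lemma gaussian_bound {a : ℝ} (ha : 0 < a) (N : ℕ) {r : ℝ} (hr : 0 ≤ r) :
    (1 + r) ^ N * Real.exp (-a * r ^ 2) ≤ Real.exp ((N : ℝ) ^ 2 / (4 * a)) := by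
  have h1 : (1 + r) ^ N ≤ Real.exp (N * r) := by
    rw [Real.exp_nat_mul]
    gcongr
    linarith [Real.add_one_le_exp r]
  calc (1 + r) ^ N * Real.exp (-a * r ^ 2)
      ≤ Real.exp (N * r) * Real.exp (-a * r ^ 2) := by gcongr
    _ = Real.exp (N * r + -a * r ^ 2) := (Real.exp_add _ _).symm
    _ ≤ _ := by
      apply Real.exp_le_exp.mpr
      rw [le_div_iff₀ (by positivity)]
      nlinarith [sq_nonneg (2 * a * r - N)]

lemma gaussian_decay {a : ℝ} (ha : 0 < a) (n : ℕ) :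
    ∀ {F : Type} [NormedAddCommGroup F] [NormedSpace ℝ F] (h : R3 → F), h.HasTemperateGrowth →
      ∀ k : ℕ, ∃ C : ℝ, ∀ x,
        ‖x‖ ^ k * ‖iteratedFDeriv ℝ n (fun x => Real.exp (-a * ‖x‖ ^ 2) • h x) x‖ ≤ C := by
  induction n with
  | zero =>
    intro F _ _ h hh k
    obtain ⟨m, C, hC, hb⟩ := hh.norm_iteratedFDeriv_le_uniform 0
    refine ⟨C * Real.exp (((k + m : ℕ) : ℝ) ^ 2 / (4 * a)), fun x => ?_⟩
    have hb0 := hb 0 le_rfl x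
    rw [norm_iteratedFDeriv_zero] at hb0 ⊢
    rw [norm_smul, Real.norm_eq_abs, abs_of_pos (Real.exp_pos _)]
    calc ‖x‖ ^ k * (Real.exp (-a * ‖x‖ ^ 2) * ‖h x‖)
        ≤ (1 + ‖x‖) ^ k * (Real.exp (-a * ‖x‖ ^ 2) * (C * (1 + ‖x‖) ^ m)) := by
          gcongr
          linarith
      _ = C * ((1 + ‖x‖) ^ (k + m) * Real.exp (-a * ‖x‖ ^ 2)) := by ring
      _ ≤ _ := by
          gcongr
          exact gaussian_bound ha _ (norm_nonneg x)
  | succ n ih =>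
    intro F _ _ h hh k
    have hd : (fderiv ℝ h).HasTemperateGrowth := by
      refine ⟨hh.1.fderiv_right (by simp), fun n => ?_⟩
      obtain ⟨m, C, hb⟩ := hh.2 (n + 1)
      exact ⟨m, C, fun x => by rw [norm_iteratedFDeriv_fderiv]; exact hb x⟩
    have hg : (fun x : R3 => fderiv ℝ h x -
        (2 * a) • ((innerSL ℝ x).smulRight (h x))).HasTemperateGrowth := by
      have h1 : (fun x : R3 => (innerSL ℝ x).smulRight (h x)).HasTemperateGrowth :=
        (ContinuousLinearMap.smulRightL ℝ R3 F).bilinear_hasTemperateGrowth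
          (innerSL ℝ (E := R3)).hasTemperateGrowth hh
      exact hd.sub ((Function.HasTemperateGrowth.const (2 * a)).smul h1)
    obtain ⟨C, hC⟩ := ih _ hg k
    refine ⟨C, fun x => ?_⟩
    have hf : fderiv ℝ (fun x : R3 => Real.exp (-a * ‖x‖ ^ 2) • h x) = fun x =>
        Real.exp (-a * ‖x‖ ^ 2) •
          (fderiv ℝ h x - (2 * a) • ((innerSL ℝ x).smulRight (h x))) := by
      funext y
      have e1 : HasFDerivAt (fun x : R3 => Real.exp (-a * ‖x‖ ^ 2)) _ y :=
        (((hasStrictFDerivAt_norm_sq y).hasFDerivAt).const_mul (-a)).exp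
      have e2 : HasFDerivAt h (fderiv ℝ h y) y :=
        (hh.1.differentiable (by simp) y).hasFDerivAt
      refine (e1.smul e2).fderiv.trans ?_
      ext v
      simp [smul_smul, sub_eq_add_neg]
      congr 1
      ring
    rw [← norm_iteratedFDeriv_fderiv, hf]
    exact hC x

/-- The heat kernel `x ↦ (4πt)^{-3/2} e^{-|x|²/(4t)}` at time `t > 0`. -/
def heatKernel (t : ℝ) (ht : 0 < t) : 𝓢(R3, ℂ) where
  toFun x := Real.exp (-(1 / (4 * t)) * ‖x‖ ^ 2) •
    (((4 * Real.pi * t) ^ (-(3 / 2) : ℝ) : ℝ) : ℂ)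
  smooth' := by
    have h : ContDiff ℝ (⊤ : ℕ∞) (fun x : R3 => ‖x‖ ^ 2) := contDiff_norm_sq ℝ
    exact ((contDiff_const.mul h).exp).smul contDiff_const
  decay' k n := gaussian_decay (by positivity) n _ (Function.HasTemperateGrowth.const _) k

/-- `(e^{tΔ} f)(y) = ⟨f, G_t(· - y)⟩` for `t > 0`, where `G_t` is the (even) heat kernel. -/
def heatFlow (f : 𝓢'(R3, ℂ)) (t : ℝ) (y : R3) : ℂ :=
  if ht : 0 < t then f (SchwartzMap.compSubConstCLM ℂ y (heatKernel t ht)) else 0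

/-! ### `BMO^{-1}` and `C^{-1}` -/

/-- `sup_{x, R > 0} R^{-3/2} (∫_{[0,R²] × B(x,R)} |e^{tΔ} f(y)|² dy dt)^{1/2}`. -/
def carlesonNorm (f : 𝓢'(R3, ℂ)) : ℝ≥0∞ :=
  ⨆ (x : R3) (R : ℝ) (_ : 0 < R), ENNReal.ofReal (R ^ (-(3 / 2) : ℝ)) *
    (∫⁻ z in Set.Icc (0 : ℝ) (R ^ 2) ×ˢ Metric.closedBall x R,
      ‖heatFlow f z.1 z.2‖ₑ ^ 2) ^ (1 / 2 : ℝ)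

/-- The Koch–Tataru space `BMO^{-1}`. -/
def bmoInv (φ : ℝ → ℝ) : DistSpace where
  carrier := {f | besovNorm φ ∞ f + carlesonNorm f < ∞}
  nrm f := besovNorm φ ∞ f + carlesonNorm f

/-- `sup_{t > 0} t^{1/2} ‖e^{tΔ} f‖_{L^∞}`. -/
def holderInvNorm (f : 𝓢'(R3, ℂ)) : ℝ≥0∞ :=
  ⨆ (t : ℝ) (_ : 0 < t), ENNReal.ofReal (t ^ (1 / 2 : ℝ)) * eLpNorm (heatFlow f t) ∞ volume

/-- The (homogeneous) Hölder space `C^{-1}` of order `-1`, defined by the heat flow. -/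
def holderInv : DistSpace where
  carrier := {f | holderInvNorm f < ∞}
  nrm := holderInvNorm

end AnisoNS

end

/-!
The embeddings rest on three facts about Fourier multipliers with Schwartz symbols. The `L^1` norm of
the kernel of `m(D)` is invariant under dilations of `m`, so dyadic blocks are uniformly bounded
(`kernelNorm_dilate`), and its `L^q` norms scale, which is Bernstein's inequality
(`lintegral_enorm_fourierInv_sym`). A tempered distribution commutes with convolution integrals
(`apply_eq_integral_translate`), so that `m(D) u` is the function `y ↦ u(𝓕⁻ m(· - y))` for even `m`;
this computes `L^∞` norms of blocks and gives the semigroup property of the heat flow. Finally, a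
distribution of finite `Ḃ^{-1}_{∞,∞}` norm is the sum of its blocks as soon as its low frequencies
tend to zero (`hasSum_isoBlock_of_tendsto`), because the block of order `k` paired with a test
function is `O(2^{-|k|})`.

*Isotropic spaces.* The block of order `k` contributes at most `min(1, (4^k t)⁻¹) ‖Δ_k u‖_∞` to
`e^{tΔ} u` (`exists_enorm_heatFlow_le`). Summation gives `Ḃ^{-1}_{∞,∞} ⊂ C^{-1}`; the Cauchy-Schwarz
inequality and integration in time give `Ḃ^{-1}_{∞,2} ⊂ BMO^{-1}`. Conversely, a symbol supported in
frequencies at most `2^k` is a Gaussian at time `4^{-k}` times a dyadic symbol, so that the heat flow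
controls the blocks and the low frequencies, whence `C^{-1} ⊂ Ḃ^{-1}_{∞,∞}`. To see that elements of
`BMO^{-1}` are sums of their blocks, `e^{tΔ} u` is written as an average of `e^{(t-s)Δ} e^{sΔ} u` over
`s ≤ t / 2`, which bounds the norm of `C^{-1}` by the Carleson norm
(`exists_holderInvNorm_le_carlesonNorm`).

*Anisotropic spaces.* The embedding of `B^{0,1/2}` is Bernstein's inequality in the horizontal
variables. On a Schwartz function, the block `Δ_j` meets `Δ^h_k Δ^v_l` with `k ≥ l - 1` only for
`|k - j| ≤ 3`, and `S^h_{l-1} Δ^v_l` only for `|l - j| ≤ 3`. Bernstein's inequality in both groups of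
variables, Young's inequality in `j` and Minkowski's inequality in `l` then bound the norm of
`Ḃ^{-1}_{∞,2}` by the anisotropic one (`exists_l2_blockSup_le`). By duality the anisotropic norm
controls the pairing with test functions, so Cauchy sequences converge in the sense of distributions.
Both norms are lower semicontinuous for this convergence, which carries the embedding over to the
completion and shows that a Cauchy sequence with limit `0` tends to `0` in norm.
-/

open scoped FourierTransform RealInnerProductSpace

set_option linter.unusedSectionVars false

noncomputable section

namespace AnisoNS

/-! ### Kernels of Fourier multipliers -/

section Kernel

variable {V : Type*} [NormedAddCommGroup V] [InnerProductSpace ℝ V] [FiniteDimensional ℝ V]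
  [MeasurableSpace V] [BorelSpace V]
variable {E : Type*} [NormedAddCommGroup E] [InnerProductSpace ℝ E] [FiniteDimensional ℝ E]
  [MeasurableSpace E] [BorelSpace E]

/-- The `L¹` norm of the convolution kernel `𝓕⁻ m` of the Fourier multiplier with symbol `m`. -/
def kernelNorm (m : 𝓢(V, ℂ)) : ℝ≥0∞ := ∫⁻ x, ‖𝓕⁻ m x‖ₑ

/-- The dilated function `ξ ↦ m (c ξ)`. -/
def dilate {c : ℝ} (hc : 0 < c) (m : 𝓢(V, ℂ)) : 𝓢(V, ℂ) :=
  SchwartzMap.compCLMOfContinuousLinearEquiv ℂ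
    (ContinuousLinearEquiv.smulLeft (Units.mk0 c hc.ne') : V ≃L[ℝ] V) m

@[simp] lemma dilate_apply {c : ℝ} (hc : 0 < c) (m : 𝓢(V, ℂ)) (ξ : V) :
    dilate hc m ξ = m (c • ξ) := rfl

lemma lintegral_enorm_lt_top (f : 𝓢(V, ℂ)) : ∫⁻ x, ‖f x‖ₑ < ∞ := by
  simpa [eLpNorm_one_eq_lintegral_enorm] using f.eLpNorm_lt_top 1

lemma kernelNorm_lt_top (m : 𝓢(V, ℂ)) : kernelNorm m < ∞ := lintegral_enorm_lt_top _

lemma fourierInv_dilate {c : ℝ} (hc : 0 < c) (m : 𝓢(V, ℂ)) (x : V) :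
    𝓕⁻ (dilate hc m) x = (c ^ Module.finrank ℝ V)⁻¹ • 𝓕⁻ m (c⁻¹ • x) := by
  rw [SchwartzMap.fourierInv_coe, SchwartzMap.fourierInv_coe, Real.fourierInv_eq, Real.fourierInv_eq]
  have h := Measure.integral_comp_smul_of_nonneg volume
    (fun v : V => 𝐞 (inner ℝ v (c⁻¹ • x)) • m v) c (hR := hc.le)
  rw [← h]
  congr 1
  funext v
  simp only [dilate_apply, inner_smul_left, inner_smul_right]
  congr 3
  simp [hc.ne']

lemma lintegral_comp_inv_smul {c : ℝ} (hc : 0 < c) (f : V → ℝ≥0∞) :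
    ∫⁻ x, f (c⁻¹ • x) = ENNReal.ofReal (c ^ Module.finrank ℝ V) * ∫⁻ x, f x := by
  have h1 : ∫⁻ x, f (c⁻¹ • x) = ∫⁻ y, f y ∂(Measure.map (fun x : V => c⁻¹ • x) volume) :=
    (lintegral_map_equiv f
      (Homeomorph.smulOfNeZero c⁻¹ (inv_ne_zero hc.ne')).toMeasurableEquiv).symm
  rw [h1, Measure.map_addHaar_smul _ (inv_ne_zero hc.ne'), lintegral_smul_measure]
  simp [abs_of_pos hc]

/-- The scaling of the `L^q` norms of kernels. For `q = 1` the norm is invariant under dilation, so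
that all dyadic blocks are bounded uniformly on `L^1` and `L^∞`. -/
lemma lintegral_enorm_fourierInv_dilate {c : ℝ} (hc : 0 < c) (m : 𝓢(V, ℂ)) {q : ℝ} (hq : 0 ≤ q) :
    ∫⁻ x, ‖𝓕⁻ (dilate hc m) x‖ₑ ^ q =
      ENNReal.ofReal (c ^ ((Module.finrank ℝ V : ℝ) * (1 - q))) * ∫⁻ x, ‖𝓕⁻ m x‖ₑ ^ q := by
  have h1 : ∀ x, ‖𝓕⁻ (dilate hc m) x‖ₑ ^ q =
      ENNReal.ofReal (c ^ (-(Module.finrank ℝ V : ℝ) * q)) * ‖𝓕⁻ m (c⁻¹ • x)‖ₑ ^ q := by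
    intro x
    rw [fourierInv_dilate, enorm_smul, ENNReal.mul_rpow_of_nonneg _ _ hq]
    congr 1
    rw [Real.enorm_of_nonneg (by positivity), ENNReal.ofReal_rpow_of_nonneg (by positivity) hq,
      Real.rpow_mul hc.le, Real.rpow_neg hc.le, Real.rpow_natCast]
  simp_rw [h1]
  rw [lintegral_const_mul' _ _ ENNReal.ofReal_ne_top,
    lintegral_comp_inv_smul hc (fun y => ‖𝓕⁻ m y‖ₑ ^ q), ← mul_assoc,
    ← ENNReal.ofReal_mul (by positivity), ← Real.rpow_natCast c, ← Real.rpow_add hc]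
  congr 3
  ring

lemma kernelNorm_dilate {c : ℝ} (hc : 0 < c) (m : 𝓢(V, ℂ)) :
    kernelNorm (dilate hc m) = kernelNorm m := by
  have h := lintegral_enorm_fourierInv_dilate hc m zero_le_one
  simpa [kernelNorm] using h

lemma kernelNorm_smul (c : ℂ) (m : 𝓢(V, ℂ)) : kernelNorm (c • m) = ‖c‖ₑ * kernelNorm m := by
  unfold kernelNorm
  rw [← lintegral_const_mul' _ _ enorm_ne_top]
  congr 1
  funext x
  rw [FourierTransform.fourierInv_smul, smul_apply, enorm_smul]

/-- A Fourier multiplier whose symbol factors through a linear map `P` is a convolution along the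
image of the adjoint `ι` of `P`. -/
lemma fourierMultiplier_comp_apply {P : E →L[ℝ] V} {ι : V →L[ℝ] E}
    (hι : ∀ v ξ, inner ℝ (ι v) ξ = inner ℝ v (P ξ)) (m : 𝓢(V, ℂ))
    (a : 𝓢(E, ℂ)) (x : E) :
    SchwartzMap.fourierMultiplierCLM ℂ (fun ξ => m (P ξ)) a x
      = ∫ v, 𝓕⁻ m v * a (x - ι v) := by
  -- Fourier inversion for both `m` and `a`, and Fubini's theorem.
  have hg : (fun ξ => m (P ξ)).HasTemperateGrowth :=
    m.hasTemperateGrowth.comp P.hasTemperateGrowth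
  have hm : ∀ ξ, m (P ξ) = ∫ v, 𝐞 (-inner ℝ v (P ξ)) • 𝓕⁻ m v := by
    intro ξ
    have h : 𝓕 (𝓕⁻ m) = m := FourierTransform.fourier_fourierInv_eq m
    conv_lhs => rw [← h]
    rw [SchwartzMap.fourier_coe, Real.fourier_eq]
  have ha : ∀ y, a y = ∫ ξ, 𝐞 (inner ℝ ξ y) • 𝓕 a ξ := by
    intro y
    have h : 𝓕⁻ (𝓕 a) = a := FourierTransform.fourierInv_fourier_eq a
    conv_lhs => rw [← h]
    rw [SchwartzMap.fourierInv_coe, Real.fourierInv_eq]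
  rw [SchwartzMap.fourierMultiplierCLM_apply, SchwartzMap.fourierInv_coe, Real.fourierInv_eq]
  have hL : ∀ ξ, 𝐞 (inner ℝ ξ x) • (SchwartzMap.smulLeftCLM ℂ (fun ξ => m (P ξ)) (𝓕 a)) ξ
      = ∫ v, ((𝐞 (inner ℝ ξ (x - ι v)) : Circle) : ℂ) * (𝓕⁻ m v * 𝓕 a ξ) := by
    intro ξ
    rw [SchwartzMap.smulLeftCLM_apply_apply hg, hm, smul_eq_mul, ← integral_mul_const,
      Circle.smul_def, smul_eq_mul, ← integral_const_mul]
    congr 1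
    funext v
    have h : inner ℝ ξ (ι v) = inner ℝ v (P ξ) := by rw [real_inner_comm, hι]
    rw [inner_sub_right, h, sub_eq_add_neg, AddChar.map_add_eq_mul,
      Circle.smul_def, Circle.coe_mul, smul_eq_mul]
    ring
  have hR : ∀ v, 𝓕⁻ m v * a (x - ι v)
      = ∫ ξ, ((𝐞 (inner ℝ ξ (x - ι v)) : Circle) : ℂ) * (𝓕⁻ m v * 𝓕 a ξ) := by
    intro v
    rw [ha, ← integral_const_mul]
    congr 1
    funext ξ
    rw [Circle.smul_def, smul_eq_mul]
    ring
  simp_rw [hL, hR]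
  rw [integral_integral_swap]
  have h1 : Integrable (fun z : E × V => 𝓕⁻ m z.2 * 𝓕 a z.1) (volume.prod volume) := by
    have := (𝓕 a).integrable.mul_prod (𝓕⁻ m).integrable (μ := (volume : Measure E))
      (ν := (volume : Measure V))
    simpa only [mul_comm] using this
  refine (h1.norm).mono' ?_ (Eventually.of_forall fun z => ?_)
  · refine AEStronglyMeasurable.mul ?_ h1.aestronglyMeasurable
    refine Continuous.aestronglyMeasurable ?_
    exact continuous_subtype_val.comp (Real.continuous_fourierChar.comp (by fun_prop))
  · rw [Function.uncurry_apply_pair, norm_mul, Circle.norm_coe, one_mul]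

/-- Fourier multipliers with Schwartz symbol are convolutions with the kernel. -/
lemma fourierMultiplier_apply (m : 𝓢(V, ℂ)) (a : 𝓢(V, ℂ)) (x : V) :
    SchwartzMap.fourierMultiplierCLM ℂ m a x = ∫ v, 𝓕⁻ m v * a (x - v) :=
  fourierMultiplier_comp_apply (P := ContinuousLinearMap.id ℝ V)
    (ι := ContinuousLinearMap.id ℝ V) (fun _ _ => rfl) m a x

lemma enorm_fourierMultiplier_comp_le {P : E →L[ℝ] V} {ι : V →L[ℝ] E}
    (hι : ∀ v ξ, inner ℝ (ι v) ξ = inner ℝ v (P ξ)) (m : 𝓢(V, ℂ))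
    (a : 𝓢(E, ℂ)) (x : E) :
    ‖SchwartzMap.fourierMultiplierCLM ℂ (fun ξ => m (P ξ)) a x‖ₑ
      ≤ ∫⁻ v, ‖𝓕⁻ m v‖ₑ * ‖a (x - ι v)‖ₑ := by
  rw [fourierMultiplier_comp_apply hι]
  refine (enorm_integral_le_lintegral_enorm _).trans_eq ?_
  simp only [enorm_mul]

/-- Fourier multipliers act on `L^∞`. -/
lemma enorm_fourierMultiplier_le (m a : 𝓢(V, ℂ)) {C : ℝ≥0∞} (hC : ∀ x, ‖a x‖ₑ ≤ C) (x : V) :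
    ‖SchwartzMap.fourierMultiplierCLM ℂ m a x‖ₑ ≤ kernelNorm m * C := by
  refine (enorm_fourierMultiplier_comp_le (P := ContinuousLinearMap.id ℝ V)
    (ι := ContinuousLinearMap.id ℝ V) (fun _ _ => rfl) m a x).trans ?_
  rw [kernelNorm, ← lintegral_mul_const'' _ (𝓕⁻ m).continuous.enorm.aemeasurable]
  gcongr
  exact hC _

/-- Fourier multipliers act on `L¹`. -/
lemma lintegral_enorm_fourierMultiplier_le (m a : 𝓢(V, ℂ)) :
    ∫⁻ x, ‖SchwartzMap.fourierMultiplierCLM ℂ m a x‖ₑ ≤ kernelNorm m * ∫⁻ x, ‖a x‖ₑ := by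
  calc ∫⁻ x, ‖SchwartzMap.fourierMultiplierCLM ℂ m a x‖ₑ
      ≤ ∫⁻ x, ∫⁻ v, ‖𝓕⁻ m v‖ₑ * ‖a (x - v)‖ₑ := by
        gcongr with x
        exact enorm_fourierMultiplier_comp_le (P := ContinuousLinearMap.id ℝ V)
          (ι := ContinuousLinearMap.id ℝ V) (fun _ _ => rfl) m a x
    _ = ∫⁻ v, ∫⁻ x, ‖𝓕⁻ m v‖ₑ * ‖a (x - v)‖ₑ := by
        apply lintegral_lintegral_swap
        apply Continuous.aemeasurable
        refine Continuous.comp (g := fun p : ℂ × ℂ => ‖p.1‖ₑ * ‖p.2‖ₑ)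
          (f := fun z : V × V => (𝓕⁻ m z.2, a (z.1 - z.2))) ?_ ?_
        · have : (fun p : ℂ × ℂ => ‖p.1‖ₑ * ‖p.2‖ₑ) = fun p => ‖p.1 * p.2‖ₑ := by
            funext p; rw [enorm_mul]
          rw [this]; fun_prop
        · fun_prop
    _ = ∫⁻ v, ‖𝓕⁻ m v‖ₑ * ∫⁻ x, ‖a x‖ₑ := by
        congr 1
        funext v
        rw [lintegral_const_mul' _ _ enorm_ne_top, lintegral_sub_right_eq_self (fun x => ‖a x‖ₑ) v]
    _ = _ := by
        rw [lintegral_mul_const'' _ (𝓕⁻ m).continuous.enorm.aemeasurable, kernelNorm]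

/-- Fourier multipliers map `L¹` to `L^∞`. -/
lemma enorm_fourierMultiplier_le_lintegral (m a : 𝓢(V, ℂ)) {C : ℝ≥0∞}
    (hC : ∀ x, ‖𝓕⁻ m x‖ₑ ≤ C) (x : V) :
    ‖SchwartzMap.fourierMultiplierCLM ℂ m a x‖ₑ ≤ C * ∫⁻ x, ‖a x‖ₑ := by
  refine (enorm_fourierMultiplier_comp_le (P := ContinuousLinearMap.id ℝ V)
    (ι := ContinuousLinearMap.id ℝ V) (fun _ _ => rfl) m a x).trans ?_
  calc ∫⁻ v, ‖𝓕⁻ m v‖ₑ * ‖a (x - v)‖ₑ ≤ ∫⁻ v, C * ‖a (x - v)‖ₑ := by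
        gcongr with v; exact hC v
    _ = C * ∫⁻ x, ‖a x‖ₑ := by
        rw [lintegral_const_mul'' _ (by fun_prop), lintegral_sub_left_eq_self (fun x => ‖a x‖ₑ) x]

end Kernel

/-! ### Tempered distributions and convolution integrals -/

section Exchange

variable {E : Type*} [NormedAddCommGroup E] [InnerProductSpace ℝ E] [FiniteDimensional ℝ E]
  [MeasurableSpace E] [BorelSpace E]

variable (E) in
/-- The space of jets of order `N` of complex functions on `E`, with the supremum norm. -/
def JetSpace (N : ℕ) : Type _ := (n : Fin (N + 1)) → (E [×(n : ℕ)]→L[ℝ] ℂ)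

instance (N : ℕ) : NormedAddCommGroup (JetSpace E N) :=
  inferInstanceAs (NormedAddCommGroup ((n : Fin (N + 1)) → (E [×(n : ℕ)]→L[ℝ] ℂ)))

instance (N : ℕ) : NormedSpace ℂ (JetSpace E N) :=
  inferInstanceAs (NormedSpace ℂ ((n : Fin (N + 1)) → (E [×(n : ℕ)]→L[ℝ] ℂ)))

instance (N : ℕ) : CompleteSpace (JetSpace E N) :=
  inferInstanceAs (CompleteSpace ((n : Fin (N + 1)) → (E [×(n : ℕ)]→L[ℝ] ℂ)))

/-- The component of order `n` of a jet. -/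
def JetSpace.proj {N : ℕ} (n : Fin (N + 1)) : JetSpace E N →L[ℂ] (E [×(n : ℕ)]→L[ℝ] ℂ) :=
  ContinuousLinearMap.proj (R := ℂ) (φ := fun n : Fin (N + 1) => (E [×(n : ℕ)]→L[ℝ] ℂ)) n

lemma JetSpace.norm_le_iff {N : ℕ} {C : ℝ} (hC : 0 ≤ C) (w : JetSpace E N) :
    ‖w‖ ≤ C ↔ ∀ n, ‖JetSpace.proj n w‖ ≤ C :=
  pi_norm_le_iff_of_nonneg (x := (w : (n : Fin (N + 1)) → (E [×(n : ℕ)]→L[ℝ] ℂ))) hC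

lemma JetSpace.ext {N : ℕ} {v w : JetSpace E N} (h : ∀ n, JetSpace.proj n v = JetSpace.proj n w) :
    v = w := funext h

/-- The weighted jet `x ↦ (1 + |x|)^N (f(x), Df(x), …, D^N f(x))` of a Schwartz function. -/
def weightedJetFun (N : ℕ) (f : 𝓢(E, ℂ)) (x : E) : JetSpace E N :=
  fun n => ((1 + ‖x‖) ^ N : ℝ) • iteratedFDeriv ℝ (n : ℕ) f x

lemma proj_weightedJetFun (N : ℕ) (f : 𝓢(E, ℂ)) (x : E) (n : Fin (N + 1)) :
    JetSpace.proj n (weightedJetFun N f x) =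
      ((1 + ‖x‖) ^ N : ℝ) • iteratedFDeriv ℝ (n : ℕ) f x := rfl

lemma continuous_weightedJetFun (N : ℕ) (f : 𝓢(E, ℂ)) : Continuous (weightedJetFun N f) := by
  refine continuous_pi fun n => ?_
  have h : Continuous (iteratedFDeriv ℝ (n : ℕ) f) :=
    (f.smooth ⊤).continuous_iteratedFDeriv (mod_cast le_top)
  have h2 : Continuous fun x : E => ((1 + ‖x‖) ^ N : ℝ) := by fun_prop
  exact h2.smul h

/-- The sum of the Schwartz seminorms of order at most `(N, N)`, up to a constant. -/
def jetBound (N : ℕ) (f : 𝓢(E, ℂ)) : ℝ :=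
  2 ^ N * (Finset.Iic (N, N)).sup (fun m => SchwartzMap.seminorm ℝ m.1 m.2) f

lemma jetBound_nonneg (N : ℕ) (f : 𝓢(E, ℂ)) : 0 ≤ jetBound N f := by
  unfold jetBound
  positivity

lemma le_jetBound {N n : ℕ} (hn : n ≤ N) (f : 𝓢(E, ℂ)) (x : E) :
    (1 + ‖x‖) ^ N * ‖iteratedFDeriv ℝ n f x‖ ≤ jetBound N f :=
  SchwartzMap.one_add_le_sup_seminorm_apply (m := (N, N)) le_rfl hn f x

lemma norm_weightedJetFun_le (N : ℕ) (f : 𝓢(E, ℂ)) (x : E) :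
    ‖weightedJetFun N f x‖ ≤ jetBound N f := by
  refine (JetSpace.norm_le_iff (jetBound_nonneg N f) _).2 fun n => ?_
  rw [proj_weightedJetFun, norm_smul, Real.norm_of_nonneg (by positivity)]
  exact le_jetBound (Nat.lt_succ_iff.1 n.2) f x

/-- `weightedJetFun` as a linear map to bounded continuous functions. Its norm dominates the
Schwartz seminorms of order at most `(N, N)`. -/
def weightedJet (N : ℕ) : 𝓢(E, ℂ) →ₗ[ℂ] BoundedContinuousFunction E (JetSpace E N) where
  toFun f := BoundedContinuousFunction.ofNormedAddCommGroup (weightedJetFun N f)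
    (continuous_weightedJetFun N f) (jetBound N f) (norm_weightedJetFun_le N f)
  map_add' f g := by
    refine BoundedContinuousFunction.ext fun x => JetSpace.ext fun n => ?_
    have h : iteratedFDeriv ℝ (n : ℕ) (⇑(f + g)) x =
        iteratedFDeriv ℝ (n : ℕ) f x + iteratedFDeriv ℝ (n : ℕ) g x := by
      rw [FunLike.coe_add]
      exact iteratedFDeriv_add_apply (f.contDiffAt n) (g.contDiffAt n)
    simp only [BoundedContinuousFunction.coe_ofNormedAddCommGroup, proj_weightedJetFun, h, smul_add,
      BoundedContinuousFunction.coe_add, Pi.add_apply, map_add]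
  map_smul' c f := by
    refine BoundedContinuousFunction.ext fun x => JetSpace.ext fun n => ?_
    have h : iteratedFDeriv ℝ (n : ℕ) (⇑(c • f)) x = c • iteratedFDeriv ℝ (n : ℕ) f x := by
      rw [FunLike.coe_smul]
      exact iteratedFDeriv_const_smul_apply (f.contDiffAt n)
    simp only [BoundedContinuousFunction.coe_ofNormedAddCommGroup, proj_weightedJetFun, h,
      BoundedContinuousFunction.coe_smul, map_smul, RingHom.id_apply]
    rw [smul_comm]

lemma weightedJet_apply (N : ℕ) (f : 𝓢(E, ℂ)) (x : E) :
    weightedJet N f x = weightedJetFun N f x := rfl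

lemma norm_iteratedFDeriv_le_weightedJet {N n : ℕ} (hn : n ≤ N) (f : 𝓢(E, ℂ)) (x : E) :
    (1 + ‖x‖) ^ N * ‖iteratedFDeriv ℝ n f x‖ ≤ ‖weightedJet N f‖ := by
  have h1 := ((JetSpace.norm_le_iff (norm_nonneg (weightedJet N f)) _).1
    ((weightedJet N f).norm_coe_le_norm x)) ⟨n, Nat.lt_succ_iff.2 hn⟩
  rwa [weightedJet_apply, proj_weightedJetFun, norm_smul, Real.norm_of_nonneg (by positivity)] at h1

lemma seminorm_le_weightedJet {N k n : ℕ} (hk : k ≤ N) (hn : n ≤ N) (f : 𝓢(E, ℂ)) :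
    SchwartzMap.seminorm ℂ k n f ≤ ‖weightedJet N f‖ := by
  refine SchwartzMap.seminorm_le_bound ℂ k n f (norm_nonneg _) fun x => ?_
  refine le_trans ?_ (norm_iteratedFDeriv_le_weightedJet hn f x)
  gcongr
  calc ‖x‖ ^ k ≤ (1 + ‖x‖) ^ k := by gcongr; linarith
    _ ≤ (1 + ‖x‖) ^ N := pow_le_pow_right₀ (by linarith [norm_nonneg x]) hk

lemma weightedJet_injective (N : ℕ) : Function.Injective (weightedJet (E := E) N) := by
  rw [← LinearMap.ker_eq_bot, LinearMap.ker_eq_bot']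
  intro f hf
  ext x
  have h := norm_iteratedFDeriv_le_weightedJet (Nat.zero_le N) f x
  rw [hf, norm_zero, norm_iteratedFDeriv_zero] at h
  have h3 : ‖f x‖ ≤ 0 := by
    by_contra h4
    have : 0 < (1 + ‖x‖) ^ N * ‖f x‖ := by
      have := not_le.1 h4
      positivity
    linarith
  simpa using h3

/-- A tempered distribution is a continuous functional of the weighted jet of some order. By the
Hahn-Banach theorem this functional is defined on the whole Banach space of bounded continuous jet
fields, where Bochner integrals are available. -/
lemma exists_eq_comp_weightedJet (u : 𝓢'(E, ℂ)) :
    ∃ (N : ℕ) (T : BoundedContinuousFunction E (JetSpace E N) →L[ℂ] ℂ),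
      ∀ f, u f = T (weightedJet N f) := by
  obtain ⟨s, C, -, hC⟩ := Seminorm.bound_of_continuous (schwartz_withSeminorms ℂ E ℂ)
    ((normSeminorm ℂ ℂ).comp (u : 𝓢(E, ℂ) →ₗ[ℂ] ℂ)) (by
      exact continuous_norm.comp u.continuous)
  let N : ℕ := s.sup fun i => max i.1 i.2
  have hN : ∀ f, ‖u f‖ ≤ C * ‖weightedJet N f‖ := by
    intro f
    refine (hC f).trans ?_
    rw [smul_apply, NNReal.smul_def, smul_eq_mul]
    gcongr
    refine Seminorm.finset_sup_apply_le (norm_nonneg _) fun i hi => ?_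
    have h1 : max i.1 i.2 ≤ N := Finset.le_sup (f := fun i : ℕ × ℕ => max i.1 i.2) hi
    exact seminorm_le_weightedJet ((le_max_left _ _).trans h1) ((le_max_right _ _).trans h1) f
  let e := LinearEquiv.ofInjective (weightedJet (E := E) N) (weightedJet_injective N)
  let g : LinearMap.range (weightedJet (E := E) N) →L[ℂ] ℂ :=
    LinearMap.mkContinuous ((u : 𝓢(E, ℂ) →ₗ[ℂ] ℂ) ∘ₗ (e.symm : _ →ₗ[ℂ] 𝓢(E, ℂ))) C (by
      intro x
      obtain ⟨f, rfl⟩ := e.surjective x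
      simpa [e] using hN f)
  obtain ⟨T, hT, -⟩ := exists_extension_norm_eq _ g
  refine ⟨N, T, fun f => ?_⟩
  have h1 := hT (e f)
  have h2 : g (e f) = u f := by
    change u (e.symm (e f)) = u f
    rw [e.symm_apply_apply]
  rw [← h2, ← h1]
  rfl

lemma iteratedFDeriv_translate (K : 𝓢(E, ℂ)) (n : ℕ) (y x : E) :
    iteratedFDeriv ℝ n (K.compSubConstCLM ℂ y) x = iteratedFDeriv ℝ n K (x - y) := by
  have : (⇑(K.compSubConstCLM ℂ y) : E → ℂ) = fun z => K (z - y) := by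
    funext z; simp
  rw [this, iteratedFDeriv_comp_sub]

lemma one_add_norm_pow_le (N : ℕ) (x y : E) :
    (1 + ‖x‖) ^ N ≤ (1 + ‖y‖) ^ N * (1 + ‖x - y‖) ^ N := by
  rw [← mul_pow]
  gcongr
  have := norm_add_le (x - y) y
  rw [sub_add_cancel] at this
  nlinarith [norm_nonneg y, norm_nonneg (x - y)]

lemma norm_weightedJet_translate_le (N : ℕ) (K : 𝓢(E, ℂ)) (y : E) :
    ‖weightedJet N (K.compSubConstCLM ℂ y)‖ ≤ jetBound N K * (1 + ‖y‖) ^ N := by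
  have h0 := jetBound_nonneg N K
  refine (BoundedContinuousFunction.norm_le (by positivity)).2 fun x => ?_
  refine (JetSpace.norm_le_iff (by positivity) _).2 fun n => ?_
  rw [weightedJet_apply, proj_weightedJetFun, norm_smul, Real.norm_of_nonneg (by positivity),
    iteratedFDeriv_translate]
  calc (1 + ‖x‖) ^ N * ‖iteratedFDeriv ℝ n K (x - y)‖
      ≤ ((1 + ‖y‖) ^ N * (1 + ‖x - y‖) ^ N) * ‖iteratedFDeriv ℝ n K (x - y)‖ := by
        gcongr; exact one_add_norm_pow_le N x y
    _ = ((1 + ‖x - y‖) ^ N * ‖iteratedFDeriv ℝ n K (x - y)‖) * (1 + ‖y‖) ^ N := by ring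
    _ ≤ _ := by gcongr; exact le_jetBound (Nat.lt_succ_iff.1 n.2) K _

/-- The mean value inequality for translates, with a weight `c` that does not depend on the
translation. -/
lemma norm_smul_translate_sub_le {W : Type*} [NormedAddCommGroup W] [NormedSpace ℝ W]
    {A : E → W} (hA : Differentiable ℝ A) (x y₀ : E) (c : ℝ) (hc : 0 ≤ c) {C : ℝ}
    (hb : ∀ z ∈ Metric.ball y₀ 1, c * ‖fderiv ℝ A (x - z)‖ ≤ C) {y : E}
    (hy : y ∈ Metric.ball y₀ 1) :
    ‖c • A (x - y) - c • A (x - y₀)‖ ≤ C * ‖y - y₀‖ := by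
  have hd : ∀ z ∈ Metric.ball y₀ 1, HasFDerivWithinAt (fun z => c • A (x - z))
      (c • ((fderiv ℝ A (x - z)).comp (-ContinuousLinearMap.id ℝ E))) (Metric.ball y₀ 1) z := by
    intro z _
    have h1 : HasFDerivAt A (fderiv ℝ A (x - z)) (x - z) := (hA (x - z)).hasFDerivAt
    exact ((h1.comp z ((hasFDerivAt_id z).const_sub x)).const_smul c).hasFDerivWithinAt
  refine (convex_ball y₀ (1 : ℝ)).norm_image_sub_le_of_norm_hasFDerivWithin_le hd (fun z hz => ?_)
    (Metric.mem_ball_self one_pos) hy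
  rw [norm_smul, Real.norm_of_nonneg hc, ContinuousLinearMap.comp_neg, norm_neg,
    ContinuousLinearMap.comp_id]
  exact hb z hz

lemma continuous_weightedJet_translate (N : ℕ) (K : 𝓢(E, ℂ)) :
    Continuous fun y => weightedJet N (K.compSubConstCLM ℂ y) := by
  rw [continuous_iff_continuousAt]
  intro y₀
  have h0 := jetBound_nonneg (N + 1) K
  set C : ℝ := (2 + ‖y₀‖) ^ N * jetBound (N + 1) K with hC
  have hlip : ∀ y ∈ Metric.ball y₀ 1, ‖weightedJet N (K.compSubConstCLM ℂ y) -
      weightedJet N (K.compSubConstCLM ℂ y₀)‖ ≤ C * ‖y - y₀‖ := by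
    intro y hy
    refine (BoundedContinuousFunction.norm_le (by positivity)).2 fun x => ?_
    refine (JetSpace.norm_le_iff (by positivity) _).2 fun n => ?_
    have hdiff : Differentiable ℝ (iteratedFDeriv ℝ n K) :=
      (K.smooth ⊤).differentiable_iteratedFDeriv (m := n) (by exact_mod_cast ENat.natCast_lt_top _)
    have key := norm_smul_translate_sub_le hdiff x y₀ ((1 + ‖x‖) ^ N) (by positivity) (C := C) ?_ hy
    · simpa only [BoundedContinuousFunction.coe_sub, Pi.sub_apply, weightedJet_apply, map_sub,
        proj_weightedJetFun, iteratedFDeriv_translate] using key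
    · intro z hz
      rw [norm_fderiv_iteratedFDeriv]
      have hz' : ‖z‖ ≤ 1 + ‖y₀‖ := by
        have h1 := norm_add_le (z - y₀) y₀
        rw [sub_add_cancel] at h1
        rw [mem_ball_iff_norm] at hz
        linarith
      calc (1 + ‖x‖) ^ N * ‖iteratedFDeriv ℝ (n + 1) K (x - z)‖
          ≤ ((1 + ‖z‖) ^ N * (1 + ‖x - z‖) ^ N) * ‖iteratedFDeriv ℝ (n + 1) K (x - z)‖ := by
            gcongr; exact one_add_norm_pow_le N x z
        _ ≤ ((2 + ‖y₀‖) ^ N * (1 + ‖x - z‖) ^ (N + 1)) *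
              ‖iteratedFDeriv ℝ (n + 1) K (x - z)‖ := by
            gcongr ?_ ^ N * ?_ * _
            · linarith
            · exact pow_le_pow_right₀ (by linarith [norm_nonneg (x - z)]) (Nat.le_succ N)
        _ = (2 + ‖y₀‖) ^ N * ((1 + ‖x - z‖) ^ (N + 1) *
              ‖iteratedFDeriv ℝ (n + 1) K (x - z)‖) := by ring
        _ ≤ C := by
            rw [hC]
            gcongr
            exact le_jetBound (Nat.succ_le_succ (Nat.lt_succ_iff.1 n.2)) K _
  rw [ContinuousAt, tendsto_iff_norm_sub_tendsto_zero]
  refine squeeze_zero' (Eventually.of_forall fun _ => norm_nonneg _)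
    (Filter.mem_of_superset (Metric.ball_mem_nhds y₀ one_pos) hlip) ?_
  have : Continuous fun y : E => C * ‖y - y₀‖ := by fun_prop
  simpa using this.tendsto y₀

lemma hasFDerivAt_integral_translate {W : Type*} [NormedAddCommGroup W] [NormedSpace ℂ W]
    [NormedSpace ℝ W] [IsScalarTower ℝ ℂ W]
    {A : E → W} (hA : ContDiff ℝ 1 A) {C : ℝ} (hC : ∀ x, ‖A x‖ ≤ C)
    (hC' : ∀ x, ‖fderiv ℝ A x‖ ≤ C) (ψ : 𝓢(E, ℂ)) (x : E) :
    HasFDerivAt (fun x => ∫ y, ψ y • A (x - y)) (∫ y, ψ y • fderiv ℝ A (x - y)) x := by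
  have hcA : Continuous A := hA.continuous
  have hcA' : Continuous (fderiv ℝ A) := hA.continuous_fderiv (by norm_num)
  have hm1 : ∀ x, AEStronglyMeasurable (fun y => ψ y • A (x - y)) volume := fun x =>
    (ψ.continuous.smul (hcA.comp (by fun_prop))).aestronglyMeasurable
  have hm2 : AEStronglyMeasurable (fun y => ψ y • fderiv ℝ A (x - y)) volume :=
    (ψ.continuous.smul (hcA'.comp (by fun_prop))).aestronglyMeasurable
  have hint : Integrable (fun y => ‖ψ y‖ * C) volume := ψ.integrable.norm.mul_const C
  refine hasFDerivAt_integral_of_dominated_of_fderiv_le (s := Set.univ) (bound := fun y => ‖ψ y‖ * C)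
    (F' := fun x y => ψ y • fderiv ℝ A (x - y)) Filter.univ_mem
    (Eventually.of_forall hm1) ?_ hm2 ?_ hint ?_
  · refine hint.mono' (hm1 x) (Eventually.of_forall fun y => ?_)
    rw [norm_smul]
    gcongr
    exact hC _
  · refine Eventually.of_forall fun y z _ => ?_
    rw [norm_smul]
    gcongr
    exact hC' _
  · refine Eventually.of_forall fun y z _ => ?_
    have h1 : HasFDerivAt A (fderiv ℝ A (z - y)) (z - y) :=
      (hA.differentiable (by norm_num) (z - y)).hasFDerivAt
    have h2 := h1.comp z ((hasFDerivAt_id z).sub_const y)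
    rw [ContinuousLinearMap.comp_id] at h2
    exact h2.const_smul (ψ y)

lemma fderiv_integral_translate_apply {W : Type*} [NormedAddCommGroup W] [NormedSpace ℂ W]
    [NormedSpace ℝ W] [IsScalarTower ℝ ℂ W]
    {A : E → W} (hA : ContDiff ℝ 1 A) {C : ℝ} (hC : ∀ x, ‖A x‖ ≤ C)
    (hC' : ∀ x, ‖fderiv ℝ A x‖ ≤ C) (ψ : 𝓢(E, ℂ)) (x v : E) :
    Integrable (fun y => ψ y • fderiv ℝ A (x - y) v) volume ∧
    fderiv ℝ (fun x => ∫ y, ψ y • A (x - y)) x v = ∫ y, ψ y • fderiv ℝ A (x - y) v := by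
  have hcA' : Continuous (fderiv ℝ A) := hA.continuous_fderiv (by norm_num)
  have hI : Integrable (fun y => ψ y • fderiv ℝ A (x - y)) volume := by
    refine (ψ.integrable.norm.mul_const C).mono'
      (ψ.continuous.smul (hcA'.comp (by fun_prop))).aestronglyMeasurable
      (Eventually.of_forall fun y => ?_)
    rw [norm_smul]
    gcongr
    exact hC' _
  rw [(hasFDerivAt_integral_translate hA hC hC' ψ x).fderiv, ContinuousLinearMap.integral_apply hI]
  exact ⟨hI.apply_continuousLinearMap v, rfl⟩

lemma iteratedFDeriv_integral_translate (K ψ : 𝓢(E, ℂ)) (n : ℕ) :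
    ∀ x, iteratedFDeriv ℝ n (fun x => ∫ y, ψ y • K (x - y)) x =
      ∫ y, ψ y • iteratedFDeriv ℝ n K (x - y) := by
  have hc : ∀ n, Continuous (iteratedFDeriv ℝ n K) := fun n =>
    (K.smooth ⊤).continuous_iteratedFDeriv (mod_cast le_top)
  have hint : ∀ n x, Integrable (fun y => ψ y • iteratedFDeriv ℝ n K (x - y)) volume := by
    intro n x
    obtain ⟨C, -, hC⟩ := K.decay 0 n
    refine (ψ.integrable.norm.mul_const C).mono'
      (ψ.continuous.smul ((hc n).comp (by fun_prop))).aestronglyMeasurable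
      (Eventually.of_forall fun y => ?_)
    rw [norm_smul]
    gcongr
    simpa using hC (x - y)
  induction n with
  | zero =>
    intro x
    have h := (continuousMultilinearCurryFin0 ℝ E ℂ).symm.toContinuousLinearEquiv.integral_comp_comm
      (μ := volume) (fun y => ψ y • K (x - y))
    refine Eq.trans ?_ (h.symm.trans ?_)
    · rfl
    · congr 1
  | succ n ih =>
    intro x
    have h1 : iteratedFDeriv ℝ n (fun x => ∫ y, ψ y • K (x - y)) =
      fun x => ∫ y, ψ y • iteratedFDeriv ℝ n K (x - y) := funext ih
    obtain ⟨C, -, hC⟩ := K.decay 0 n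
    obtain ⟨C', -, hC'⟩ := K.decay 0 (n + 1)
    ext m
    obtain ⟨hI, h2⟩ := fderiv_integral_translate_apply (A := iteratedFDeriv ℝ n K) (C := max C C')
      ((K.smooth ⊤).iteratedFDeriv_right (m := 1) (i := n) (by exact_mod_cast le_top))
      (fun x => (by simpa using hC x : ‖_‖ ≤ C).trans (le_max_left _ _))
      (fun x => by
        rw [norm_fderiv_iteratedFDeriv]
        exact (by simpa using hC' x : ‖_‖ ≤ C').trans (le_max_right _ _)) ψ x (m 0)
    rw [iteratedFDeriv_succ_apply_left, h1, h2, ContinuousMultilinearMap.integral_apply hI,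
      ContinuousMultilinearMap.integral_apply (hint (n + 1) x)]
    rfl

/-- The function `y ↦ u(K(· - y))` is continuous. -/
lemma continuous_apply_translate (u : 𝓢'(E, ℂ)) (K : 𝓢(E, ℂ)) :
    Continuous fun y => u (K.compSubConstCLM ℂ y) := by
  obtain ⟨N, T, hT⟩ := exists_eq_comp_weightedJet u
  simp_rw [hT]
  exact T.continuous.comp (continuous_weightedJet_translate N K)

/-- A tempered distribution commutes with the convolution integral: the weighted jet of the
convolution is the Bochner integral of the weighted jets of the translates, and a continuous linear
functional commutes with the Bochner integral. -/
lemma apply_eq_integral_translate (u : 𝓢'(E, ℂ)) (K ψ h : 𝓢(E, ℂ))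
    (hh : ∀ x, h x = ∫ y, ψ y * K (x - y)) :
    u h = ∫ y, ψ y * u (K.compSubConstCLM ℂ y) := by
  obtain ⟨N, T, hT⟩ := exists_eq_comp_weightedJet u
  have hcont := continuous_weightedJet_translate N K
  have hint : Integrable (fun y => ψ y • weightedJet N (K.compSubConstCLM ℂ y)) volume := by
    have h1 : Integrable (fun y : E => 2 ^ N * jetBound N K * (‖ψ y‖ + ‖y‖ ^ N * ‖ψ y‖)) volume :=
      (ψ.integrable.norm.add (ψ.integrable_pow_mul volume N)).const_mul _
    refine h1.mono' (ψ.continuous.smul hcont).aestronglyMeasurable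
      (Eventually.of_forall fun y => ?_)
    rw [norm_smul]
    have h2 : (1 + ‖y‖) ^ N ≤ 2 ^ N * (1 + ‖y‖ ^ N) := by
      have h3 := add_pow_le (zero_le_one) (norm_nonneg y) N
      rw [one_pow] at h3
      refine h3.trans ?_
      gcongr
      · norm_num
      · omega
    calc ‖ψ y‖ * ‖weightedJet N (K.compSubConstCLM ℂ y)‖
        ≤ ‖ψ y‖ * (jetBound N K * (2 ^ N * (1 + ‖y‖ ^ N))) := by
          gcongr
          refine (norm_weightedJet_translate_le N K y).trans ?_
          gcongr
          exact jetBound_nonneg N K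
      _ = _ := by ring
  have hJ : weightedJet N h = ∫ y, ψ y • weightedJet N (K.compSubConstCLM ℂ y) := by
    refine BoundedContinuousFunction.ext fun x => JetSpace.ext fun n => ?_
    have h1 := ((JetSpace.proj n).comp
      (BoundedContinuousFunction.evalCLM ℂ x)).integral_comp_comm hint
    refine Eq.trans ?_ h1
    have h2 : (h : E → ℂ) = fun x => ∫ y, ψ y • K (x - y) := funext hh
    rw [weightedJet_apply, proj_weightedJetFun, h2, iteratedFDeriv_integral_translate,
      ← integral_smul]
    congr 1
    funext y
    simp only [ContinuousLinearMap.comp_apply, BoundedContinuousFunction.evalCLM_apply, map_smul,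
      weightedJet_apply, proj_weightedJetFun, iteratedFDeriv_translate]
    rw [smul_comm]
  rw [hT, hJ, ← T.integral_comp_comm hint]
  congr 1
  funext y
  rw [map_smul, hT, smul_eq_mul]

end Exchange

/-! ### Fourier multipliers on tempered distributions -/

section Distribution

variable {E : Type*} [NormedAddCommGroup E] [InnerProductSpace ℝ E] [FiniteDimensional ℝ E]
  [MeasurableSpace E] [BorelSpace E]

lemma fourierInv_neg_apply (f : 𝓢(E, ℂ)) (ξ : E) : 𝓕⁻ f (-ξ) = 𝓕 f ξ := by
  rw [SchwartzMap.fourierInv_apply_eq]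
  simp

lemma fourierInv_eq_fourier_of_even {m : 𝓢(E, ℂ)} (hm : ∀ ξ, m (-ξ) = m ξ) : 𝓕⁻ m = 𝓕 m := by
  ext x
  rw [SchwartzMap.fourierInv_coe, SchwartzMap.fourier_coe, Real.fourierInv_eq, Real.fourier_eq,
    ← integral_neg_eq_self]
  congr 1
  funext v
  rw [hm, inner_neg_left]

lemma fourierInv_even {m : 𝓢(E, ℂ)} (hm : ∀ ξ, m (-ξ) = m ξ) (x : E) : 𝓕⁻ m (-x) = 𝓕⁻ m x := by
  rw [fourierInv_neg_apply, fourierInv_eq_fourier_of_even hm]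

/-- Multipliers with even symbol are their own transposes. -/
lemma fourierMultiplier_apply_of_even {g : E → ℂ} (hg : g.HasTemperateGrowth)
    (hev : ∀ ξ, g (-ξ) = g ξ) (u : 𝓢'(E, ℂ)) (ψ : 𝓢(E, ℂ)) :
    TemperedDistribution.fourierMultiplierCLM ℂ g u ψ =
      u (SchwartzMap.fourierMultiplierCLM ℂ g ψ) := by
  rw [TemperedDistribution.fourierMultiplierCLM_apply_apply,
    SchwartzMap.fourierMultiplierCLM_apply]
  congr 1
  ext x
  rw [SchwartzMap.fourierInv_coe, SchwartzMap.fourier_coe, Real.fourierInv_eq, Real.fourier_eq,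
    ← integral_neg_eq_self]
  congr 1
  funext v
  rw [inner_neg_left, neg_neg, SchwartzMap.smulLeftCLM_apply_apply hg,
    SchwartzMap.smulLeftCLM_apply_apply hg, hev, fourierInv_neg_apply]

lemma lintegral_enorm_translate (ψ : 𝓢(E, ℂ)) (y : E) :
    ∫⁻ x, ‖ψ.compSubConstCLM ℂ y x‖ₑ = ∫⁻ x, ‖ψ x‖ₑ := by
  simp only [SchwartzMap.compSubConstCLM_apply]
  exact lintegral_sub_right_eq_self (fun x => ‖ψ x‖ₑ) y

lemma fourierMultiplier_translate (m ψ : 𝓢(E, ℂ)) (y : E) :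
    SchwartzMap.fourierMultiplierCLM ℂ m (ψ.compSubConstCLM ℂ y) =
      (SchwartzMap.fourierMultiplierCLM ℂ m ψ).compSubConstCLM ℂ y := by
  ext x
  rw [SchwartzMap.compSubConstCLM_apply, fourierMultiplier_apply, fourierMultiplier_apply]
  congr 1
  funext v
  rw [SchwartzMap.compSubConstCLM_apply, sub_right_comm]

lemma fourierMultiplier_fourierInv (m₁ m₂ m : 𝓢(E, ℂ)) (h : ∀ ξ, m ξ = m₁ ξ * m₂ ξ) :
    SchwartzMap.fourierMultiplierCLM ℂ m₁ (𝓕⁻ m₂) = 𝓕⁻ m := by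
  rw [SchwartzMap.fourierMultiplierCLM_apply, FourierTransform.fourier_fourierInv_eq]
  congr 1
  ext ξ
  rw [SchwartzMap.smulLeftCLM_apply_apply m₁.hasTemperateGrowth, h, smul_eq_mul]

lemma fourierMultiplier_fourierMultiplier {g₁ g₂ g : E → ℂ} (h₁ : g₁.HasTemperateGrowth)
    (h₂ : g₂.HasTemperateGrowth) (h : ∀ ξ, g ξ = g₁ ξ * g₂ ξ) (ψ : 𝓢(E, ℂ)) :
    SchwartzMap.fourierMultiplierCLM ℂ g₁ (SchwartzMap.fourierMultiplierCLM ℂ g₂ ψ) =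
      SchwartzMap.fourierMultiplierCLM ℂ g ψ := by
  rw [SchwartzMap.fourierMultiplierCLM_fourierMultiplierCLM_apply h₁ h₂]
  congr 2
  funext ξ
  exact (h ξ).symm

/-- The transpose of the multiplier with Schwartz symbol `m` turns the tempered distribution `u` into
the continuous function `y ↦ u(𝓕⁻ m(· - y))`. -/
lemma fourierMultiplier_apply_eq_integral (m : 𝓢(E, ℂ)) (u : 𝓢'(E, ℂ))
    (ψ : 𝓢(E, ℂ)) :
    u (SchwartzMap.fourierMultiplierCLM ℂ m ψ) =
      ∫ y, ψ y * u ((𝓕⁻ m).compSubConstCLM ℂ y) := by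
  refine apply_eq_integral_translate u (𝓕⁻ m) ψ _ fun x => ?_
  rw [fourierMultiplier_apply, ← integral_sub_left_eq_self _ _ x]
  congr 1
  funext v
  rw [sub_sub_cancel, mul_comm]

/-- On a Schwartz function, the representation of a multiplier by translates of its kernel is the
multiplier itself. -/
lemma coe_apply_translate {m : 𝓢(E, ℂ)} (hm : ∀ ξ, m (-ξ) = m ξ) (a : 𝓢(E, ℂ)) (y : E) :
    (a : 𝓢'(E, ℂ)) ((𝓕⁻ m).compSubConstCLM ℂ y) = SchwartzMap.fourierMultiplierCLM ℂ m a y := by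
  rw [SchwartzMap.coe_apply, fourierMultiplier_apply, ← integral_sub_left_eq_self _ _ y]
  congr 1
  funext x
  have h : y - x - y = -x := by abel
  rw [SchwartzMap.compSubConstCLM_apply, smul_eq_mul, h, fourierInv_even hm]

lemma enorm_coe_apply_le (a ψ : 𝓢(E, ℂ)) {C : ℝ≥0∞} (hC : ∀ x, ‖a x‖ₑ ≤ C) :
    ‖(a : 𝓢'(E, ℂ)) ψ‖ₑ ≤ C * ∫⁻ x, ‖ψ x‖ₑ := by
  rw [SchwartzMap.coe_apply]
  refine (enorm_integral_le_lintegral_enorm _).trans ?_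
  rw [← lintegral_const_mul'' _ ψ.continuous.enorm.aemeasurable]
  gcongr with x
  rw [smul_eq_mul, enorm_mul, mul_comm]
  gcongr
  exact hC x

end Distribution

/-! ### The `L^∞` norm of a tempered distribution -/

section SupNorm

lemma enorm_apply_le_supNorm (v : 𝓢'(R3, ℂ)) (ψ : 𝓢(R3, ℂ)) :
    ‖v ψ‖ₑ ≤ supNorm v * ∫⁻ x, ‖ψ x‖ₑ := by
  by_cases hψ : ∫⁻ x, ‖ψ x‖ₑ = 0
  -- Here `supNorm v` may be `∞`, but `ψ` vanishes.
  · have h0 : ψ = 0 := by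
      rw [lintegral_eq_zero_iff' ψ.continuous.enorm.aemeasurable] at hψ
      have h1 : (ψ : R3 → ℂ) =ᵐ[volume] fun _ => 0 := by
        filter_upwards [hψ] with x hx
        simpa using hx
      have h2 := (Continuous.ae_eq_iff_eq volume ψ.continuous continuous_const).1 h1
      ext x
      simpa using congrFun h2 x
    simp [h0]
  rw [supNorm, ENNReal.iInf_mul_of_ne hψ (lintegral_enorm_lt_top ψ).ne]
  refine le_iInf fun g => ?_
  rw [ENNReal.iInf_mul_of_ne hψ (lintegral_enorm_lt_top ψ).ne]
  refine le_iInf fun hg => ?_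
  rw [← hg, Lp.toTemperedDistribution_apply]
  refine (enorm_integral_le_lintegral_enorm _).trans ?_
  rw [← lintegral_const_mul'' _ ψ.continuous.enorm.aemeasurable]
  refine lintegral_mono_ae ?_
  have h1 : ∀ᵐ x ∂(volume : Measure R3), ‖g x‖ₑ ≤ ‖g‖ₑ := by
    rw [Lp.enorm_def]
    exact ae_le_eLpNormEssSup
  filter_upwards [h1] with x hx
  rw [enorm_smul, mul_comm]
  gcongr

/-- A distribution given by a bounded function. -/
lemma supNorm_le_of_eq_integral {v : 𝓢'(R3, ℂ)} {F : R3 → ℂ} (hF : AEStronglyMeasurable F volume)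
    {C : ℝ≥0∞} (hC : ∀ᵐ x, ‖F x‖ₑ ≤ C) (hv : ∀ ψ : 𝓢(R3, ℂ), v ψ = ∫ x, ψ x * F x) :
    supNorm v ≤ C := by
  rcases eq_or_ne C ∞ with rfl | hCt
  · exact le_top
  have hle : eLpNorm F ∞ volume ≤ C := by
    rw [eLpNorm_exponent_top]
    exact essSup_le_of_ae_le _ hC
  have hF' : MemLp F ∞ volume := ⟨hF, hle.trans_lt hCt.lt_top⟩
  refine (iInf₂_le hF'.toLp ?_).trans ?_
  · ext ψ
    rw [Lp.toTemperedDistribution_apply, hv]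
    refine integral_congr_ae ?_
    filter_upwards [hF'.coeFn_toLp] with x hx
    rw [hx, smul_eq_mul]
  · rw [Lp.enorm_toLp]
    exact hle

/-- The `L^∞` norm of `m(D) u` is controlled by `u` on the translates of the kernel of `m`. -/
lemma supNorm_fourierMultiplier_le {m : 𝓢(R3, ℂ)} (hm : ∀ ξ, m (-ξ) = m ξ) (u : 𝓢'(R3, ℂ))
    {C : ℝ≥0∞} (hC : ∀ y, ‖u ((𝓕⁻ m).compSubConstCLM ℂ y)‖ₑ ≤ C) :
    supNorm (TemperedDistribution.fourierMultiplierCLM ℂ m u) ≤ C := by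
  refine supNorm_le_of_eq_integral (continuous_apply_translate u (𝓕⁻ m)).aestronglyMeasurable
    (Eventually.of_forall hC) fun ψ => ?_
  rw [fourierMultiplier_apply_of_even m.hasTemperateGrowth hm, fourierMultiplier_apply_eq_integral]

end SupNorm

/-! ### Approximation of the identity by multipliers -/

section Approximation

variable {E : Type*} [NormedAddCommGroup E] [InnerProductSpace ℝ E] [FiniteDimensional ℝ E]
  [MeasurableSpace E] [BorelSpace E]

lemma norm_iteratedFDeriv_dilate_sub_one_le {m : 𝓢(E, ℂ)} (hm : m 0 = 1) (N : ℕ) :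
    ∃ C : ℝ, 0 ≤ C ∧ ∀ (c : ℝ), 0 < c → c ≤ 1 → ∀ i ≤ N, ∀ ξ,
      ‖iteratedFDeriv ℝ i (fun ξ => m (c • ξ) - 1) ξ‖ ≤ c * C * (1 + ‖ξ‖) := by
  refine ⟨jetBound (N + 1) m, jetBound_nonneg _ _, fun c hc hc1 i hi ξ => ?_⟩
  have hB : ∀ j ≤ N + 1, ∀ ξ, ‖iteratedFDeriv ℝ j m ξ‖ ≤ jetBound (N + 1) m := by
    intro j hj ξ
    refine le_trans ?_ (le_jetBound hj m ξ)
    exact le_mul_of_one_le_left (norm_nonneg _) (one_le_pow₀ (by linarith [norm_nonneg ξ]))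
  have hB0 := jetBound_nonneg (N + 1) m
  rcases Nat.eq_zero_or_pos i with rfl | hi0
  · rw [norm_iteratedFDeriv_zero]
    have h1 : ‖m (c • ξ) - m 0‖ ≤ jetBound (N + 1) m * ‖c • ξ - 0‖ := by
      refine (convex_univ).norm_image_sub_le_of_norm_fderiv_le (𝕜 := ℝ)
        (fun x _ => m.differentiableAt) (fun x _ => ?_) (Set.mem_univ _) (Set.mem_univ _)
      have h2 := hB 1 (by omega) x
      rwa [← norm_iteratedFDeriv_fderiv, norm_iteratedFDeriv_zero] at h2
    rw [hm, sub_zero, norm_smul, Real.norm_of_nonneg hc.le] at h1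
    refine h1.trans ?_
    nlinarith [norm_nonneg ξ, mul_nonneg hB0 hc.le]
  · have h1 : iteratedFDeriv ℝ i (fun ξ => m (c • ξ) - 1) ξ =
        c ^ i • iteratedFDeriv ℝ i m (c • ξ) := by
      have h2 : iteratedFDeriv ℝ i ((fun ξ => m (c • ξ)) - fun _ => (1 : ℂ)) ξ =
          iteratedFDeriv ℝ i (fun ξ => m (c • ξ)) ξ - iteratedFDeriv ℝ i (fun _ => (1 : ℂ)) ξ := by
        refine iteratedFDeriv_sub_apply ?_ contDiffAt_const
        exact ((m.smooth i).comp (contDiff_const_smul c)).contDiffAt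
      rw [iteratedFDeriv_const_of_ne hi0.ne', iteratedFDeriv_comp_const_smul c (m.smooth i)] at h2
      rw [Pi.zero_apply, sub_zero] at h2
      exact h2
    rw [h1, norm_smul, norm_pow, Real.norm_of_nonneg hc.le]
    calc c ^ i * ‖iteratedFDeriv ℝ i m (c • ξ)‖ ≤ c ^ 1 * jetBound (N + 1) m := by
          gcongr ?_ * ?_
          · exact pow_le_pow_of_le_one hc.le hc1 hi0
          · exact hB i (by omega) _
      _ ≤ c * jetBound (N + 1) m * (1 + ‖ξ‖) := by
          rw [pow_one]
          exact le_mul_of_one_le_right (by positivity) (by linarith [norm_nonneg ξ])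

lemma tendsto_smulLeft_dilate {m : 𝓢(E, ℂ)} (hm : m 0 = 1) {c : ℕ → ℝ} (hc : ∀ n, 0 < c n)
    (hlim : Tendsto c atTop (𝓝 0)) (g : 𝓢(E, ℂ)) :
    Tendsto (fun n => SchwartzMap.smulLeftCLM ℂ (dilate (hc n) m) g) atTop (𝓝 g) := by
  rw [(schwartz_withSeminorms ℝ E ℂ).tendsto_nhds]
  rintro ⟨k, n⟩ ε hε
  obtain ⟨C, hC0, hC⟩ := norm_iteratedFDeriv_dilate_sub_one_le hm n
  set N := max (k + 1) n with hN
  have hB0 := jetBound_nonneg N g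
  have hlim2 : Tendsto (fun j => c j * (C * 2 ^ n * jetBound N g)) atTop (𝓝 0) := by
    simpa using hlim.mul_const (C * 2 ^ n * jetBound N g)
  filter_upwards [hlim2.eventually (gt_mem_nhds hε),
    hlim.eventually (ge_mem_nhds zero_lt_one)] with j hj hj1
  refine lt_of_le_of_lt ?_ hj
  have hcj := hc j
  refine SchwartzMap.seminorm_le_bound ℝ k n _ (by positivity) fun x => ?_
  have h1 : (⇑(SchwartzMap.smulLeftCLM ℂ (dilate (hc j) m) g - g) : E → ℂ) =
      fun x => (m (c j • x) - 1) * g x := by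
    funext x
    rw [FunLike.coe_sub, Pi.sub_apply,
      SchwartzMap.smulLeftCLM_apply_apply (dilate (hc j) m).hasTemperateGrowth, dilate_apply,
      smul_eq_mul]
    ring
  rw [h1]
  have hsm : ContDiff ℝ n (fun x => m (c j • x) - 1) :=
    ((m.smooth n).comp (contDiff_const_smul (c j))).sub contDiff_const
  calc ‖x‖ ^ k * ‖iteratedFDeriv ℝ n (fun x => (m (c j • x) - 1) * g x) x‖
      ≤ ‖x‖ ^ k * ∑ i ∈ Finset.range (n + 1), (n.choose i : ℝ) *
          ‖iteratedFDeriv ℝ i (fun x => m (c j • x) - 1) x‖ * ‖iteratedFDeriv ℝ (n - i) g x‖ := by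
        gcongr
        exact norm_iteratedFDeriv_mul_le hsm (g.smooth n) x le_rfl
    _ ≤ ∑ i ∈ Finset.range (n + 1), (n.choose i : ℝ) * (c j * C * jetBound N g) := by
        rw [Finset.mul_sum]
        refine Finset.sum_le_sum fun i hi => ?_
        have h3 := le_jetBound (N := N) (n := n - i) ((Nat.sub_le n i).trans (le_max_right _ _)) g x
        calc ‖x‖ ^ k * ((n.choose i : ℝ) * ‖iteratedFDeriv ℝ i (fun x => m (c j • x) - 1) x‖ *
              ‖iteratedFDeriv ℝ (n - i) g x‖)
            ≤ (1 + ‖x‖) ^ k * ((n.choose i : ℝ) * (c j * C * (1 + ‖x‖)) *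
              ‖iteratedFDeriv ℝ (n - i) g x‖) := by
              gcongr
              · linarith
              · exact hC (c j) (hc j) hj1 i (Nat.lt_succ_iff.1 (Finset.mem_range.1 hi)) x
          _ = (n.choose i : ℝ) * (c j * C * ((1 + ‖x‖) ^ (k + 1) *
              ‖iteratedFDeriv ℝ (n - i) g x‖)) := by ring
          _ ≤ (n.choose i : ℝ) * (c j * C * jetBound N g) := by
              gcongr
              refine le_trans ?_ h3
              gcongr
              · linarith [norm_nonneg x]
              · exact le_max_left _ _
    _ = c j * (C * 2 ^ n * jetBound N g) := by
        rw [← Finset.sum_mul]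
        have := Nat.sum_range_choose n
        have h4 : (∑ i ∈ Finset.range (n + 1), (n.choose i : ℝ)) = 2 ^ n := by
          exact_mod_cast this
        rw [h4]
        ring

/-- Fourier multipliers with symbol `m(c ·)` tend to the identity as `c → 0`, if `m(0) = 1`. -/
lemma tendsto_fourierMultiplier_dilate {m : 𝓢(E, ℂ)} (hm : m 0 = 1) {c : ℕ → ℝ}
    (hc : ∀ n, 0 < c n) (hlim : Tendsto c atTop (𝓝 0)) (ψ : 𝓢(E, ℂ)) :
    Tendsto (fun n => SchwartzMap.fourierMultiplierCLM ℂ (dilate (hc n) m) ψ) atTop (𝓝 ψ) := by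
  have h1 := ((FourierTransform.fourierInvCLM ℂ 𝓢(E, ℂ)).continuous.tendsto (𝓕 ψ)).comp
    (tendsto_smulLeft_dilate hm hc hlim (𝓕 ψ))
  rwa [FourierTransform.fourierInvCLM_apply, FourierTransform.fourierInv_fourier_eq] at h1

end Approximation

/-! ### Radial symbols -/

/-- Smooth compactly supported profiles `θ` for which `v ↦ θ(|v|)` is smooth at the origin. -/
structure IsProfile (θ : ℝ → ℝ) : Prop where
  contDiff : ContDiff ℝ (⊤ : ℕ∞) θ
  hasCompactSupport : HasCompactSupport θ
  eventually_eq : ∃ η : ℝ → ℝ, ContDiff ℝ (⊤ : ℕ∞) η ∧ θ =ᶠ[𝓝 0] fun τ => η (τ ^ 2)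

section Radial

variable {V : Type*} [NormedAddCommGroup V] [InnerProductSpace ℝ V] [FiniteDimensional ℝ V]
  [MeasurableSpace V] [BorelSpace V]

/-- The symbol `v ↦ θ(2π|v|)`. -/
def radial (V : Type*) [NormedAddCommGroup V] [InnerProductSpace ℝ V] [FiniteDimensional ℝ V]
    {θ : ℝ → ℝ} (hθ : IsProfile θ) : 𝓢(V, ℂ) :=
  HasCompactSupport.toSchwartzMap (f := fun v : V => ((θ (2 * Real.pi * ‖v‖) : ℝ) : ℂ))
    (by
      obtain ⟨R, hR⟩ := hθ.hasCompactSupport.isBounded.subset_closedBall 0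
      refine HasCompactSupport.of_support_subset_isCompact
        (isCompact_closedBall (0 : V) (R / (2 * Real.pi))) fun v hv => ?_
      have h1 : θ (2 * Real.pi * ‖v‖) ≠ 0 := fun h => hv (by simp [h])
      have h2 := hR (subset_tsupport θ h1)
      rw [mem_closedBall_zero_iff, Real.norm_of_nonneg (by positivity)] at h2
      rw [mem_closedBall_zero_iff, le_div_iff₀ (by positivity)]
      linarith)
    (by
      refine Complex.ofRealCLM.contDiff.comp ?_
      rw [contDiff_iff_contDiffAt]
      intro v
      by_cases hv : v = 0
      · subst hv
        obtain ⟨η, hη, hηe⟩ := hθ.eventually_eq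
        have h1 : Tendsto (fun v : V => 2 * Real.pi * ‖v‖) (𝓝 0) (𝓝 0) := by
          have : Continuous fun v : V => 2 * Real.pi * ‖v‖ := by fun_prop
          simpa using this.tendsto 0
        have h2 : (fun v : V => θ (2 * Real.pi * ‖v‖)) =ᶠ[𝓝 0]
            fun v => η ((2 * Real.pi) ^ 2 * ‖v‖ ^ 2) := by
          filter_upwards [h1.eventually hηe] with w hw
          rw [hw, mul_pow]
        exact ((hη.comp (contDiff_const.mul (contDiff_norm_sq ℝ))).contDiffAt).congr_of_eventuallyEq
          h2
      · exact hθ.contDiff.contDiffAt.comp v (contDiffAt_const.mul (contDiffAt_norm ℝ hv)))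

@[simp] lemma radial_apply {θ : ℝ → ℝ} (hθ : IsProfile θ) (v : V) :
    radial V hθ v = ((θ (2 * Real.pi * ‖v‖) : ℝ) : ℂ) := rfl

lemma dilate_radial_apply {θ : ℝ → ℝ} (hθ : IsProfile θ) {c : ℝ} (hc : 0 < c) (v : V) :
    dilate hc (radial V hθ) v = ((θ (c * (2 * Real.pi * ‖v‖)) : ℝ) : ℂ) := by
  rw [dilate_apply, radial_apply, norm_smul, Real.norm_of_nonneg hc.le]
  congr 2
  ring

lemma dilate_radial_even {θ : ℝ → ℝ} (hθ : IsProfile θ) {c : ℝ} (hc : 0 < c) (v : V) :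
    dilate hc (radial V hθ) (-v) = dilate hc (radial V hθ) v := by
  rw [dilate_radial_apply, dilate_radial_apply, norm_neg]

end Radial

lemma IsProfile.of_eventually_const {θ : ℝ → ℝ} (h : ContDiff ℝ (⊤ : ℕ∞) θ)
    (h' : HasCompactSupport θ) (c : ℝ) (hc : θ =ᶠ[𝓝 0] fun _ => c) : IsProfile θ :=
  ⟨h, h', fun _ => c, contDiff_const, hc⟩

lemma IsProfile.comp_mul {θ : ℝ → ℝ} (hθ : IsProfile θ) {c : ℝ} (hc : 0 < c) :
    IsProfile fun τ => θ (c * τ) := by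
  obtain ⟨η, hη, hηe⟩ := hθ.eventually_eq
  refine ⟨hθ.contDiff.comp (contDiff_const.mul contDiff_id), ?_,
    fun τ => η (c ^ 2 * τ), hη.comp (contDiff_const.mul contDiff_id), ?_⟩
  · exact hθ.hasCompactSupport.comp_homeomorph (Homeomorph.mulLeft₀ c hc.ne')
  · have h1 : Tendsto (fun τ : ℝ => c * τ) (𝓝 0) (𝓝 0) := by
      have : Continuous fun τ : ℝ => c * τ := by fun_prop
      simpa using this.tendsto 0
    filter_upwards [h1.eventually hηe] with w hw
    rw [hw, mul_pow]

lemma IsProfile.sub {θ₁ θ₂ : ℝ → ℝ} (h₁ : IsProfile θ₁) (h₂ : IsProfile θ₂) :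
    IsProfile fun τ => θ₁ τ - θ₂ τ := by
  obtain ⟨η₁, hη₁, he₁⟩ := h₁.eventually_eq
  obtain ⟨η₂, hη₂, he₂⟩ := h₂.eventually_eq
  refine ⟨h₁.contDiff.sub h₂.contDiff, h₁.hasCompactSupport.sub h₂.hasCompactSupport,
    fun τ => η₁ τ - η₂ τ, hη₁.sub hη₂, ?_⟩
  filter_upwards [he₁, he₂] with τ h h'
  rw [h, h']

lemma IsProfile.mul_exp {θ : ℝ → ℝ} (hθ : IsProfile θ) :
    IsProfile fun τ => θ τ * Real.exp (τ ^ 2) := by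
  obtain ⟨η, hη, hηe⟩ := hθ.eventually_eq
  refine ⟨hθ.contDiff.mul ((contDiff_id.pow 2).exp), hθ.hasCompactSupport.mul_right,
    fun τ => η τ * Real.exp τ, hη.mul contDiff_id.exp, ?_⟩
  filter_upwards [hηe] with τ h
  rw [h]

lemma IsProfile.div_sq {θ : ℝ → ℝ} (hθ : IsProfile θ) (h0 : θ =ᶠ[𝓝 0] fun _ => 0) :
    IsProfile fun τ => θ τ / τ ^ 2 := by
  have h1 : (fun τ => θ τ / τ ^ 2) =ᶠ[𝓝 0] fun _ => 0 := by
    filter_upwards [h0] with τ h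
    rw [h, zero_div]
  refine IsProfile.of_eventually_const ?_ ?_ 0 h1
  · rw [contDiff_iff_contDiffAt]
    intro τ
    by_cases hτ : τ = 0
    · subst hτ
      exact contDiffAt_const.congr_of_eventuallyEq h1
    · exact hθ.contDiff.contDiffAt.div (contDiff_id.pow 2).contDiffAt (pow_ne_zero 2 hτ)
  · simp_rw [div_eq_mul_inv]
    exact hθ.hasCompactSupport.mul_right

/-! ### The dyadic partition of unity -/

section Profiles

variable {φ : ℝ → ℝ}

lemma IsDyadicCutoff.eq_zero_of_le (hφ : IsDyadicCutoff φ) {τ : ℝ} (h : τ ≤ 3 / 4) : φ τ = 0 := by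
  by_contra hne
  exact absurd (hφ.tsupport_subset (subset_tsupport φ hne)).1 (not_lt.2 h)

lemma IsDyadicCutoff.eq_zero_of_ge (hφ : IsDyadicCutoff φ) {τ : ℝ} (h : 8 / 3 ≤ τ) : φ τ = 0 := by
  by_contra hne
  exact absurd (hφ.tsupport_subset (subset_tsupport φ hne)).2 (not_lt.2 h)

/-- Only two terms of the partition of unity are present on `[4/3, 8/3]`. -/
lemma IsDyadicCutoff.add_half (hφ : IsDyadicCutoff φ) {τ : ℝ} (h1 : 4 / 3 ≤ τ) (h2 : τ ≤ 8 / 3) :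
    φ τ + φ (τ / 2) = 1 := by
  have hs := hφ.hasSum τ (by linarith)
  have hf := hasSum_sum_of_ne_finset_zero (f := fun j : ℤ => φ ((2 : ℝ) ^ (-j) * τ)) (s := {0, 1})
    (L := .unconditional ℤ) (by
    intro j hj
    simp only [Finset.mem_insert, Finset.mem_singleton, not_or] at hj
    rcases lt_or_gt_of_ne hj.1 with h | h
    · apply hφ.eq_zero_of_ge
      have : (2 : ℝ) ^ (1 : ℤ) ≤ 2 ^ (-j) := zpow_le_zpow_right₀ one_le_two (by omega)
      rw [zpow_one] at this
      nlinarith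
    · apply hφ.eq_zero_of_le
      have : (2 : ℝ) ^ (-j) ≤ 2 ^ (-2 : ℤ) := zpow_le_zpow_right₀ one_le_two (by omega)
      have h4 : (2 : ℝ) ^ (-2 : ℤ) = 1 / 4 := by norm_num
      rw [h4] at this
      nlinarith)
  have := hs.unique hf
  rw [Finset.sum_pair (by norm_num)] at this
  rw [this]
  simp only [neg_zero, zpow_zero, one_mul]
  congr 2
  rw [zpow_neg, zpow_one]
  ring

/-- The profile `χ` of the low frequency cutoff: `χ(τ) = ∑_{j < 0} φ(2^{-j} τ)` for `τ > 0`, and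
`χ = 1` near the origin. -/
def lowProfile (φ : ℝ → ℝ) (τ : ℝ) : ℝ := if |τ| ≤ 3 / 2 then 1 - φ |τ| else 0

lemma lowProfile_eq_one (hφ : IsDyadicCutoff φ) {τ : ℝ} (h : |τ| ≤ 3 / 4) :
    lowProfile φ τ = 1 := by
  rw [lowProfile, if_pos (by linarith), hφ.eq_zero_of_le h, sub_zero]

lemma lowProfile_eq_zero (hφ : IsDyadicCutoff φ) {τ : ℝ} (h : 4 / 3 ≤ |τ|) :
    lowProfile φ τ = 0 := by
  rw [lowProfile]
  split_ifs with h1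
  · have h2 := hφ.add_half h (by linarith)
    rw [hφ.eq_zero_of_le (τ := |τ| / 2) (by linarith)] at h2
    linarith
  · rfl

lemma lowProfile_half_sub (hφ : IsDyadicCutoff φ) {τ : ℝ} (h0 : 0 ≤ τ) :
    lowProfile φ (τ / 2) - lowProfile φ τ = φ τ := by
  have ha : |τ| = τ := abs_of_nonneg h0
  have ha2 : |τ / 2| = τ / 2 := abs_of_nonneg (by linarith)
  rcases le_total τ (4 / 3) with h | h
  · rw [lowProfile_eq_one hφ (by rw [ha2]; linarith), lowProfile, if_pos (by rw [ha]; linarith), ha]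
    ring
  · rw [lowProfile_eq_zero hφ (τ := τ) (by rw [ha]; exact h)]
    rcases le_total τ (8 / 3) with h' | h'
    · have := hφ.add_half h h'
      rw [lowProfile, if_pos (by rw [ha2]; linarith), ha2]
      linarith
    · rw [lowProfile_eq_zero hφ (by rw [ha2]; linarith), hφ.eq_zero_of_ge h', sub_zero]

lemma IsDyadicCutoff.isProfile (hφ : IsDyadicCutoff φ) : IsProfile φ := by
  refine IsProfile.of_eventually_const hφ.contDiff hφ.hasCompactSupport 0 ?_
  filter_upwards [gt_mem_nhds (show (0 : ℝ) < 3 / 4 by norm_num)] with τ hτ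
  exact hφ.eq_zero_of_le hτ.le

lemma isProfile_lowProfile (hφ : IsDyadicCutoff φ) : IsProfile (lowProfile φ) := by
  have habs : Tendsto (fun τ : ℝ => |τ|) (𝓝 0) (𝓝 0) := by
    simpa using (continuous_abs (G := ℝ)).tendsto 0
  have h0 : lowProfile φ =ᶠ[𝓝 0] fun _ => 1 := by
    filter_upwards [habs.eventually (gt_mem_nhds (show (0 : ℝ) < 3 / 4 by norm_num))] with τ hτ
    exact lowProfile_eq_one hφ hτ.le
  refine IsProfile.of_eventually_const ?_ ?_ 1 h0
  · rw [contDiff_iff_contDiffAt]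
    intro τ
    by_cases hτ : τ = 0
    · subst hτ
      exact contDiffAt_const.congr_of_eventuallyEq h0
    rcases lt_or_ge |τ| (3 / 2) with h | h
    · have h1 : lowProfile φ =ᶠ[𝓝 τ] fun τ => 1 - φ |τ| := by
        filter_upwards [continuous_abs.continuousAt.eventually (gt_mem_nhds h)] with σ hσ
        rw [lowProfile, if_pos (le_of_lt hσ)]
      refine ContDiffAt.congr_of_eventuallyEq ?_ h1
      exact contDiffAt_const.sub (hφ.contDiff.contDiffAt.comp τ (contDiffAt_abs hτ))
    · have h1 : lowProfile φ =ᶠ[𝓝 τ] fun _ => 0 := by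
        filter_upwards [continuous_abs.continuousAt.eventually
          (lt_mem_nhds (show 4 / 3 < |τ| by linarith))] with σ hσ
        exact lowProfile_eq_zero hφ (le_of_lt hσ)
      exact contDiffAt_const.congr_of_eventuallyEq h1
  · refine HasCompactSupport.of_support_subset_isCompact (isCompact_closedBall (0 : ℝ) (4 / 3))
      fun τ hτ => ?_
    rw [mem_closedBall_zero_iff, Real.norm_eq_abs]
    by_contra hne
    exact hτ (lowProfile_eq_zero hφ (not_le.1 hne).le)

/-- A profile equal to `1` on the support of `φ` and vanishing near the origin. -/
def wideProfile (φ : ℝ → ℝ) (τ : ℝ) : ℝ := lowProfile φ (1 / 4 * τ) - lowProfile φ (4 * τ)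

lemma isProfile_wideProfile (hφ : IsDyadicCutoff φ) : IsProfile (wideProfile φ) :=
  ((isProfile_lowProfile hφ).comp_mul (by norm_num)).sub
    ((isProfile_lowProfile hφ).comp_mul (by norm_num))

lemma wideProfile_eventually_eq_zero (hφ : IsDyadicCutoff φ) :
    wideProfile φ =ᶠ[𝓝 0] fun _ => 0 := by
  have habs : Tendsto (fun τ : ℝ => |τ|) (𝓝 0) (𝓝 0) := by
    simpa using (continuous_abs (G := ℝ)).tendsto 0
  filter_upwards [habs.eventually (gt_mem_nhds (show (0 : ℝ) < 3 / 16 by norm_num))] with τ hτ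
  rw [wideProfile, lowProfile_eq_one hφ, lowProfile_eq_one hφ, sub_self]
  · rw [abs_mul, abs_of_pos (by norm_num : (0 : ℝ) < 4)]; linarith
  · rw [abs_mul, abs_of_pos (by norm_num : (0 : ℝ) < 1 / 4)]; linarith

lemma wideProfile_mul (hφ : IsDyadicCutoff φ) (τ : ℝ) : wideProfile φ τ * φ τ = φ τ := by
  by_cases h : φ τ = 0
  · rw [h, mul_zero]
  · have h1 := hφ.tsupport_subset (subset_tsupport φ h)
    have h2 := h1.1
    have h3 := h1.2
    have ha : |τ| = τ := abs_of_pos (by linarith)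
    rw [wideProfile, lowProfile_eq_one hφ, lowProfile_eq_zero hφ, sub_zero, one_mul]
    · rw [abs_mul, ha, abs_of_pos (by norm_num : (0 : ℝ) < 4)]; linarith
    · rw [abs_mul, ha, abs_of_pos (by norm_num : (0 : ℝ) < 1 / 4)]; linarith

lemma lowProfile_succ_sub (hφ : IsDyadicCutoff φ) {τ : ℝ} (h0 : 0 ≤ τ) (k : ℤ) :
    lowProfile φ ((2 : ℝ) ^ (-(k + 1)) * τ) - lowProfile φ ((2 : ℝ) ^ (-k) * τ) =
      φ ((2 : ℝ) ^ (-k) * τ) := by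
  rw [← lowProfile_half_sub hφ (by positivity : 0 ≤ (2 : ℝ) ^ (-k) * τ)]
  congr 2
  rw [neg_add, zpow_add₀ two_ne_zero]
  norm_num
  ring

/-- The telescoping sum `∑_{m ≤ k < m + n} φ(2^{-k} τ)`. -/
lemma sum_cutoff (hφ : IsDyadicCutoff φ) {τ : ℝ} (h0 : 0 ≤ τ) (m : ℤ) (n : ℕ) :
    ∑ i ∈ Finset.range n, φ ((2 : ℝ) ^ (-(m + i)) * τ) =
      lowProfile φ ((2 : ℝ) ^ (-(m + n)) * τ) - lowProfile φ ((2 : ℝ) ^ (-m) * τ) := by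
  induction n with
  | zero => simp
  | succ n ih =>
    rw [Finset.sum_range_succ, ih, ← lowProfile_succ_sub hφ h0 (m + n)]
    push_cast
    rw [add_assoc]
    ring

lemma exists_zpow_mem_Ico {τ : ℝ} (h0 : 0 < τ) : ∃ n : ℤ, (2 : ℝ) ^ n ≤ τ ∧ τ < 2 ^ (n + 1) :=
  exists_mem_Ico_zpow h0 one_lt_two

lemma cutoff_zpow_eq_zero (hφ : IsDyadicCutoff φ) {τ : ℝ} {n : ℤ} (h1 : (2 : ℝ) ^ n ≤ τ)
    (h2 : τ < 2 ^ (n + 1)) {k : ℤ} (hk : k ∉ ({n - 1, n, n + 1} : Finset ℤ)) :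
    φ ((2 : ℝ) ^ (-k) * τ) = 0 := by
  simp only [Finset.mem_insert, Finset.mem_singleton, not_or] at hk
  have hp : (0 : ℝ) < 2 ^ (-k) := by positivity
  rcases lt_or_ge k n with h | h
  · apply hφ.eq_zero_of_ge
    have h3 : (2 : ℝ) ^ (2 : ℤ) ≤ 2 ^ (-k + n) := zpow_le_zpow_right₀ one_le_two (by omega)
    rw [zpow_add₀ two_ne_zero] at h3
    have h4 : (2 : ℝ) ^ (2 : ℤ) = 4 := by norm_num
    nlinarith
  · apply hφ.eq_zero_of_le
    have h3 : (2 : ℝ) ^ (-k + (n + 1)) ≤ 2 ^ (-1 : ℤ) := zpow_le_zpow_right₀ one_le_two (by omega)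
    rw [zpow_add₀ two_ne_zero] at h3
    have h5 : (2 : ℝ) ^ (-k) * τ ≤ 2 ^ (-k) * 2 ^ (n + 1) := by gcongr
    exact (h5.trans h3).trans (by norm_num)

lemma exists_bound_cutoff (hφ : IsDyadicCutoff φ) : ∃ B : ℝ≥0, ∀ τ, ‖φ τ‖ₑ ≤ B := by
  obtain ⟨C, hC⟩ := hφ.hasCompactSupport.exists_bound_of_continuous hφ.contDiff.continuous
  refine ⟨C.toNNReal, fun τ => ?_⟩
  rw [← ofReal_norm]
  exact ENNReal.ofReal_le_ofReal (hC τ)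

lemma exists_tsum_cutoff_le (hφ : IsDyadicCutoff φ) :
    ∃ B : ℝ≥0, ∀ τ, 0 < τ → ∑' k : ℤ, ‖φ ((2 : ℝ) ^ (-k) * τ)‖ₑ ≤ B := by
  obtain ⟨B, hB⟩ := exists_bound_cutoff hφ
  refine ⟨3 * B, fun τ hτ => ?_⟩
  obtain ⟨n, h1, h2⟩ := exists_zpow_mem_Ico hτ
  rw [tsum_eq_sum (s := ({n - 1, n, n + 1} : Finset ℤ)) (fun k hk => by
    rw [cutoff_zpow_eq_zero hφ h1 h2 hk, enorm_zero])]
  refine (Finset.sum_le_sum fun k _ => hB _).trans ?_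
  rw [Finset.sum_const, nsmul_eq_mul]
  push_cast
  gcongr
  exact_mod_cast Finset.card_le_three

/-- `χ(2^{-k} τ)` is the sum of the dyadic profiles of order less than `k`. -/
lemma hasSum_lowProfile (hφ : IsDyadicCutoff φ) {τ : ℝ} (hτ : 0 < τ) (k : ℤ) :
    HasSum (fun k' : {k' : ℤ // k' ≤ k - 1} => φ ((2 : ℝ) ^ (-(k' : ℤ)) * τ))
      (lowProfile φ ((2 : ℝ) ^ (-k) * τ)) := by
  obtain ⟨n, h1, h2⟩ := exists_zpow_mem_Ico hτ
  let e : ℕ ≃ {k' : ℤ // k' ≤ k - 1} :=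
    { toFun := fun i => ⟨k - 1 - i, by omega⟩
      invFun := fun k' => (k - 1 - k').toNat
      left_inv := fun i => by simp
      right_inv := fun k' => by
        have := k'.2
        ext
        simp only
        omega }
  rw [← e.hasSum_iff]
  obtain ⟨N, hN⟩ : ∃ N : ℕ, k - 1 - n + 1 < N := ⟨(k - 1 - n + 1).toNat + 1, by omega⟩
  have hz : ∀ i ∉ Finset.range N,
      ((fun k' : {k' : ℤ // k' ≤ k - 1} => φ ((2 : ℝ) ^ (-(k' : ℤ)) * τ)) ∘ e) i = 0 := by
    intro i hi
    rw [Finset.mem_range, not_lt] at hi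
    refine cutoff_zpow_eq_zero hφ h1 h2 ?_
    simp only [e, Equiv.coe_fn_mk, Finset.mem_insert, Finset.mem_singleton, not_or]
    omega
  have hs := hasSum_sum_of_ne_finset_zero (L := .unconditional ℕ) hz
  convert hs using 1
  rw [← Finset.sum_range_reflect]
  have h3 := sum_cutoff hφ hτ.le (k - N) N
  have h4 : lowProfile φ ((2 : ℝ) ^ (-(k - N)) * τ) = 0 := by
    apply lowProfile_eq_zero hφ
    rw [abs_of_pos (by positivity)]
    have h5 : (2 : ℝ) ^ (1 : ℤ) ≤ 2 ^ (-(k - N) + n) := zpow_le_zpow_right₀ one_le_two (by omega)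
    rw [zpow_add₀ two_ne_zero, zpow_one] at h5
    have hp : (0 : ℝ) < 2 ^ (-(k - N : ℤ)) := by positivity
    nlinarith
  rw [h4, sub_zero] at h3
  rw [show k - (N : ℤ) + N = k by ring] at h3
  rw [← h3]
  refine Finset.sum_congr rfl fun i hi => ?_
  have hi' := Finset.mem_range.1 hi
  simp only [Function.comp_apply, e, Equiv.coe_fn_mk]
  congr 3
  omega

end Profiles

/-! ### Dyadic blocks of tempered distributions -/

lemma two_zpow_neg_pos (k : ℤ) : (0 : ℝ) < 2 ^ (-k) := by positivity

section Sym

variable {V : Type*} [NormedAddCommGroup V] [InnerProductSpace ℝ V] [FiniteDimensional ℝ V]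
  [MeasurableSpace V] [BorelSpace V] {θ : ℝ → ℝ}

/-- The symbol `v ↦ θ(2^{-k} 2π|v|)`. -/
def sym (V : Type*) [NormedAddCommGroup V] [InnerProductSpace ℝ V] [FiniteDimensional ℝ V]
    {θ : ℝ → ℝ} (hθ : IsProfile θ) (k : ℤ) : 𝓢(V, ℂ) :=
  dilate (two_zpow_neg_pos k) (radial V hθ)

lemma sym_apply (hθ : IsProfile θ) (k : ℤ) (v : V) :
    sym V hθ k v = ((θ ((2 : ℝ) ^ (-k) * (2 * Real.pi * ‖v‖)) : ℝ) : ℂ) :=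
  dilate_radial_apply hθ _ v

lemma sym_even (hθ : IsProfile θ) (k : ℤ) (v : V) : sym V hθ k (-v) = sym V hθ k v :=
  dilate_radial_even hθ _ v

lemma kernelNorm_sym (hθ : IsProfile θ) (k : ℤ) :
    kernelNorm (sym V hθ k) = kernelNorm (radial V hθ) :=
  kernelNorm_dilate _ _

lemma ofReal_two_zpow (k : ℤ) : ENNReal.ofReal ((2 : ℝ) ^ k) = (2 : ℝ≥0∞) ^ k := by
  have h : (2 : ℝ) ^ k = (((2 : ℝ≥0) ^ k : ℝ≥0) : ℝ) := by push_cast; rfl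
  rw [h, ENNReal.ofReal_coe_nnreal, ENNReal.coe_zpow two_ne_zero, ENNReal.coe_ofNat]

lemma two_zpow_ne_top (k : ℤ) : (2 : ℝ≥0∞) ^ k ≠ ∞ :=
  (ENNReal.zpow_lt_top two_ne_zero ENNReal.ofNat_ne_top k).ne

lemma two_zpow_add (k l : ℤ) : (2 : ℝ≥0∞) ^ (k + l) = 2 ^ k * 2 ^ l :=
  ENNReal.zpow_add two_ne_zero ENNReal.ofNat_ne_top k l

lemma two_zpow_mul_neg (k : ℤ) : (2 : ℝ≥0∞) ^ k * 2 ^ (-k) = 1 := by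
  rw [← two_zpow_add, add_neg_cancel, zpow_zero]

/-- The Bernstein bound for the kernels of dyadic symbols. -/
lemma exists_enorm_fourierInv_sym_le (hθ : IsProfile θ) :
    ∃ C : ℝ≥0, ∀ (k : ℤ) (x : V),
      ‖𝓕⁻ (sym V hθ k) x‖ₑ ≤ (2 : ℝ≥0∞) ^ (k * Module.finrank ℝ V) * C := by
  obtain ⟨C, -, hC⟩ := (𝓕⁻ (radial V hθ)).decay 0 0
  refine ⟨C.toNNReal, fun k x => ?_⟩
  rw [sym, fourierInv_dilate, enorm_smul]
  gcongr
  · rw [Real.enorm_of_nonneg (by positivity), ← ofReal_two_zpow]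
    apply ENNReal.ofReal_le_ofReal
    rw [← zpow_natCast, ← zpow_mul, ← zpow_neg]
    apply le_of_eq
    congr 1
    ring
  · rw [← ofReal_norm]
    exact ENNReal.ofReal_le_ofReal (by simpa using hC (((2 : ℝ) ^ (-k))⁻¹ • x))

end Sym

section Blocks

variable {φ : ℝ → ℝ}

lemma isoSymbol_eq (hφ : IsDyadicCutoff φ) (k : ℤ) : isoSymbol φ k = sym R3 hφ.isProfile k := by
  funext ξ
  rw [sym_apply, isoSymbol]

lemma isoBlock_apply (hφ : IsDyadicCutoff φ) (k : ℤ) (u : 𝓢'(R3, ℂ)) (ψ : 𝓢(R3, ℂ)) :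
    isoBlock φ k u ψ = u (SchwartzMap.fourierMultiplierCLM ℂ (sym R3 hφ.isProfile k) ψ) := by
  rw [isoBlock, isoSymbol_eq hφ, fourierMultiplier_apply_of_even
    (SchwartzMap.hasTemperateGrowth _) (sym_even _ _)]

/-- The block of order `k` only sees frequencies of size `2^k`. -/
lemma isoBlock_apply_wide (hφ : IsDyadicCutoff φ) (k : ℤ) (u : 𝓢'(R3, ℂ)) (ψ : 𝓢(R3, ℂ)) :
    isoBlock φ k u (SchwartzMap.fourierMultiplierCLM ℂ (sym R3 (isProfile_wideProfile hφ) k) ψ) =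
      isoBlock φ k u ψ := by
  rw [isoBlock_apply hφ, isoBlock_apply hφ, fourierMultiplier_fourierMultiplier
    (SchwartzMap.hasTemperateGrowth _) (SchwartzMap.hasTemperateGrowth _) fun ξ => ?_]
  rw [sym_apply, sym_apply, ← Complex.ofReal_mul, mul_comm (φ _), wideProfile_mul hφ]

lemma enorm_isoBlock_apply_le (hφ : IsDyadicCutoff φ) (k : ℤ) (u : 𝓢'(R3, ℂ)) (ψ : 𝓢(R3, ℂ)) :
    ‖isoBlock φ k u ψ‖ₑ ≤ supNorm (isoBlock φ k u) *
      ∫⁻ x, ‖SchwartzMap.fourierMultiplierCLM ℂ (sym R3 (isProfile_wideProfile hφ) k) ψ x‖ₑ := by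
  rw [← isoBlock_apply_wide hφ]
  exact enorm_apply_le_supNorm _ _

/-- `-Δ` as a Fourier multiplier. -/
def negLaplacian : 𝓢(R3, ℂ) →L[ℂ] 𝓢(R3, ℂ) :=
  SchwartzMap.fourierMultiplierCLM ℂ fun ξ => (((2 * Real.pi) ^ 2 * ‖ξ‖ ^ 2 : ℝ) : ℂ)

lemma hasTemperateGrowth_negLaplacian :
    (fun ξ : R3 => (((2 * Real.pi) ^ 2 * ‖ξ‖ ^ 2 : ℝ) : ℂ)).HasTemperateGrowth := by
  have h1 : (fun ξ : R3 => ((2 * Real.pi) ^ 2 * ‖ξ‖ ^ 2 : ℝ)).HasTemperateGrowth :=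
    (Function.HasTemperateGrowth.const ((2 * Real.pi) ^ 2)).mul
      (Function.hasTemperateGrowth_norm_sq R3)
  exact Function.HasTemperateGrowth.comp Function.Complex.hasTemperateGrowth_ofReal h1

/-- Annular multipliers are bounded on `L¹`, and gain `2^{-2k}` on functions with Laplacian in
`L¹`. -/
lemma exists_lintegral_wide_le (hφ : IsDyadicCutoff φ) : ∃ C : ℝ≥0, ∀ (k : ℤ) (ψ : 𝓢(R3, ℂ)),
    ∫⁻ x, ‖SchwartzMap.fourierMultiplierCLM ℂ (sym R3 (isProfile_wideProfile hφ) k) ψ x‖ₑ ≤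
      C * min (∫⁻ x, ‖ψ x‖ₑ) (2 ^ (-k) * (2 ^ (-k) * ∫⁻ x, ‖negLaplacian ψ x‖ₑ)) := by
  have hw := isProfile_wideProfile hφ
  have hw2 := hw.div_sq (wideProfile_eventually_eq_zero hφ)
  have hw0 : wideProfile φ 0 = 0 := (wideProfile_eventually_eq_zero hφ).self_of_nhds
  refine ⟨(kernelNorm (radial R3 hw)).toNNReal + (kernelNorm (radial R3 hw2)).toNNReal,
    fun k ψ => ?_⟩
  push_cast
  rw [ENNReal.coe_toNNReal (kernelNorm_lt_top _).ne, ENNReal.coe_toNNReal (kernelNorm_lt_top _).ne]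
  rw [mul_min]
  refine le_min ?_ ?_
  · refine (lintegral_enorm_fourierMultiplier_le _ ψ).trans ?_
    rw [kernelNorm_sym]
    gcongr
    exact le_self_add
  -- Divide the symbol by `|ξ|²`; the quotient is again a dyadic symbol.
  · have hsymb : ∀ ξ : R3, sym R3 hw k ξ = (((2 : ℂ) ^ (-k)) ^ 2 • sym R3 hw2 k) ξ *
        (((2 * Real.pi) ^ 2 * ‖ξ‖ ^ 2 : ℝ) : ℂ) := by
      intro ξ
      rw [FunLike.coe_smul, Pi.smul_apply, sym_apply, sym_apply, smul_eq_mul]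
      rcases eq_or_ne ξ 0 with rfl | hξ
      · simp [hw0]
      · have h1 : (‖ξ‖ : ℂ) ≠ 0 := by simpa using hξ
        have h2 : (2 : ℂ) ^ (-k) ≠ 0 := zpow_ne_zero _ two_ne_zero
        have h3 : (Real.pi : ℂ) ≠ 0 := by simp [Real.pi_ne_zero]
        push_cast
        field_simp
    have h1 : SchwartzMap.fourierMultiplierCLM ℂ (sym R3 hw k) ψ =
        SchwartzMap.fourierMultiplierCLM ℂ (((2 : ℂ) ^ (-k)) ^ 2 • sym R3 hw2 k : 𝓢(R3, ℂ))
          (negLaplacian ψ) :=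
      (fourierMultiplier_fourierMultiplier (SchwartzMap.hasTemperateGrowth _)
        hasTemperateGrowth_negLaplacian hsymb ψ).symm
    rw [h1]
    refine (lintegral_enorm_fourierMultiplier_le _ _).trans ?_
    rw [kernelNorm_smul, kernelNorm_sym]
    have h2 : ‖((2 : ℂ) ^ (-k)) ^ 2‖ₑ = 2 ^ (-k) * 2 ^ (-k) := by
      rw [← ofReal_norm, norm_pow, norm_zpow, Complex.norm_ofNat, ENNReal.ofReal_pow (by positivity),
        ofReal_two_zpow, sq]
    rw [h2]
    calc 2 ^ (-k) * 2 ^ (-k) * kernelNorm (radial R3 hw2) * ∫⁻ x, ‖negLaplacian ψ x‖ₑ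
        = kernelNorm (radial R3 hw2) * (2 ^ (-k) * (2 ^ (-k) * ∫⁻ x, ‖negLaplacian ψ x‖ₑ)) := by
          ring
      _ ≤ _ := by
          gcongr
          exact le_add_self

lemma supNorm_isoBlock_le (k : ℤ) (u : 𝓢'(R3, ℂ)) :
    supNorm (isoBlock φ k u) ≤ 2 ^ k * besovNorm φ ∞ u := by
  have h1 : (2 : ℝ≥0∞) ^ (-k) * supNorm (isoBlock φ k u) ≤ besovNorm φ ∞ u := by
    rw [besovNorm, if_pos rfl]
    exact le_iSup (fun k : ℤ => (2 : ℝ≥0∞) ^ (-k) * supNorm (isoBlock φ k u)) k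
  calc supNorm (isoBlock φ k u) = 2 ^ k * (2 ^ (-k) * supNorm (isoBlock φ k u)) := by
        rw [← mul_assoc, two_zpow_mul_neg, one_mul]
    _ ≤ _ := by gcongr

/-- The summable weight `2^{-|k|}`. -/
def dyadicWeight (k : ℤ) : ℝ≥0∞ := min (2 ^ k) (2 ^ (-k))

lemma tsum_two_zpow_neg_nat : ∑' n : ℕ, (2 : ℝ≥0∞) ^ (-(n : ℤ)) = 2 := by
  have h : ∀ n : ℕ, (2 : ℝ≥0∞) ^ (-(n : ℤ)) = (2⁻¹ : ℝ≥0∞) ^ n := by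
    intro n
    rw [ENNReal.zpow_neg, zpow_natCast, ENNReal.inv_pow]
  simp_rw [h]
  rw [ENNReal.tsum_geometric, ENNReal.one_sub_inv_two, inv_inv]

lemma tsum_dyadicWeight_le : ∑' k : ℤ, dyadicWeight k ≤ 4 := by
  have h : (4 : ℝ≥0∞) = 2 + 2 := by norm_num
  rw [tsum_of_nat_of_neg_add_one ENNReal.summable ENNReal.summable, h]
  gcongr
  · rw [← tsum_two_zpow_neg_nat]
    exact ENNReal.tsum_le_tsum fun n => min_le_right _ _
  · rw [← tsum_two_zpow_neg_nat]
    refine ENNReal.tsum_le_tsum fun n => (min_le_left _ _).trans ?_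
    exact ENNReal.zpow_le_of_le one_le_two (by omega)

/-- Absolute convergence of the pairing of the dyadic blocks with a test function. -/
lemma exists_tsum_enorm_isoBlock_le (hφ : IsDyadicCutoff φ) :
    ∃ C : ℝ≥0, ∀ (u : 𝓢'(R3, ℂ)) (ψ : 𝓢(R3, ℂ)),
      ∑' k : ℤ, ‖isoBlock φ k u ψ‖ₑ ≤
        C * besovNorm φ ∞ u * ((∫⁻ x, ‖ψ x‖ₑ) + ∫⁻ x, ‖negLaplacian ψ x‖ₑ) := by
  obtain ⟨C, hC⟩ := exists_lintegral_wide_le hφ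
  refine ⟨C * 4, fun u ψ => ?_⟩
  set a := ∫⁻ x, ‖ψ x‖ₑ
  set b := ∫⁻ x, ‖negLaplacian ψ x‖ₑ
  have hk : ∀ k : ℤ, ‖isoBlock φ k u ψ‖ₑ ≤
      (C * besovNorm φ ∞ u * (a + b)) * dyadicWeight k := by
    intro k
    have h1 : (2 : ℝ≥0∞) ^ k * min a (2 ^ (-k) * (2 ^ (-k) * b)) ≤ (a + b) * dyadicWeight k := by
      rw [dyadicWeight, mul_min (a + b)]
      refine le_min ?_ ?_
      · rw [mul_comm (a + b)]
        gcongr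
        exact (min_le_left _ _).trans le_self_add
      · calc (2 : ℝ≥0∞) ^ k * min a (2 ^ (-k) * (2 ^ (-k) * b))
            ≤ 2 ^ k * (2 ^ (-k) * (2 ^ (-k) * b)) := by gcongr; exact min_le_right _ _
          _ = b * 2 ^ (-k) := by rw [← mul_assoc, two_zpow_mul_neg, one_mul, mul_comm]
          _ ≤ _ := by gcongr; exact le_add_self
    calc ‖isoBlock φ k u ψ‖ₑ
        ≤ (2 ^ k * besovNorm φ ∞ u) * (C * min a (2 ^ (-k) * (2 ^ (-k) * b))) :=
          (enorm_isoBlock_apply_le hφ k u ψ).trans (mul_le_mul' (supNorm_isoBlock_le k u) (hC k ψ))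
      _ = C * besovNorm φ ∞ u * (2 ^ k * min a (2 ^ (-k) * (2 ^ (-k) * b))) := by ring
      _ ≤ C * besovNorm φ ∞ u * ((a + b) * dyadicWeight k) := by gcongr
      _ = _ := by ring
  refine (ENNReal.tsum_le_tsum hk).trans ?_
  rw [ENNReal.tsum_mul_left]
  calc _ ≤ (C * besovNorm φ ∞ u * (a + b)) * 4 := by gcongr; exact tsum_dyadicWeight_le
    _ = _ := by push_cast; ring

/-- The low frequency cutoff `S_k`. -/
def lowMul (hφ : IsDyadicCutoff φ) (k : ℤ) : 𝓢(R3, ℂ) →L[ℂ] 𝓢(R3, ℂ) :=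
  SchwartzMap.fourierMultiplierCLM ℂ (sym R3 (isProfile_lowProfile hφ) k)

lemma lowMul_succ_sub (hφ : IsDyadicCutoff φ) (k : ℤ) (ψ : 𝓢(R3, ℂ)) :
    lowMul hφ (k + 1) ψ - lowMul hφ k ψ =
      SchwartzMap.fourierMultiplierCLM ℂ (sym R3 hφ.isProfile k) ψ := by
  have h1 : (sym R3 hφ.isProfile k : R3 → ℂ) =
      sym R3 (isProfile_lowProfile hφ) (k + 1) - sym R3 (isProfile_lowProfile hφ) k := by
    funext ξ
    rw [Pi.sub_apply, sym_apply, sym_apply, sym_apply, ← Complex.ofReal_sub,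
      lowProfile_succ_sub hφ (by positivity)]
  rw [lowMul, lowMul, h1, SchwartzMap.fourierMultiplierCLM_apply,
    SchwartzMap.fourierMultiplierCLM_apply, SchwartzMap.fourierMultiplierCLM_apply,
    SchwartzMap.smulLeftCLM_sub (SchwartzMap.hasTemperateGrowth _)
    (SchwartzMap.hasTemperateGrowth _), sub_apply, sub_eq_add_neg, sub_eq_add_neg,
    FourierTransform.fourierInv_add, FourierTransform.fourierInv_neg]

lemma sum_Ico_neg_isoBlock_apply (hφ : IsDyadicCutoff φ) (u : 𝓢'(R3, ℂ)) (ψ : 𝓢(R3, ℂ)) (n : ℕ) :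
    ∑ k ∈ Finset.Ico (-(n : ℤ)) n, isoBlock φ k u ψ =
      u (lowMul hφ n ψ) - u (lowMul hφ (-n) ψ) := by
  induction n with
  | zero => simp
  | succ n ih =>
    have h1 : Finset.Ico (-((n + 1 : ℕ) : ℤ)) ((n + 1 : ℕ) : ℤ) =
        insert (n : ℤ) (insert (-(n : ℤ) - 1) (Finset.Ico (-(n : ℤ)) n)) := by
      ext k
      simp only [Finset.mem_Ico, Finset.mem_insert]
      omega
    rw [h1, Finset.sum_insert, Finset.sum_insert, ih, isoBlock_apply hφ, isoBlock_apply hφ,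
      ← lowMul_succ_sub hφ, ← lowMul_succ_sub hφ, map_sub, map_sub]
    · rw [show -(n : ℤ) - 1 + 1 = -n by ring, show (-((n + 1 : ℕ) : ℤ)) = -(n : ℤ) - 1 by push_cast; ring]
      push_cast
      ring
    · simp only [Finset.mem_Ico]
      omega
    · simp only [Finset.mem_insert, Finset.mem_Ico]
      omega

lemma tendsto_lowMul (hφ : IsDyadicCutoff φ) (u : 𝓢'(R3, ℂ)) (ψ : 𝓢(R3, ℂ)) :
    Tendsto (fun n : ℕ => u (lowMul hφ n ψ)) atTop (𝓝 (u ψ)) := by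
  have h0 : radial R3 (isProfile_lowProfile hφ) 0 = 1 := by
    rw [radial_apply, norm_zero, mul_zero, lowProfile_eq_one hφ (by norm_num), Complex.ofReal_one]
  have hlim : Tendsto (fun n : ℕ => (2 : ℝ) ^ (-(n : ℤ))) atTop (𝓝 0) := by
    simp_rw [zpow_neg, zpow_natCast, ← inv_pow]
    exact tendsto_pow_atTop_nhds_zero_of_lt_one (by norm_num) (by norm_num)
  have h1 := tendsto_fourierMultiplier_dilate h0 (fun n : ℕ => two_zpow_neg_pos n) hlim ψ
  exact (u.continuous.tendsto ψ).comp h1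

/-- A distribution with finite `Ḃ^{-1}_{∞,∞}` norm and without low frequency part is the sum of its
dyadic blocks. -/
lemma hasSum_isoBlock_of_tendsto (hφ : IsDyadicCutoff φ) {u : 𝓢'(R3, ℂ)}
    (hu : besovNorm φ ∞ u < ∞)
    (hlow : ∀ ψ, Tendsto (fun n : ℕ => u (lowMul hφ (-n) ψ)) atTop (𝓝 0)) :
    HasSum (fun k : ℤ => isoBlock φ k u) u := by
  obtain ⟨C, hC⟩ := exists_tsum_enorm_isoBlock_le hφ
  rw [HasSum, PointwiseConvergenceCLM.tendsto_iff_forall_tendsto]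
  intro ψ
  have hfin : ∑' k : ℤ, ‖isoBlock φ k u ψ‖ₑ ≠ ∞ := by
    refine ((hC u ψ).trans_lt ?_).ne
    refine ENNReal.mul_lt_top (ENNReal.mul_lt_top ENNReal.coe_lt_top hu) ?_
    exact ENNReal.add_lt_top.2 ⟨lintegral_enorm_lt_top ψ, lintegral_enorm_lt_top (negLaplacian ψ)⟩
  have hsum : Summable fun k : ℤ => isoBlock φ k u ψ := by
    refine Summable.of_norm ?_
    simpa using ENNReal.summable_toReal hfin
  have h1 : Tendsto (fun n : ℕ => ∑ k ∈ Finset.Ico (-(n : ℤ)) n, isoBlock φ k u ψ) atTop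
      (𝓝 (∑' k : ℤ, isoBlock φ k u ψ)) := by
    have h := hsum.hasSum
    simp only [HasSum, SummationFilter.unconditional_filter] at h
    refine h.comp (Monotone.tendsto_atTop_finset ?_ ?_)
    · intro m n hmn
      exact Finset.Ico_subset_Ico (by omega) (by omega)
    · intro k
      refine ⟨k.natAbs + 1, ?_⟩
      rw [Finset.mem_Ico]
      omega
  have h2 : Tendsto (fun n : ℕ => ∑ k ∈ Finset.Ico (-(n : ℤ)) n, isoBlock φ k u ψ) atTop
      (𝓝 (u ψ - 0)) := by
    simp_rw [sum_Ico_neg_isoBlock_apply hφ]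
    exact (tendsto_lowMul hφ u ψ).sub (hlow ψ)
  rw [sub_zero] at h2
  have h3 := hsum.hasSum
  rw [tendsto_nhds_unique h1 h2, HasSum] at h3
  simpa using h3

end Blocks

/-! ### The heat flow -/

/-- The Fourier transform of the heat kernel. -/
def gaussSym (t : ℝ) (ht : 0 < t) : 𝓢(R3, ℂ) := 𝓕 (heatKernel t ht)

lemma gaussSym_apply (t : ℝ) (ht : 0 < t) (ξ : R3) :
    gaussSym t ht ξ = ((Real.exp (-(t * (2 * Real.pi * ‖ξ‖) ^ 2)) : ℝ) : ℂ) := by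
  have hb : (0 : ℝ) < ((1 / (4 * t) : ℝ) : ℂ).re := by
    rw [Complex.ofReal_re]; positivity
  have h1 : (fun v : R3 => heatKernel t ht v) = fun v =>
      (((4 * Real.pi * t) ^ (-(3 / 2) : ℝ) : ℝ) : ℂ) •
        Complex.exp (-((1 / (4 * t) : ℝ) : ℂ) * ‖v‖ ^ 2) := by
    funext v
    change Real.exp (-(1 / (4 * t)) * ‖v‖ ^ 2) • (((4 * Real.pi * t) ^ (-(3 / 2) : ℝ) : ℝ) : ℂ) = _
    rw [Complex.real_smul, smul_eq_mul, mul_comm]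
    push_cast
    rfl
  have h2 : gaussSym t ht ξ = 𝓕 (fun v : R3 => heatKernel t ht v) ξ := by
    rw [gaussSym, SchwartzMap.fourier_coe]
  have h3 : 𝓕 (fun v : R3 => (((4 * Real.pi * t) ^ (-(3 / 2) : ℝ) : ℝ) : ℂ) •
        Complex.exp (-((1 / (4 * t) : ℝ) : ℂ) * ‖v‖ ^ 2)) ξ =
      (((4 * Real.pi * t) ^ (-(3 / 2) : ℝ) : ℝ) : ℂ) •
        𝓕 (fun v : R3 => Complex.exp (-((1 / (4 * t) : ℝ) : ℂ) * ‖v‖ ^ 2)) ξ := by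
    rw [Real.fourier_eq, Real.fourier_eq, ← integral_smul]
    congr 1
    funext v
    rw [smul_comm]
  rw [h2, h1, h3, fourier_gaussian_innerProductSpace hb]
  have h4 : ((Real.pi : ℂ) / ((1 / (4 * t) : ℝ) : ℂ)) = ((4 * Real.pi * t : ℝ) : ℂ) := by
    have : (t : ℂ) ≠ 0 := by exact_mod_cast ht.ne'
    push_cast
    field_simp
  have h5 : ((Module.finrank ℝ R3 : ℂ) / 2) = ((3 / 2 : ℝ) : ℂ) := by
    rw [finrank_euclideanSpace_fin]
    push_cast
    rfl
  rw [h4, h5, ← Complex.ofReal_cpow (by positivity), smul_eq_mul, ← mul_assoc,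
    ← Complex.ofReal_mul, ← Real.rpow_add (by positivity)]
  norm_num
  congr 1
  have : (t : ℂ) ≠ 0 := by exact_mod_cast ht.ne'
  field_simp
  ring

lemma fourierInv_gaussSym (t : ℝ) (ht : 0 < t) : 𝓕⁻ (gaussSym t ht) = heatKernel t ht := by
  rw [gaussSym, FourierTransform.fourierInv_fourier_eq]

lemma heatFlow_eq {t : ℝ} (ht : 0 < t) (u : 𝓢'(R3, ℂ)) (y : R3) :
    heatFlow u t y = u ((heatKernel t ht).compSubConstCLM ℂ y) := by
  rw [heatFlow, dif_pos ht]

lemma gaussSym_eq_dilate (t : ℝ) (ht : 0 < t) :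
    gaussSym t ht = dilate (Real.sqrt_pos.2 ht) (gaussSym 1 one_pos) := by
  ext ξ
  rw [dilate_apply, gaussSym_apply, gaussSym_apply, norm_smul, Real.norm_eq_abs,
    abs_of_nonneg (Real.sqrt_nonneg t)]
  congr 3
  have := Real.sq_sqrt ht.le
  linear_combination (-(2 * Real.pi * ‖ξ‖) ^ 2) * this

lemma lintegral_enorm_heatKernel (t : ℝ) (ht : 0 < t) :
    ∫⁻ x, ‖heatKernel t ht x‖ₑ = kernelNorm (gaussSym 1 one_pos) := by
  rw [← fourierInv_gaussSym, gaussSym_eq_dilate]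
  exact kernelNorm_dilate _ _

lemma lintegral_enorm_negLaplacian_heatKernel (t : ℝ) (ht : 0 < t) :
    ∫⁻ x, ‖negLaplacian (heatKernel t ht) x‖ₑ =
      ENNReal.ofReal t⁻¹ * kernelNorm (𝓕 (negLaplacian (heatKernel 1 one_pos))) := by
  have hF : ∀ (s : ℝ) (hs : 0 < s) (ξ : R3), 𝓕 (negLaplacian (heatKernel s hs)) ξ =
      (((2 * Real.pi) ^ 2 * ‖ξ‖ ^ 2 : ℝ) : ℂ) * gaussSym s hs ξ := by
    intro s hs ξ
    rw [negLaplacian, SchwartzMap.fourierMultiplierCLM_apply, FourierTransform.fourier_fourierInv_eq,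
      SchwartzMap.smulLeftCLM_apply_apply hasTemperateGrowth_negLaplacian, smul_eq_mul, gaussSym]
  have h1 : 𝓕 (negLaplacian (heatKernel t ht)) =
      (((t⁻¹ : ℝ) : ℂ)) • dilate (Real.sqrt_pos.2 ht) (𝓕 (negLaplacian (heatKernel 1 one_pos))) := by
    ext ξ
    rw [smul_apply, dilate_apply, hF, hF, gaussSym_eq_dilate t ht, dilate_apply, smul_eq_mul,
      norm_smul, Real.norm_eq_abs, abs_of_nonneg (Real.sqrt_nonneg t), mul_pow (√t) ‖ξ‖, Real.sq_sqrt ht.le,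
      ← mul_assoc, ← Complex.ofReal_mul]
    congr 2
    field_simp
  have h2 : ∫⁻ x, ‖negLaplacian (heatKernel t ht) x‖ₑ =
      kernelNorm (𝓕 (negLaplacian (heatKernel t ht))) := by
    rw [kernelNorm, FourierTransform.fourierInv_fourier_eq]
  rw [h2, h1]
  rw [kernelNorm_smul, kernelNorm_dilate]
  congr 1
  rw [← ofReal_norm, Complex.norm_real, Real.norm_of_nonneg (by positivity)]

/-- The weight `min(1, (4^k t)⁻¹)`, which bounds the heat semigroup on frequencies of size
`2^k`. -/
def heatWeight (k : ℤ) (t : ℝ) : ℝ≥0∞ := min 1 (2 ^ (-k) * (2 ^ (-k) * ENNReal.ofReal t⁻¹))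

lemma enorm_le_tsum_enorm_of_hasSum {ι : Type*} {f : ι → ℂ} {a : ℂ} (h : HasSum f a) :
    ‖a‖ₑ ≤ ∑' i, ‖f i‖ₑ := by
  refine le_of_tendsto (h.enorm) (Eventually.of_forall fun s => ?_)
  exact (enorm_sum_le _ _).trans (ENNReal.sum_le_tsum s)

lemma tendsto_zero_of_enorm_le_two_zpow {a : ℕ → ℂ} {D : ℝ≥0∞} (hD : D ≠ ∞)
    (h : ∀ n : ℕ, ‖a n‖ₑ ≤ 2 ^ (-(n : ℤ)) * D) : Tendsto a atTop (𝓝 0) := by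
  rw [tendsto_zero_iff_enorm_tendsto_zero]
  have h1 : Tendsto (fun n : ℕ => (2 : ℝ≥0∞) ^ (-(n : ℤ)) * D) atTop (𝓝 (0 * D)) := by
    refine ENNReal.Tendsto.mul_const ?_ (Or.inr hD)
    simp only [ENNReal.zpow_neg, zpow_natCast, ENNReal.inv_pow]
    exact ENNReal.tendsto_pow_atTop_nhds_zero_of_lt_one (by simp)
  rw [zero_mul] at h1
  exact tendsto_of_tendsto_of_tendsto_of_le_of_le tendsto_const_nhds h1 (fun _ => zero_le) h

/-- The pointwise bound of the heat flow by the dyadic blocks: the heat kernel is an `L^1` test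
function of bounded norm whose Laplacian has norm of order `t⁻¹`. -/
lemma exists_enorm_heatFlow_le {φ : ℝ → ℝ} (hφ : IsDyadicCutoff φ) : ∃ C : ℝ≥0, ∀ (u : 𝓢'(R3, ℂ)),
    HasSum (fun k : ℤ => isoBlock φ k u) u → ∀ t : ℝ, 0 < t → ∀ y : R3,
      ‖heatFlow u t y‖ₑ ≤ C * ∑' k : ℤ, heatWeight k t * supNorm (isoBlock φ k u) := by
  obtain ⟨C, hC⟩ := exists_lintegral_wide_le hφ
  set D := kernelNorm (gaussSym 1 one_pos) +
    kernelNorm (𝓕 (negLaplacian (heatKernel 1 one_pos))) with hD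
  have hDtop : D ≠ ∞ := (ENNReal.add_lt_top.2 ⟨kernelNorm_lt_top _, kernelNorm_lt_top _⟩).ne
  refine ⟨C * D.toNNReal, fun u hu t ht y => ?_⟩
  rw [heatFlow_eq ht]
  set ψ := (heatKernel t ht).compSubConstCLM ℂ y with hψ
  have hsum : HasSum (fun k : ℤ => isoBlock φ k u ψ) (u ψ) := by
    rw [HasSum, PointwiseConvergenceCLM.tendsto_iff_forall_tendsto] at hu
    simpa [HasSum] using hu ψ
  have hk : ∀ k : ℤ, ‖isoBlock φ k u ψ‖ₑ ≤
      (C * D) * (heatWeight k t * supNorm (isoBlock φ k u)) := by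
    intro k
    refine (enorm_isoBlock_apply_le hφ k u ψ).trans ?_
    rw [hψ, fourierMultiplier_translate, lintegral_enorm_translate]
    refine (mul_le_mul' le_rfl (hC k _)).trans ?_
    have h1 : min (∫⁻ x, ‖heatKernel t ht x‖ₑ)
        (2 ^ (-k) * (2 ^ (-k) * ∫⁻ x, ‖negLaplacian (heatKernel t ht) x‖ₑ)) ≤
        D * heatWeight k t := by
      rw [heatWeight, mul_min D, lintegral_enorm_heatKernel,
        lintegral_enorm_negLaplacian_heatKernel, mul_one]
      refine min_le_min le_self_add ?_
      calc _ = kernelNorm (𝓕 (negLaplacian (heatKernel 1 one_pos))) *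
            (2 ^ (-k) * (2 ^ (-k) * ENNReal.ofReal t⁻¹)) := by ring
        _ ≤ _ := by gcongr; exact le_add_self
    calc _ ≤ supNorm (isoBlock φ k u) * (C * (D * heatWeight k t)) := by gcongr
      _ = _ := by ring
  push_cast
  rw [ENNReal.coe_toNNReal hDtop, ← ENNReal.tsum_mul_left]
  exact (enorm_le_tsum_enorm_of_hasSum hsum).trans (ENNReal.tsum_le_tsum hk)

lemma exists_two_zpow_le {s : ℝ} (hs : 0 < s) :
    ∃ n : ℤ, ENNReal.ofReal s ≤ 2 ^ n ∧ (2 : ℝ≥0∞) ^ n ≤ 2 * ENNReal.ofReal s := by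
  obtain ⟨n, h1, h2⟩ := exists_zpow_mem_Ico hs
  refine ⟨n + 1, ?_, ?_⟩
  · rw [← ofReal_two_zpow]
    exact ENNReal.ofReal_le_ofReal h2.le
  · rw [two_zpow_add, zpow_one, mul_comm, ← ofReal_two_zpow]
    gcongr

/-- The sum is dominated by the two geometric series that meet at `2^k ≈ t^{-1/2}`. -/
lemma tsum_two_zpow_mul_heatWeight_le {t : ℝ} (ht : 0 < t) :
    ∑' k : ℤ, 2 ^ k * heatWeight k t ≤ 8 * ENNReal.ofReal (t ^ (-(1 / 2) : ℝ)) := by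
  obtain ⟨n, h1, h2⟩ := exists_two_zpow_le (Real.rpow_pos_of_pos ht (-(1 / 2) : ℝ))
  have hk : ∀ k : ℤ, (2 : ℝ≥0∞) ^ k * heatWeight k t ≤ 2 ^ n * dyadicWeight (k - n) := by
    intro k
    rw [dyadicWeight, mul_min ((2 : ℝ≥0∞) ^ n), ← two_zpow_add, ← two_zpow_add,
      show n + (k - n) = k by ring]
    refine le_min ?_ ?_
    · refine (mul_le_mul' le_rfl (min_le_left _ _)).trans ?_
      rw [mul_one]
    · refine (mul_le_mul' le_rfl (min_le_right _ _)).trans ?_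
      rw [← mul_assoc, two_zpow_mul_neg, one_mul]
      have h3 : ENNReal.ofReal t⁻¹ ≤ 2 ^ n * 2 ^ n := by
        have h4 : t⁻¹ = t ^ (-(1 / 2) : ℝ) * t ^ (-(1 / 2) : ℝ) := by
          rw [← Real.rpow_add ht, ← Real.rpow_neg_one]
          norm_num
        rw [h4, ENNReal.ofReal_mul (by positivity)]
        gcongr
      calc (2 : ℝ≥0∞) ^ (-k) * ENNReal.ofReal t⁻¹ ≤ 2 ^ (-k) * (2 ^ n * 2 ^ n) := by gcongr
        _ = 2 ^ (n + -(k - n)) := by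
          rw [← two_zpow_add, ← two_zpow_add]
          congr 1
          ring
  refine (ENNReal.tsum_le_tsum hk).trans ?_
  rw [ENNReal.tsum_mul_left]
  calc (2 : ℝ≥0∞) ^ n * ∑' k : ℤ, dyadicWeight (k - n) = 2 ^ n * ∑' k : ℤ, dyadicWeight k := by
        congr 1
        exact (Equiv.subRight n).tsum_eq dyadicWeight
    _ ≤ (2 * ENNReal.ofReal (t ^ (-(1 / 2) : ℝ))) * 4 := by
        gcongr
        exact tsum_dyadicWeight_le
    _ = _ := by ring

lemma holderInvNorm_le_of_enorm_le {u : 𝓢'(R3, ℂ)} {C : ℝ≥0∞}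
    (h : ∀ t : ℝ, 0 < t → ∀ y, ‖heatFlow u t y‖ₑ ≤ C * ENNReal.ofReal (t ^ (-(1 / 2) : ℝ))) :
    holderInvNorm u ≤ C := by
  refine iSup₂_le fun t ht => ?_
  have h1 : eLpNorm (heatFlow u t) ∞ volume ≤ C * ENNReal.ofReal (t ^ (-(1 / 2) : ℝ)) := by
    rw [eLpNorm_exponent_top]
    exact essSup_le_of_ae_le _ (Eventually.of_forall (h t ht))
  calc _ ≤ ENNReal.ofReal (t ^ (1 / 2 : ℝ)) * (C * ENNReal.ofReal (t ^ (-(1 / 2) : ℝ))) := by gcongr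
    _ = C * ENNReal.ofReal (t ^ (1 / 2 : ℝ) * t ^ (-(1 / 2) : ℝ)) := by
      rw [ENNReal.ofReal_mul (by positivity)]
      ring
    _ = C := by rw [← Real.rpow_add ht]; norm_num

/-- `Ḃ^{-1}_{∞,∞} ⊂ C^{-1}`. -/
lemma besov_top_embedsIn_holderInv {φ : ℝ → ℝ} (hφ : IsDyadicCutoff φ) :
    (besov φ ∞).EmbedsIn holderInv := by
  obtain ⟨C, hC⟩ := exists_enorm_heatFlow_le hφ
  have key : ∀ u ∈ (besov φ ∞).carrier, holderInvNorm u ≤ (C * 8 : ℝ≥0) * besovNorm φ ∞ u := by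
    intro u hu
    refine holderInvNorm_le_of_enorm_le fun t ht y => (hC u hu.1 t ht y).trans ?_
    calc (C : ℝ≥0∞) * ∑' k : ℤ, heatWeight k t * supNorm (isoBlock φ k u)
        ≤ C * ∑' k : ℤ, (2 ^ k * heatWeight k t) * besovNorm φ ∞ u := by
          gcongr C * ?_
          refine ENNReal.tsum_le_tsum fun k => ?_
          calc _ ≤ heatWeight k t * (2 ^ k * besovNorm φ ∞ u) := by
                gcongr; exact supNorm_isoBlock_le k u
            _ = _ := by ring
      _ ≤ C * ((8 * ENNReal.ofReal (t ^ (-(1 / 2) : ℝ))) * besovNorm φ ∞ u) := by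
          rw [ENNReal.tsum_mul_right]
          gcongr
          exact tsum_two_zpow_mul_heatWeight_le ht
      _ = _ := by push_cast; ring
  refine ⟨fun u hu => (key u hu).trans_lt (ENNReal.mul_lt_top ENNReal.coe_lt_top hu.2),
    C * 8, key⟩

/-! ### From the heat flow to the dyadic blocks -/

lemma enorm_heatFlow_le_ae (u : 𝓢'(R3, ℂ)) {t : ℝ} (ht : 0 < t) :
    ∀ᵐ y, ‖heatFlow u t y‖ₑ ≤ ENNReal.ofReal (t ^ (-(1 / 2) : ℝ)) * holderInvNorm u := by
  have h1 : ENNReal.ofReal (t ^ (1 / 2 : ℝ)) * eLpNorm (heatFlow u t) ∞ volume ≤ holderInvNorm u :=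
    le_iSup₂ (f := fun (t : ℝ) (_ : 0 < t) =>
      ENNReal.ofReal (t ^ (1 / 2 : ℝ)) * eLpNorm (heatFlow u t) ∞ volume) t ht
  have h2 : eLpNorm (heatFlow u t) ∞ volume ≤
      ENNReal.ofReal (t ^ (-(1 / 2) : ℝ)) * holderInvNorm u := by
    calc eLpNorm (heatFlow u t) ∞ volume = ENNReal.ofReal (t ^ (-(1 / 2) : ℝ)) *
          (ENNReal.ofReal (t ^ (1 / 2 : ℝ)) * eLpNorm (heatFlow u t) ∞ volume) := by
          rw [← mul_assoc, ← ENNReal.ofReal_mul (by positivity), ← Real.rpow_add ht]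
          norm_num
      _ ≤ _ := by gcongr
  rw [eLpNorm_exponent_top] at h2
  filter_upwards [enorm_ae_le_eLpNormEssSup (heatFlow u t) volume] with y hy
  exact hy.trans h2

/-- A multiplier whose symbol contains a Gaussian factor is controlled by the heat flow. -/
lemma enorm_apply_fourierMultiplier_le {m m' : 𝓢(R3, ℂ)} {t : ℝ} (ht : 0 < t)
    (h : ∀ ξ, m ξ = gaussSym t ht ξ * m' ξ) (u : 𝓢'(R3, ℂ)) (ψ : 𝓢(R3, ℂ)) :
    ‖u (SchwartzMap.fourierMultiplierCLM ℂ m ψ)‖ₑ ≤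
      ENNReal.ofReal (t ^ (-(1 / 2) : ℝ)) * holderInvNorm u * (kernelNorm m' * ∫⁻ x, ‖ψ x‖ₑ) := by
  rw [← fourierMultiplier_fourierMultiplier (SchwartzMap.hasTemperateGrowth _)
    (SchwartzMap.hasTemperateGrowth _) h, fourierMultiplier_apply_eq_integral]
  refine (enorm_integral_le_lintegral_enorm _).trans ?_
  refine le_trans ?_ (mul_le_mul' le_rfl (lintegral_enorm_fourierMultiplier_le m' ψ))
  rw [← lintegral_const_mul _ (SchwartzMap.continuous _).enorm.measurable]
  refine lintegral_mono_ae ?_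
  filter_upwards [enorm_heatFlow_le_ae u ht] with y hy
  rw [heatFlow_eq ht] at hy
  rw [fourierInv_gaussSym, enorm_mul, mul_comm]
  gcongr

/-- Localization of `u` at frequencies of size at most `2^k` costs a factor `2^k` in the norm of
`C^{-1}`: the heat semigroup at time `4^{-k}` is invertible on such frequencies. -/
lemma enorm_apply_sym_le {θ : ℝ → ℝ} (hθ : IsProfile θ) (k : ℤ) (u : 𝓢'(R3, ℂ)) (ψ : 𝓢(R3, ℂ)) :
    ‖u (SchwartzMap.fourierMultiplierCLM ℂ (sym R3 hθ k) ψ)‖ₑ ≤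
      2 ^ k * holderInvNorm u * (kernelNorm (radial R3 hθ.mul_exp) * ∫⁻ x, ‖ψ x‖ₑ) := by
  -- The time `t = 4^{-k}`, at which the Gaussian factor lives at the scale of the symbol.
  have ht : (0 : ℝ) < ((2 : ℝ) ^ (-k)) ^ 2 := by positivity
  have h := enorm_apply_fourierMultiplier_le (m := sym R3 hθ k) (m' := sym R3 hθ.mul_exp k) ht
    (fun ξ => ?_) u ψ
  · rw [kernelNorm_sym] at h
    refine h.trans_eq ?_
    congr 2
    rw [← ofReal_two_zpow, ← Real.rpow_natCast, ← Real.rpow_mul (by positivity)]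
    norm_num
    rw [Real.rpow_neg_one, inv_inv]
  · rw [sym_apply, sym_apply, gaussSym_apply, ← Complex.ofReal_mul,
      mul_left_comm (Real.exp _) (θ _), ← Real.exp_add, mul_pow (2 ^ (-k) : ℝ), neg_add_cancel, Real.exp_zero, mul_one]

/-- `C^{-1} ⊂ Ḃ^{-1}_{∞,∞}`. -/
lemma holderInv_embedsIn_besov_top {φ : ℝ → ℝ} (hφ : IsDyadicCutoff φ) :
    holderInv.EmbedsIn (besov φ ∞) := by
  set C := kernelNorm (radial R3 hφ.isProfile.mul_exp) *
    kernelNorm (radial R3 (isProfile_wideProfile hφ)) with hC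
  have hCtop : C ≠ ∞ := (ENNReal.mul_lt_top (kernelNorm_lt_top _) (kernelNorm_lt_top _)).ne
  have key : ∀ u : 𝓢'(R3, ℂ), besovNorm φ ∞ u ≤ C.toNNReal * holderInvNorm u := by
    intro u
    rw [ENNReal.coe_toNNReal hCtop, besovNorm, if_pos rfl]
    refine iSup_le fun k => ?_
    have h1 : supNorm (isoBlock φ k u) ≤ 2 ^ k * holderInvNorm u * C := by
      rw [isoBlock, isoSymbol_eq hφ]
      refine supNorm_fourierMultiplier_le (sym_even _ _) u fun y => ?_
      have h2 : 𝓕⁻ (sym R3 hφ.isProfile k) = SchwartzMap.fourierMultiplierCLM ℂ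
          (sym R3 hφ.isProfile k) (𝓕⁻ (sym R3 (isProfile_wideProfile hφ) k)) := by
        rw [fourierMultiplier_fourierInv _ _ (sym R3 hφ.isProfile k)]
        intro ξ
        rw [sym_apply, sym_apply, ← Complex.ofReal_mul, mul_comm (φ _), wideProfile_mul hφ]
      rw [h2, ← fourierMultiplier_translate]
      refine (enorm_apply_sym_le _ _ _ _).trans ?_
      rw [lintegral_enorm_translate]
      change _ * (_ * kernelNorm _) ≤ _
      rw [kernelNorm_sym]
    calc (2 : ℝ≥0∞) ^ (-k) * supNorm (isoBlock φ k u)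
        ≤ 2 ^ (-k) * (2 ^ k * holderInvNorm u * C) := by gcongr
      _ = (2 ^ k * 2 ^ (-k)) * (C * holderInvNorm u) := by ring
      _ = _ := by rw [two_zpow_mul_neg, one_mul]
  refine ⟨fun u hu => ?_, C.toNNReal, fun u _ => key u⟩
  have hfin : besovNorm φ ∞ u < ∞ := (key u).trans_lt (ENNReal.mul_lt_top ENNReal.coe_lt_top hu)
  refine ⟨hasSum_isoBlock_of_tendsto hφ hfin fun ψ => ?_, hfin⟩
  set D := holderInvNorm u *
    (kernelNorm (radial R3 (isProfile_lowProfile hφ).mul_exp) * ∫⁻ x, ‖ψ x‖ₑ) with hD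
  have hDtop : D ≠ ∞ := (ENNReal.mul_lt_top hu (ENNReal.mul_lt_top (kernelNorm_lt_top _)
    (lintegral_enorm_lt_top ψ))).ne
  exact tendsto_zero_of_enorm_le_two_zpow hDtop fun n =>
    (enorm_apply_sym_le (isProfile_lowProfile hφ) (-n) u ψ).trans_eq (mul_assoc _ _ _)

/-! ### The Carleson norm of the heat flow -/

lemma tsum_mul_sq_le {ι : Type*} (f g : ι → ℝ≥0∞) :
    (∑' i, f i * g i) ^ 2 ≤ (∑' i, f i ^ 2) * ∑' i, g i ^ 2 := by
  let _ : MeasurableSpace ι := ⊤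
  have h := ENNReal.lintegral_mul_le_Lp_mul_Lq (Measure.count : Measure ι)
    (p := 2) (q := 2) Real.HolderConjugate.two_two
    (f := f) (g := g) measurable_from_top.aemeasurable measurable_from_top.aemeasurable
  simp only [lintegral_count, Pi.mul_apply, ENNReal.rpow_two] at h
  calc (∑' i, f i * g i) ^ 2 ≤ ((∑' i, f i ^ 2) ^ (1 / 2 : ℝ) * (∑' i, g i ^ 2) ^ (1 / 2 : ℝ)) ^ 2 := by
        gcongr
    _ = _ := by
        rw [mul_pow, ← ENNReal.rpow_natCast, ← ENNReal.rpow_natCast, ← ENNReal.rpow_mul,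
          ← ENNReal.rpow_mul]
        norm_num

/-- The Cauchy-Schwarz inequality with the weight `w`. -/
lemma tsum_weight_mul_sq_le (w a : ℤ → ℝ≥0∞) :
    (∑' k, w k * a k) ^ 2 ≤
      (∑' k : ℤ, 2 ^ k * w k) * ∑' k : ℤ, w k * (2 ^ (-k) * a k ^ 2) := by
  have hsq : ∀ x : ℝ≥0∞, (x ^ (1 / 2 : ℝ)) ^ 2 = x := fun x => by
    rw [← ENNReal.rpow_natCast, ← ENNReal.rpow_mul]; norm_num
  have h := tsum_mul_sq_le (fun k : ℤ => (2 ^ k * w k) ^ (1 / 2 : ℝ))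
    (fun k : ℤ => (w k * (2 ^ (-k) * a k ^ 2)) ^ (1 / 2 : ℝ))
  simp only [hsq] at h
  refine le_trans (le_of_eq ?_) h
  congr 1
  refine tsum_congr fun k => ?_
  rw [← ENNReal.mul_rpow_of_nonneg _ _ (by norm_num)]
  have h1 : 2 ^ k * w k * (w k * (2 ^ (-k) * a k ^ 2)) = (w k * a k) ^ 2 := by
    calc _ = (2 ^ k * 2 ^ (-k)) * (w k * a k) ^ 2 := by ring
      _ = _ := by rw [two_zpow_mul_neg, one_mul]
  rw [h1, ← ENNReal.rpow_natCast, ← ENNReal.rpow_mul]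
  norm_num

lemma measurable_heatWeight (k : ℤ) : Measurable (heatWeight k) := by
  unfold heatWeight
  fun_prop

/-- The integral splits at `t = 4^{-k}`. -/
lemma lintegral_heatWeight_le (k : ℤ) :
    ∫⁻ t in Set.Ioi (0 : ℝ), ENNReal.ofReal (t ^ (-(1 / 2) : ℝ)) * heatWeight k t ≤
      4 * 2 ^ (-k) := by
  set r : ℝ := (2 : ℝ) ^ (-k) with hr
  have hr0 : 0 < r := by positivity
  have hs0 : 0 < r ^ 2 := by positivity
  have h1 : ∫⁻ t in Set.Ioc 0 (r ^ 2), ENNReal.ofReal (t ^ (-(1 / 2) : ℝ)) = ENNReal.ofReal (2 * r) := by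
    have hi : IntervalIntegrable (fun t : ℝ => t ^ (-(1 / 2) : ℝ)) volume 0 (r ^ 2) :=
      intervalIntegral.intervalIntegrable_rpow' (by norm_num)
    rw [← ofReal_integral_eq_lintegral_ofReal ((intervalIntegrable_iff_integrableOn_Ioc_of_le
      hs0.le).1 hi), ← intervalIntegral.integral_of_le hs0.le, integral_rpow (Or.inl (by norm_num))]
    · congr 1
      norm_num
      rw [← Real.sqrt_eq_rpow, Real.sqrt_sq hr0.le]
      ring
    · filter_upwards [ae_restrict_mem measurableSet_Ioc] with t ht
      exact Real.rpow_nonneg ht.1.le _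
  have h2 : ∫⁻ t in Set.Ioi (r ^ 2), ENNReal.ofReal (r ^ 2 * t ^ (-(3 / 2) : ℝ)) =
      ENNReal.ofReal (2 * r) := by
    have hi : IntegrableOn (fun t : ℝ => t ^ (-(3 / 2) : ℝ)) (Set.Ioi (r ^ 2)) :=
      integrableOn_Ioi_rpow_of_lt (by norm_num) hs0
    rw [← ofReal_integral_eq_lintegral_ofReal (hi.const_mul _), integral_const_mul,
      integral_Ioi_rpow_of_lt (by norm_num) hs0]
    · congr 1
      norm_num
      rw [Real.rpow_neg hs0.le, ← Real.sqrt_eq_rpow, Real.sqrt_sq hr0.le]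
      field_simp
    · filter_upwards [ae_restrict_mem measurableSet_Ioi] with t ht
      have : 0 < t := hs0.trans ht
      positivity
  rw [← Set.Ioc_union_Ioi_eq_Ioi hs0.le]
  refine (lintegral_union_le _ _ _).trans ?_
  calc _ ≤ ENNReal.ofReal (2 * r) + ENNReal.ofReal (2 * r) := by
        refine add_le_add ?_ ?_
        · rw [← h1]
          refine lintegral_mono fun t => ?_
          exact (mul_le_mul' le_rfl (min_le_left _ _)).trans_eq (mul_one _)
        · rw [← h2]
          refine setLIntegral_mono' measurableSet_Ioi fun t ht => ?_
          have ht0 : 0 < t := hs0.trans ht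
          refine (mul_le_mul' le_rfl (min_le_right _ _)).trans_eq ?_
          rw [← ofReal_two_zpow, ← hr, ← ENNReal.ofReal_mul (by positivity),
            ← ENNReal.ofReal_mul (by positivity), ← ENNReal.ofReal_mul (by positivity)]
          congr 1
          rw [show (-(3 / 2) : ℝ) = -(1 / 2) + -1 by norm_num, Real.rpow_add ht0, Real.rpow_neg_one]
          ring
    _ = _ := by
        rw [ENNReal.ofReal_mul two_pos.le, hr, ofReal_two_zpow, ENNReal.ofReal_ofNat]
        ring

lemma setLIntegral_prod_fst_le (s : Set ℝ) (t : Set R3) {g : ℝ → ℝ≥0∞} (hg : Measurable g) :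
    ∫⁻ z in s ×ˢ t, g z.1 ≤ volume t * ∫⁻ x in s, g x := by
  rw [Measure.volume_eq_prod, ← Measure.prod_restrict]
  refine (lintegral_prod_le _).trans ?_
  simp only [lintegral_const, Measure.restrict_apply MeasurableSet.univ, Set.univ_inter]
  rw [lintegral_mul_const _ hg, mul_comm]

lemma volume_closedBall_R3 (x : R3) {R : ℝ} (hR : 0 ≤ R) :
    volume (Metric.closedBall x R) =
      ENNReal.ofReal (R ^ 3) * volume (Metric.closedBall (0 : R3) 1) := by
  rw [Measure.addHaar_closedBall' _ _ hR, finrank_euclideanSpace_fin]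

lemma besovNorm_two (φ : ℝ → ℝ) (u : 𝓢'(R3, ℂ)) : besovNorm φ 2 u =
    (∑' k : ℤ, ((2 : ℝ≥0∞) ^ (-k) * supNorm (isoBlock φ k u)) ^ 2) ^ (1 / 2 : ℝ) := by
  rw [besovNorm, if_neg (by simp)]
  simp

lemma besovNorm_two_sq (φ : ℝ → ℝ) (u : 𝓢'(R3, ℂ)) : besovNorm φ 2 u ^ 2 =
    ∑' k : ℤ, ((2 : ℝ≥0∞) ^ (-k) * supNorm (isoBlock φ k u)) ^ 2 := by
  rw [besovNorm_two, ← ENNReal.rpow_natCast, ← ENNReal.rpow_mul]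
  norm_num

lemma besovNorm_top_le_two (φ : ℝ → ℝ) (u : 𝓢'(R3, ℂ)) : besovNorm φ ∞ u ≤ besovNorm φ 2 u := by
  rw [besovNorm, if_pos rfl]
  refine iSup_le fun k => ?_
  rw [← ENNReal.pow_le_pow_left_iff two_ne_zero, besovNorm_two_sq]
  exact ENNReal.le_tsum k

/-- `Ḃ^{-1}_{∞,2} ⊂ BMO^{-1}`. -/
lemma besov_two_embedsIn_bmoInv {φ : ℝ → ℝ} (hφ : IsDyadicCutoff φ) :
    (besov φ 2).EmbedsIn (bmoInv φ) := by
  -- A bound of `|e^{tΔ} u|²`, uniform in the space variable, whose integral over all times is at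
  -- most a multiple of `‖u‖²`; the volume of the ball is compensated by the factor `R^{-3/2}`.
  obtain ⟨C, hC⟩ := exists_enorm_heatFlow_le hφ
  set v := volume (Metric.closedBall (0 : R3) 1) with hv
  have hvtop : v ≠ ∞ := measure_closedBall_lt_top.ne
  set D := (v * (C ^ 2 * 32)) ^ (1 / 2 : ℝ) with hD
  have hDtop : D ≠ ∞ := by
    refine ENNReal.rpow_ne_top_of_nonneg (by norm_num) (ENNReal.mul_ne_top hvtop ?_)
    finiteness
  have hcar : ∀ u ∈ (besov φ 2).carrier, carlesonNorm u ≤ D * besovNorm φ 2 u := by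
    intro u hu
    refine iSup_le fun x => iSup₂_le fun R hR => ?_
    set A : ℤ → ℝ≥0∞ := fun k => supNorm (isoBlock φ k u) with hA
    set g : ℝ → ℝ≥0∞ := fun t => C ^ 2 * ((8 * ENNReal.ofReal (t ^ (-(1 / 2) : ℝ))) *
      ∑' k : ℤ, heatWeight k t * (2 ^ (-k) * A k ^ 2)) with hg
    have hgm : Measurable g := by
      have := measurable_heatWeight
      have h2 : Measurable fun t => ∑' k : ℤ, heatWeight k t * (2 ^ (-k) * A k ^ 2) :=
        Measurable.tsum fun k => (this k).mul_const _
      fun_prop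
    have hle : ∀ t : ℝ, 0 ≤ t → ∀ y, ‖heatFlow u t y‖ₑ ^ 2 ≤ g t := by
      intro t ht y
      rcases ht.eq_or_lt with rfl | ht
      · simp [heatFlow]
      calc ‖heatFlow u t y‖ₑ ^ 2 ≤ (C * ∑' k : ℤ, heatWeight k t * A k) ^ 2 := by
            gcongr
            exact hC u hu.1 t ht y
        _ ≤ C ^ 2 * ((∑' k : ℤ, 2 ^ k * heatWeight k t) *
            ∑' k : ℤ, heatWeight k t * (2 ^ (-k) * A k ^ 2)) := by
            rw [mul_pow]
            gcongr
            exact tsum_weight_mul_sq_le _ _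
        _ ≤ g t := by
            rw [hg]
            dsimp only
            gcongr
            exact tsum_two_zpow_mul_heatWeight_le ht
    have hint : ∫⁻ t in Set.Icc 0 (R ^ 2), g t ≤ C ^ 2 * 32 * besovNorm φ 2 u ^ 2 := by
      rw [← setLIntegral_congr Ioc_ae_eq_Icc]
      calc ∫⁻ t in Set.Ioc 0 (R ^ 2), g t ≤ ∫⁻ t in Set.Ioi 0, g t :=
            lintegral_mono_set Set.Ioc_subset_Ioi_self
        _ = C ^ 2 * (8 * ∑' k : ℤ, (∫⁻ t in Set.Ioi (0 : ℝ),
              ENNReal.ofReal (t ^ (-(1 / 2) : ℝ)) * heatWeight k t) * (2 ^ (-k) * A k ^ 2)) := by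
            have h3 : ∀ t, g t = C ^ 2 * (8 * ∑' k : ℤ,
                (ENNReal.ofReal (t ^ (-(1 / 2) : ℝ)) * heatWeight k t) * (2 ^ (-k) * A k ^ 2)) := by
              intro t
              simp only [hg, mul_assoc, ENNReal.tsum_mul_left]
            have hm : ∀ k : ℤ, Measurable fun t : ℝ =>
                ENNReal.ofReal (t ^ (-(1 / 2) : ℝ)) * heatWeight k t := by
              intro k
              have := measurable_heatWeight k
              fun_prop
            simp only [h3]
            rw [lintegral_const_mul' _ _ (by finiteness), lintegral_const_mul' _ _ (by finiteness),
              lintegral_tsum fun k => ((hm k).mul_const _).aemeasurable]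
            simp only [lintegral_mul_const _ (hm _)]
        _ ≤ C ^ 2 * (8 * ∑' k : ℤ, (4 * 2 ^ (-k)) * (2 ^ (-k) * A k ^ 2)) := by
            gcongr C ^ 2 * (8 * ?_)
            exact ENNReal.tsum_le_tsum fun k => mul_le_mul' (lintegral_heatWeight_le k) le_rfl
        _ = _ := by
            rw [besovNorm_two_sq, mul_assoc (C ^ 2 : ℝ≥0∞), ← ENNReal.tsum_mul_left,
              ← ENNReal.tsum_mul_left, ← ENNReal.tsum_mul_left, ← ENNReal.tsum_mul_left]
            refine tsum_congr fun k => ?_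
            ring
    have h4 : ∫⁻ z in Set.Icc (0 : ℝ) (R ^ 2) ×ˢ Metric.closedBall x R, ‖heatFlow u z.1 z.2‖ₑ ^ 2 ≤
        ENNReal.ofReal (R ^ 3) * (v * (C ^ 2 * 32) * besovNorm φ 2 u ^ 2) := by
      calc _ ≤ ∫⁻ z in Set.Icc (0 : ℝ) (R ^ 2) ×ˢ Metric.closedBall x R, g z.1 :=
            setLIntegral_mono' (measurableSet_Icc.prod Metric.isClosed_closedBall.measurableSet)
              fun z hz => hle _ hz.1.1 _
        _ ≤ volume (Metric.closedBall x R) * ∫⁻ t in Set.Icc 0 (R ^ 2), g t :=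
            setLIntegral_prod_fst_le _ _ hgm
        _ ≤ (ENNReal.ofReal (R ^ 3) * v) * (C ^ 2 * 32 * besovNorm φ 2 u ^ 2) := by
            rw [volume_closedBall_R3 x hR.le]
            gcongr
        _ = _ := by ring
    calc _ ≤ ENNReal.ofReal (R ^ (-(3 / 2) : ℝ)) *
          (ENNReal.ofReal (R ^ 3) * (v * (C ^ 2 * 32) * besovNorm φ 2 u ^ 2)) ^ (1 / 2 : ℝ) := by
          gcongr
      _ = D * besovNorm φ 2 u := by
          rw [ENNReal.mul_rpow_of_nonneg _ _ (by norm_num), ENNReal.mul_rpow_of_nonneg _ _ (by norm_num),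
            ENNReal.ofReal_rpow_of_nonneg (by positivity) (by norm_num), ← mul_assoc,
            ← ENNReal.ofReal_mul (by positivity), ← hD, ← ENNReal.rpow_natCast (besovNorm φ 2 u),
            ← ENNReal.rpow_mul, ← Real.rpow_natCast R, ← Real.rpow_mul hR.le, ← Real.rpow_add hR]
          norm_num
  have key : ∀ u ∈ (besov φ 2).carrier,
      (bmoInv φ).nrm u ≤ (1 + D.toNNReal : ℝ≥0) * (besov φ 2).nrm u := by
    intro u hu
    push_cast
    rw [ENNReal.coe_toNNReal hDtop, add_mul, one_mul]
    exact add_le_add (besovNorm_top_le_two φ u) (hcar u hu)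
  exact ⟨fun u hu => (key u hu).trans_lt (ENNReal.mul_lt_top ENNReal.coe_lt_top hu.2), _, key⟩

/-! ### From the Carleson norm to the heat flow -/

lemma heatKernel_apply {t : ℝ} (ht : 0 < t) (x : R3) : heatKernel t ht x =
    Real.exp (-(1 / (4 * t)) * ‖x‖ ^ 2) • (((4 * Real.pi * t) ^ (-(3 / 2) : ℝ) : ℝ) : ℂ) := rfl

/-- The semigroup property of the heat flow of a tempered distribution. -/
lemma heatFlow_semigroup (u : 𝓢'(R3, ℂ)) {s t : ℝ} (hs : 0 < s) (hst : s < t) (x : R3) :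
    heatFlow u t x = ∫ y, heatKernel (t - s) (sub_pos.2 hst) (y - x) * heatFlow u s y := by
  have ht := hs.trans hst
  have h1 : (heatKernel t ht).compSubConstCLM ℂ x = SchwartzMap.fourierMultiplierCLM ℂ
      (gaussSym s hs) ((heatKernel (t - s) (sub_pos.2 hst)).compSubConstCLM ℂ x) := by
    rw [fourierMultiplier_translate, ← fourierInv_gaussSym (t - s),
      fourierMultiplier_fourierInv _ _ (gaussSym t ht), fourierInv_gaussSym]
    intro ξ
    rw [gaussSym_apply, gaussSym_apply, gaussSym_apply, ← Complex.ofReal_mul, ← Real.exp_add]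
    congr 2
    ring
  rw [heatFlow_eq ht, h1, fourierMultiplier_apply_eq_integral]
  simp only [fourierInv_gaussSym, ← heatFlow_eq hs, SchwartzMap.compSubConstCLM_apply]

lemma continuous_heatFlow (u : 𝓢'(R3, ℂ)) (t : ℝ) : Continuous (heatFlow u t) := by
  by_cases ht : 0 < t
  · have h : heatFlow u t = fun y => u ((heatKernel t ht).compSubConstCLM ℂ y) :=
      funext fun y => heatFlow_eq ht u y
    rw [h]
    exact continuous_apply_translate u _
  · have h : heatFlow u t = fun _ => 0 := funext fun y => by rw [heatFlow, dif_neg ht]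
    rw [h]
    exact continuous_const

/-- Joint measurability of the heat flow: by the semigroup property it is, for `t > 1 / (n + 1)`, a
parameter integral of the heat flow at the fixed time `1 / (n + 1)`. -/
lemma measurable_heatFlow (u : 𝓢'(R3, ℂ)) :
    Measurable fun z : ℝ × R3 => heatFlow u z.1 z.2 := by
  set κ : ℝ → R3 → ℂ := fun τ x =>
    Real.exp (-(1 / (4 * τ)) * ‖x‖ ^ 2) • (((4 * Real.pi * τ) ^ (-(3 / 2) : ℝ) : ℝ) : ℂ) with hκ
  set F : ℕ → ℝ × R3 → ℂ := fun n => Set.indicator {z : ℝ × R3 | 1 / ((n : ℝ) + 1) < z.1}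
    fun z => ∫ y, κ (z.1 - 1 / ((n : ℝ) + 1)) (y - z.2) * heatFlow u (1 / ((n : ℝ) + 1)) y with hF
  have hpos : ∀ n : ℕ, 0 < 1 / ((n : ℝ) + 1) := fun n => Nat.one_div_pos_of_nat
  have hFm : ∀ n, Measurable (F n) := by
    intro n
    refine Measurable.indicator ?_ (measurableSet_lt measurable_const measurable_fst)
    have h1 : Measurable fun q : (ℝ × R3) × R3 =>
        κ (q.1.1 - 1 / ((n : ℝ) + 1)) (q.2 - q.1.2) * heatFlow u (1 / ((n : ℝ) + 1)) q.2 := by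
      have h2 := (continuous_heatFlow u (1 / ((n : ℝ) + 1))).measurable
      have h3 : Measurable fun q : (ℝ × R3) × R3 => heatFlow u (1 / ((n : ℝ) + 1)) q.2 :=
        h2.comp measurable_snd
      refine Measurable.mul ?_ h3
      simp only [hκ, Complex.real_smul]
      fun_prop
    exact h1.stronglyMeasurable.integral_prod_right'.measurable
  refine measurable_of_tendsto_metrizable hFm (tendsto_pi_nhds.2 fun z => ?_)
  by_cases hz : 0 < z.1
  · have h1 : ∀ᶠ n : ℕ in atTop, 1 / ((n : ℝ) + 1) < z.1 :=
      tendsto_one_div_add_atTop_nhds_zero_nat.eventually (gt_mem_nhds hz)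
    refine tendsto_const_nhds.congr' ?_
    filter_upwards [h1] with n hn
    rw [hF]
    simp only
    rw [Set.indicator_of_mem (by exact hn), heatFlow_semigroup u (hpos n) hn]
    rfl
  · have h1 : ∀ n, F n z = 0 := by
      intro n
      refine Set.indicator_of_notMem ?_ _
      intro hn
      exact hz ((hpos n).trans hn)
    simp only [h1, heatFlow, dif_neg hz]
    exact tendsto_const_nhds

/-- A Gaussian is dominated by a sum of indicator functions of balls. -/
lemma exp_neg_sq_le_tsum_indicator {t : ℝ} (ht : 0 < t) (x y : R3) :
    ENNReal.ofReal (Real.exp (-(1 / (4 * t)) * ‖y - x‖ ^ 2)) ≤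
      ∑' m : ℕ, ENNReal.ofReal (Real.exp (-((m : ℝ) ^ 2 / 4))) *
        (Metric.closedBall x ((m + 1) * √t)).indicator 1 y := by
  set m := ⌊‖y - x‖ / √t⌋₊ with hm
  have hst : 0 < √t := Real.sqrt_pos.2 ht
  have h1 : (m : ℝ) * √t ≤ ‖y - x‖ := by
    rw [← le_div_iff₀ hst]
    exact Nat.floor_le (by positivity)
  have h2 : ‖y - x‖ ≤ (m + 1) * √t := by
    rw [← div_le_iff₀ hst]
    exact (Nat.lt_floor_add_one _).le
  refine le_trans ?_ (ENNReal.le_tsum m)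
  rw [Set.indicator_of_mem (by rwa [mem_closedBall_iff_norm]), Pi.one_apply, mul_one]
  refine ENNReal.ofReal_le_ofReal (Real.exp_le_exp.2 ?_)
  have h3 : ((m : ℝ) * √t) ^ 2 ≤ ‖y - x‖ ^ 2 := by gcongr
  rw [mul_pow, Real.sq_sqrt ht.le] at h3
  rw [neg_mul, neg_le_neg_iff, div_mul_eq_mul_div, one_mul, le_div_iff₀ (by positivity)]
  linarith

lemma summable_cube_mul_exp : Summable fun m : ℕ => ((m : ℝ) + 1) ^ 3 * Real.exp (-((m : ℝ) ^ 2 / 4)) := by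
  have h1 := (summable_nat_add_iff 1).2
    (Real.summable_pow_mul_exp_neg_nat_mul 3 (show (0 : ℝ) < 1 / 4 by norm_num))
  refine Summable.of_nonneg_of_le (fun m => by positivity) (fun m => ?_)
    (h1.mul_left (Real.exp (1 / 4)))
  have h2 : (m : ℝ) ≤ (m : ℝ) ^ 2 := by exact_mod_cast Nat.le_self_pow two_ne_zero m
  calc ((m : ℝ) + 1) ^ 3 * Real.exp (-((m : ℝ) ^ 2 / 4))
      ≤ ((m : ℝ) + 1) ^ 3 * Real.exp (1 / 4 + -(1 / 4) * ((m + 1 : ℕ) : ℝ)) := by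
        gcongr
        push_cast
        linarith
    _ = _ := by
        rw [Real.exp_add]
        push_cast
        ring

/-- The `L¹` norm of the heat flow on a parabolic cylinder, by the Cauchy-Schwarz inequality. -/
lemma lintegral_heatFlow_le (u : 𝓢'(R3, ℂ)) (x : R3) {R s : ℝ} (hR : 0 < R) (hs : s ≤ R ^ 2) :
    ∫⁻ z in Set.Ioc (0 : ℝ) s ×ˢ Metric.closedBall x R, ‖heatFlow u z.1 z.2‖ₑ ≤
      ENNReal.ofReal (R ^ 3) * (ENNReal.ofReal s * volume (Metric.closedBall (0 : R3) 1)) ^ (1 / 2 : ℝ) *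
        carlesonNorm u := by
  set S := Set.Ioc (0 : ℝ) s ×ˢ Metric.closedBall x R with hS
  set v := volume (Metric.closedBall (0 : R3) 1) with hv
  have h1 := ENNReal.lintegral_mul_le_Lp_mul_Lq ((volume : Measure (ℝ × R3)).restrict S)
    Real.HolderConjugate.two_two (measurable_heatFlow u).enorm.aemeasurable
    (aemeasurable_const (b := (1 : ℝ≥0∞)))
  simp only [Pi.mul_apply, mul_one, ENNReal.rpow_two, one_pow, lintegral_one,
    Measure.restrict_apply_univ] at h1
  refine h1.trans ?_
  have h2 : volume S = ENNReal.ofReal (R ^ 3) * (ENNReal.ofReal s * v) := by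
    rw [hS, Measure.volume_eq_prod, Measure.prod_prod, volume_closedBall_R3 x hR.le, Real.volume_Ioc,
      sub_zero]
    ring
  have h3 : (∫⁻ z in S, ‖heatFlow u z.1 z.2‖ₑ ^ 2) ^ (1 / 2 : ℝ) ≤
      ENNReal.ofReal (R ^ (3 / 2 : ℝ)) * carlesonNorm u := by
    have h4 : ENNReal.ofReal (R ^ (-(3 / 2) : ℝ)) *
        (∫⁻ z in Set.Icc (0 : ℝ) (R ^ 2) ×ˢ Metric.closedBall x R,
          ‖heatFlow u z.1 z.2‖ₑ ^ 2) ^ (1 / 2 : ℝ) ≤ carlesonNorm u :=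
      le_iSup_of_le x (le_iSup₂_of_le R hR le_rfl)
    calc _ ≤ (∫⁻ z in Set.Icc (0 : ℝ) (R ^ 2) ×ˢ Metric.closedBall x R,
          ‖heatFlow u z.1 z.2‖ₑ ^ 2) ^ (1 / 2 : ℝ) := by
          gcongr
          exact Set.prod_mono ((Set.Ioc_subset_Icc_self).trans (Set.Icc_subset_Icc_right hs)) le_rfl
      _ = ENNReal.ofReal (R ^ (3 / 2 : ℝ)) * (ENNReal.ofReal (R ^ (-(3 / 2) : ℝ)) *
          (∫⁻ z in Set.Icc (0 : ℝ) (R ^ 2) ×ˢ Metric.closedBall x R,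
            ‖heatFlow u z.1 z.2‖ₑ ^ 2) ^ (1 / 2 : ℝ)) := by
          rw [← mul_assoc, ← ENNReal.ofReal_mul (by positivity), ← Real.rpow_add hR]
          norm_num
      _ ≤ _ := by gcongr
  rw [h2, ENNReal.mul_rpow_of_nonneg _ _ (by norm_num),
    ENNReal.ofReal_rpow_of_nonneg (by positivity) (by norm_num)]
  refine (mul_le_mul' h3 le_rfl).trans_eq ?_
  have h5 : ENNReal.ofReal (R ^ 3) =
      ENNReal.ofReal (R ^ (3 / 2 : ℝ)) * ENNReal.ofReal ((R ^ 3) ^ (1 / 2 : ℝ)) := by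
    rw [← ENNReal.ofReal_mul (by positivity), ← Real.rpow_natCast, ← Real.rpow_mul hR.le,
      ← Real.rpow_add hR]
    norm_num
  rw [h5]
  ring

lemma enorm_heatKernel_sub_le {s t : ℝ} (hs : 0 < s) (hst : s ≤ t / 2) (h : 0 < t - s) (z : R3) :
    ‖heatKernel (t - s) h z‖ₑ ≤ ENNReal.ofReal ((2 * Real.pi * t) ^ (-(3 / 2) : ℝ)) *
      ENNReal.ofReal (Real.exp (-(1 / (4 * t)) * ‖z‖ ^ 2)) := by
  have ht : 0 < t := by linarith
  rw [heatKernel_apply, enorm_smul, Real.enorm_of_nonneg (Real.exp_nonneg _), ← ofReal_norm,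
    Complex.norm_real, Real.norm_of_nonneg (by positivity), mul_comm]
  gcongr ENNReal.ofReal ?_ * ENNReal.ofReal ?_
  · refine Real.rpow_le_rpow_of_nonpos (by positivity) ?_ (by norm_num)
    nlinarith [Real.pi_pos]
  · gcongr
    linarith

/-- `BMO^{-1} ⊂ C^{-1}`: the value of the heat flow at time `t` is an average of its values at the
times `s ≤ t / 2`. -/
lemma exists_holderInvNorm_le_carlesonNorm :
    ∃ C : ℝ≥0, ∀ u : 𝓢'(R3, ℂ), holderInvNorm u ≤ C * carlesonNorm u := by
  set v := volume (Metric.closedBall (0 : R3) 1) with hv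
  have hvtop : v ≠ ∞ := measure_closedBall_lt_top.ne
  set σ : ℝ≥0∞ := ∑' m : ℕ, ENNReal.ofReal (((m : ℝ) + 1) ^ 3 * Real.exp (-((m : ℝ) ^ 2 / 4))) with hσ
  have hσtop : σ ≠ ∞ := summable_cube_mul_exp.tsum_ofReal_ne_top
  set D : ℝ≥0∞ := ENNReal.ofReal ((2 * Real.pi) ^ (-(3 / 2) : ℝ) * 2 ^ (1 / 2 : ℝ)) *
    v ^ (1 / 2 : ℝ) * σ with hD
  have hDtop : D ≠ ∞ := by
    have : v ^ (1 / 2 : ℝ) ≠ ∞ := ENNReal.rpow_ne_top_of_nonneg (by norm_num) hvtop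
    finiteness
  refine ⟨D.toNNReal, fun u => ?_⟩
  rw [ENNReal.coe_toNNReal hDtop]
  refine holderInvNorm_le_of_enorm_le fun t ht x => ?_
  set c := carlesonNorm u with hc
  set a : ℝ := (2 * Real.pi * t) ^ (-(3 / 2) : ℝ) with ha
  set κ : ℕ → ℝ≥0∞ := fun m => ENNReal.ofReal (Real.exp (-((m : ℝ) ^ 2 / 4))) with hκ
  set B : ℕ → Set R3 := fun m => Metric.closedBall x ((m + 1) * √t) with hB
  have hBm : ∀ m, MeasurableSet (B m) := fun m => Metric.isClosed_closedBall.measurableSet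
  have hFm := (measurable_heatFlow u).enorm
  have hst : 0 < √t := Real.sqrt_pos.2 ht
  -- The semigroup property from time `s`, with the kernel at time `t - s ≥ t / 2` cut into annuli.
  have h1 : ∀ s ∈ Set.Ioc 0 (t / 2), ‖heatFlow u t x‖ₑ ≤
      ENNReal.ofReal a * ∑' m, κ m * ∫⁻ y in B m, ‖heatFlow u s y‖ₑ := by
    intro s hs
    have hFs := (continuous_heatFlow u s).enorm.measurable
    rw [heatFlow_semigroup u hs.1 (show s < t by linarith [hs.2])]
    refine (enorm_integral_le_lintegral_enorm _).trans ?_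
    calc _ ≤ ∫⁻ y, ENNReal.ofReal a * ∑' m, κ m * (B m).indicator (fun y => ‖heatFlow u s y‖ₑ) y := by
          refine lintegral_mono fun y => ?_
          rw [enorm_mul]
          refine (mul_le_mul' (enorm_heatKernel_sub_le hs.1 hs.2 _ _) le_rfl).trans ?_
          rw [mul_assoc]
          gcongr
          refine (mul_le_mul' (exp_neg_sq_le_tsum_indicator ht x y) le_rfl).trans_eq ?_
          rw [← ENNReal.tsum_mul_right]
          refine tsum_congr fun m => ?_
          rw [mul_assoc]
          congr 1
          by_cases hy : y ∈ B m
          · rw [Set.indicator_of_mem hy, Set.indicator_of_mem hy, Pi.one_apply, one_mul]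
          · rw [Set.indicator_of_notMem hy, Set.indicator_of_notMem hy, zero_mul]
      _ = _ := by
          have hm : ∀ m, Measurable fun y => (B m).indicator (fun y => ‖heatFlow u s y‖ₑ) y :=
            fun m => hFs.indicator (hBm m)
          rw [lintegral_const_mul' _ _ ENNReal.ofReal_ne_top,
            lintegral_tsum fun m => ((hm m).const_mul _).aemeasurable]
          congr 1
          refine tsum_congr fun m => ?_
          rw [lintegral_const_mul _ (hm m), lintegral_indicator (hBm m)]
  -- Average over the times `s ∈ (0, t / 2]`.
  have h2 : ENNReal.ofReal (t / 2) * ‖heatFlow u t x‖ₑ ≤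
      ENNReal.ofReal a * ∑' m, κ m * ∫⁻ z in Set.Ioc (0 : ℝ) (t / 2) ×ˢ B m, ‖heatFlow u z.1 z.2‖ₑ := by
    calc _ = ∫⁻ s in Set.Ioc 0 (t / 2), ‖heatFlow u t x‖ₑ := by
          rw [setLIntegral_const, Real.volume_Ioc, sub_zero, mul_comm]
      _ ≤ ∫⁻ s in Set.Ioc 0 (t / 2), ENNReal.ofReal a * ∑' m, κ m * ∫⁻ y in B m, ‖heatFlow u s y‖ₑ :=
          setLIntegral_mono' measurableSet_Ioc h1
      _ = _ := by
          have hm : ∀ m, Measurable fun s => ∫⁻ y in B m, ‖heatFlow u s y‖ₑ :=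
            fun m => hFm.lintegral_prod_right'
          rw [lintegral_const_mul' _ _ ENNReal.ofReal_ne_top,
            lintegral_tsum fun m => ((hm m).const_mul _).aemeasurable]
          congr 1
          refine tsum_congr fun m => ?_
          rw [lintegral_const_mul _ (hm m), Measure.volume_eq_prod, ← Measure.prod_restrict,
            lintegral_prod _ hFm.aemeasurable]
  have h3 : ∀ m : ℕ, κ m * ∫⁻ z in Set.Ioc (0 : ℝ) (t / 2) ×ˢ B m, ‖heatFlow u z.1 z.2‖ₑ ≤
      ENNReal.ofReal (((m : ℝ) + 1) ^ 3 * Real.exp (-((m : ℝ) ^ 2 / 4))) *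
        (ENNReal.ofReal (√t ^ 3) * (ENNReal.ofReal (t / 2) * v) ^ (1 / 2 : ℝ) * c) := by
    intro m
    have hm : t / 2 ≤ (((m : ℝ) + 1) * √t) ^ 2 := by
      rw [mul_pow, Real.sq_sqrt ht.le]
      nlinarith [sq_nonneg (m : ℝ), (Nat.cast_nonneg m : (0 : ℝ) ≤ m)]
    refine (mul_le_mul' le_rfl (lintegral_heatFlow_le u x (by positivity) hm)).trans_eq ?_
    rw [mul_pow, ENNReal.ofReal_mul (by positivity), ENNReal.ofReal_mul (by positivity)]
    ring
  have h4 : ENNReal.ofReal (t / 2) * ‖heatFlow u t x‖ₑ ≤ ENNReal.ofReal a * (σ *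
      (ENNReal.ofReal (√t ^ 3) * (ENNReal.ofReal (t / 2) * v) ^ (1 / 2 : ℝ) * c)) := by
    refine h2.trans (mul_le_mul' le_rfl ?_)
    rw [hσ, ← ENNReal.tsum_mul_right]
    exact ENNReal.tsum_le_tsum h3
  calc ‖heatFlow u t x‖ₑ = ENNReal.ofReal (2 / t) * (ENNReal.ofReal (t / 2) * ‖heatFlow u t x‖ₑ) := by
        rw [← mul_assoc, ← ENNReal.ofReal_mul (by positivity),
          show 2 / t * (t / 2) = 1 by field_simp, ENNReal.ofReal_one, one_mul]
    _ ≤ ENNReal.ofReal (2 / t) * (ENNReal.ofReal a * (σ *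
      (ENNReal.ofReal (√t ^ 3) * (ENNReal.ofReal (t / 2) * v) ^ (1 / 2 : ℝ) * c))) := by gcongr
    _ = (ENNReal.ofReal (2 / t) * ENNReal.ofReal a * ENNReal.ofReal (√t ^ 3) *
        ENNReal.ofReal ((t / 2) ^ (1 / 2 : ℝ))) * (v ^ (1 / 2 : ℝ) * σ * c) := by
        rw [ENNReal.mul_rpow_of_nonneg _ _ (by norm_num),
          ENNReal.ofReal_rpow_of_nonneg (by positivity) (by norm_num)]
        ring
    _ = (ENNReal.ofReal ((2 * Real.pi) ^ (-(3 / 2) : ℝ) * 2 ^ (1 / 2 : ℝ)) *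
        ENNReal.ofReal (t ^ (-(1 / 2) : ℝ))) * (v ^ (1 / 2 : ℝ) * σ * c) := by
        rw [← ENNReal.ofReal_mul (by positivity), ← ENNReal.ofReal_mul (by positivity),
          ← ENNReal.ofReal_mul (by positivity), ← ENNReal.ofReal_mul (by positivity)]
        congr 2
        have e1 : √t ^ 3 = t ^ (3 / 2 : ℝ) := by
          rw [Real.sqrt_eq_rpow, ← Real.rpow_natCast, ← Real.rpow_mul ht.le]
          norm_num
        have e2 : (t / 2) ^ (1 / 2 : ℝ) = t ^ (1 / 2 : ℝ) * (2 : ℝ) ^ (-(1 / 2) : ℝ) := by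
          rw [Real.div_rpow ht.le two_pos.le, Real.rpow_neg two_pos.le]
          rfl
        have e3 : a = (2 * Real.pi) ^ (-(3 / 2) : ℝ) * t ^ (-(3 / 2) : ℝ) :=
          Real.mul_rpow (by positivity) ht.le
        have e4 : t ^ (-(3 / 2) : ℝ) * t ^ (3 / 2 : ℝ) = 1 := by
          rw [← Real.rpow_add ht]; norm_num
        have e5 : 2 / t * t ^ (1 / 2 : ℝ) = 2 * t ^ (-(1 / 2) : ℝ) := by
          rw [show (-(1 / 2) : ℝ) = 1 / 2 - 1 by norm_num, Real.rpow_sub_one ht.ne']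
          ring
        have e6 : (2 : ℝ) * 2 ^ (-(1 / 2) : ℝ) = 2 ^ (1 / 2 : ℝ) := by
          nth_rewrite 1 [← Real.rpow_one 2]
          rw [← Real.rpow_add two_pos]; norm_num
        rw [e1, e2, e3]
        calc _ = (2 * Real.pi) ^ (-(3 / 2) : ℝ) * (t ^ (-(3 / 2) : ℝ) * t ^ (3 / 2 : ℝ)) *
              ((2 / t * t ^ (1 / 2 : ℝ)) * (2 : ℝ) ^ (-(1 / 2) : ℝ)) := by ring
          _ = _ := by rw [e4, e5, ← e6]; ring
    _ = _ := by rw [hD]; ring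

/-- `BMO^{-1} ⊂ Ḃ^{-1}_{∞,∞}`. -/
lemma bmoInv_embedsIn_besov_top {φ : ℝ → ℝ} (hφ : IsDyadicCutoff φ) :
    (bmoInv φ).EmbedsIn (besov φ ∞) := by
  obtain ⟨C, hC⟩ := exists_holderInvNorm_le_carlesonNorm
  refine ⟨fun u hu => ?_, 1, fun u _ => ?_⟩
  · have hu' : carlesonNorm u < ∞ := lt_of_le_of_lt le_add_self hu
    exact (holderInv_embedsIn_besov_top hφ).1
      ((hC u).trans_lt (ENNReal.mul_lt_top ENNReal.coe_lt_top hu'))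
  · rw [ENNReal.coe_one, one_mul]
    exact le_self_add

/-! ### Horizontal and vertical multipliers -/

/-- The horizontal frequency space. -/
abbrev R2 : Type := EuclideanSpace ℝ (Fin 2)

/-- The inclusion of the horizontal plane. -/
def horEmb : R2 →L[ℝ] R3 :=
  LinearMap.toContinuousLinearMap
    { toFun := fun v => !₂[v 0, v 1, 0]
      map_add' := fun x y => by ext i; fin_cases i <;> simp
      map_smul' := fun c x => by ext i; fin_cases i <;> simp }

/-- The inclusion of the vertical axis. -/
def verEmb : ℝ →L[ℝ] R3 :=
  LinearMap.toContinuousLinearMap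
    { toFun := fun z => !₂[0, 0, z]
      map_add' := fun x y => by ext i; fin_cases i <;> simp
      map_smul' := fun c x => by ext i; fin_cases i <;> simp }

/-- The vertical part `ξ₃` of `ξ`. -/
def vertical : R3 →L[ℝ] ℝ := EuclideanSpace.proj (2 : Fin 3)

lemma vertical_apply (ξ : R3) : vertical ξ = ξ 2 := rfl

lemma inner_horEmb (v : R2) (ξ : R3) : inner ℝ (horEmb v) ξ = inner ℝ v (horizontal ξ) := by
  simp [horEmb, horizontal, PiLp.inner_apply, Fin.sum_univ_succ]

lemma inner_verEmb (z : ℝ) (ξ : R3) : inner ℝ (verEmb z) ξ = inner ℝ z (vertical ξ) := by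
  simp [verEmb, vertical, PiLp.inner_apply, Fin.sum_univ_succ]

lemma sub_horEmb (x : R3) (v : R2) : x - horEmb v = !₂[x 0 - v 0, x 1 - v 1, x 2] := by
  ext i; fin_cases i <;> simp [horEmb]

lemma sub_verEmb (x : R3) (z : ℝ) : x - verEmb z = !₂[x 0, x 1, x 2 - z] := by
  ext i; fin_cases i <;> simp [verEmb]

/-- The multiplier `m(D_h)`. -/
def horMul (m : 𝓢(R2, ℂ)) : 𝓢(R3, ℂ) →L[ℂ] 𝓢(R3, ℂ) :=
  SchwartzMap.fourierMultiplierCLM ℂ fun ξ => m (horizontal ξ)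

/-- The multiplier `m(D_3)`. -/
def verMul (m : 𝓢(ℝ, ℂ)) : 𝓢(R3, ℂ) →L[ℂ] 𝓢(R3, ℂ) :=
  SchwartzMap.fourierMultiplierCLM ℂ fun ξ => m (vertical ξ)

lemma hasTemperateGrowth_comp_horizontal (m : 𝓢(R2, ℂ)) :
    (fun ξ : R3 => m (horizontal ξ)).HasTemperateGrowth :=
  m.hasTemperateGrowth.comp horizontal.hasTemperateGrowth

lemma hasTemperateGrowth_comp_vertical (m : 𝓢(ℝ, ℂ)) :
    (fun ξ : R3 => m (vertical ξ)).HasTemperateGrowth :=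
  m.hasTemperateGrowth.comp vertical.hasTemperateGrowth

lemma horBlock_eq {φ : ℝ → ℝ} (hφ : IsDyadicCutoff φ) (k : ℤ) :
    horBlock φ k = horMul (sym R2 hφ.isProfile k) := by
  rw [horBlock, horMul]
  congr 1
  funext ξ
  rw [sym_apply, horSymbol]

lemma verBlock_eq {φ : ℝ → ℝ} (hφ : IsDyadicCutoff φ) (l : ℤ) :
    verBlock φ l = verMul (sym ℝ hφ.isProfile l) := by
  rw [verBlock, verMul]
  congr 1
  funext ξ
  rw [sym_apply, verSymbol, vertical_apply, Real.norm_eq_abs]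

lemma fourierMultiplier_comm {g₁ g₂ : R3 → ℂ} (h₁ : g₁.HasTemperateGrowth)
    (h₂ : g₂.HasTemperateGrowth) (ψ : 𝓢(R3, ℂ)) :
    SchwartzMap.fourierMultiplierCLM ℂ g₁ (SchwartzMap.fourierMultiplierCLM ℂ g₂ ψ) =
      SchwartzMap.fourierMultiplierCLM ℂ g₂ (SchwartzMap.fourierMultiplierCLM ℂ g₁ ψ) := by
  rw [fourierMultiplier_fourierMultiplier h₁ h₂ (g := fun ξ => g₁ ξ * g₂ ξ) (fun _ => rfl),
    fourierMultiplier_fourierMultiplier h₂ h₁ (g := fun ξ => g₁ ξ * g₂ ξ) (fun _ => mul_comm _ _)]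

lemma horMul_verMul_comm (m₁ : 𝓢(R2, ℂ)) (m₂ : 𝓢(ℝ, ℂ)) (ψ : 𝓢(R3, ℂ)) :
    horMul m₁ (verMul m₂ ψ) = verMul m₂ (horMul m₁ ψ) :=
  fourierMultiplier_comm (hasTemperateGrowth_comp_horizontal _) (hasTemperateGrowth_comp_vertical _) ψ

/-- Blocks are reproduced by a multiplier of the same frequency size, which makes the Bernstein
inequalities below available for them. -/
lemma horMul_wide {φ : ℝ → ℝ} (hφ : IsDyadicCutoff φ) (k : ℤ) (ψ : 𝓢(R3, ℂ)) :
    horMul (sym R2 (isProfile_wideProfile hφ) k) (horBlock φ k ψ) = horBlock φ k ψ := by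
  rw [horBlock_eq hφ]
  refine fourierMultiplier_fourierMultiplier (hasTemperateGrowth_comp_horizontal _)
    (hasTemperateGrowth_comp_horizontal _) (fun ξ => ?_) ψ
  rw [sym_apply, sym_apply, ← Complex.ofReal_mul, wideProfile_mul hφ]

lemma verMul_wide {φ : ℝ → ℝ} (hφ : IsDyadicCutoff φ) (l : ℤ) (ψ : 𝓢(R3, ℂ)) :
    verMul (sym ℝ (isProfile_wideProfile hφ) l) (verBlock φ l ψ) = verBlock φ l ψ := by
  rw [verBlock_eq hφ]
  refine fourierMultiplier_fourierMultiplier (hasTemperateGrowth_comp_vertical _)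
    (hasTemperateGrowth_comp_vertical _) (fun ξ => ?_) ψ
  rw [sym_apply, sym_apply, ← Complex.ofReal_mul, wideProfile_mul hφ]

lemma horMul_wide_verMul_wide {φ : ℝ → ℝ} (hφ : IsDyadicCutoff φ) (k l : ℤ) (ψ : 𝓢(R3, ℂ)) :
    horMul (sym R2 (isProfile_wideProfile hφ) k) (verMul (sym ℝ (isProfile_wideProfile hφ) l)
      (horBlock φ k (verBlock φ l ψ))) = horBlock φ k (verBlock φ l ψ) := by
  have h : verMul (sym ℝ (isProfile_wideProfile hφ) l) (horBlock φ k (verBlock φ l ψ)) =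
      horBlock φ k (verBlock φ l ψ) := by
    rw [horBlock_eq hφ, ← horMul_verMul_comm, verMul_wide hφ]
  rw [h, horMul_wide hφ]

/-! ### Bernstein inequalities for the mixed norm -/

/-- The point of `ℝ³` with horizontal coordinates `y` and vertical coordinate `z`. -/
def pt (y : ℝ × ℝ) (z : ℝ) : R3 := !₂[y.1, y.2, z]

lemma continuous_pt : Continuous fun q : (ℝ × ℝ) × ℝ => pt q.1 q.2 := by
  unfold pt
  refine (PiLp.continuous_toLp 2 _).comp (continuous_pi fun i => ?_)
  fin_cases i
  · exact continuous_fst.fst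
  · exact continuous_fst.snd
  · exact continuous_snd

/-- The square of the `L²` norm on a vertical line. -/
def vertSq (f : R3 → ℂ) (y : ℝ × ℝ) : ℝ≥0∞ := ∫⁻ z, ‖f (pt y z)‖ₑ ^ 2

lemma measurable_vertSq {f : R3 → ℂ} (hf : Continuous f) : Measurable (vertSq f) := by
  have h : Measurable fun q : (ℝ × ℝ) × ℝ => ‖f (pt q.1 q.2)‖ₑ ^ 2 :=
    ((hf.comp continuous_pt).enorm.measurable).pow_const 2
  exact h.lintegral_prod_right'

lemma mixedNorm_eq (p : ℝ) (f : R3 → ℂ) :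
    mixedNorm p f = (∫⁻ y, vertSq f y ^ (p / 2)) ^ (1 / p) := rfl

lemma lintegral_R2_sub (f : ℝ × ℝ → ℝ≥0∞) (hf : Measurable f) (x : ℝ × ℝ) :
    ∫⁻ v : R2, f (x.1 - v 0, x.2 - v 1) = ∫⁻ y, f y := by
  have h1 : MeasurePreserving (fun v : R2 => (v 0, v 1)) volume volume :=
    (volume_preserving_finTwoArrow ℝ).comp
      (EuclideanSpace.volume_preserving_symm_measurableEquiv_toLp (Fin 2))
  have h2 := h1.lintegral_comp (hf.comp (measurable_const_sub x))
  rw [← lintegral_sub_left_eq_self f x]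
  exact h2

lemma lintegral_verEmb (f : R3 → ℂ) (x : R3) :
    ∫⁻ w, ‖f (x - verEmb w)‖ₑ ^ 2 = vertSq f (x 0, x 1) := by
  simp only [sub_verEmb]
  exact lintegral_sub_left_eq_self (fun z => ‖f (pt (x 0, x 1) z)‖ₑ ^ 2) (x 2)

lemma enorm_verMul_le (m : 𝓢(ℝ, ℂ)) (g : 𝓢(R3, ℂ)) (x : R3) :
    ‖verMul m g x‖ₑ ≤ (∫⁻ w, ‖𝓕⁻ m w‖ₑ ^ (2 : ℝ)) ^ (1 / 2 : ℝ) *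
      vertSq g (x 0, x 1) ^ (1 / 2 : ℝ) := by
  refine (enorm_fourierMultiplier_comp_le inner_verEmb m g x).trans ?_
  have hg : Continuous fun w => ‖g (x - verEmb w)‖ₑ :=
    (g.continuous.comp (continuous_const.sub verEmb.continuous)).enorm
  refine (ENNReal.lintegral_mul_le_Lp_mul_Lq volume Real.HolderConjugate.two_two
    (𝓕⁻ m).continuous.enorm.measurable.aemeasurable hg.measurable.aemeasurable).trans_eq ?_
  congr 2
  rw [← lintegral_verEmb]
  simp only [ENNReal.rpow_two]

/-- The Bernstein inequality `L^p_h(L²_v) → L^∞`. -/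
lemma enorm_le_mixedNorm {p : ℝ} (hp : 2 ≤ p) {m₁ : 𝓢(R2, ℂ)} {m₂ : 𝓢(ℝ, ℂ)} {g : 𝓢(R3, ℂ)}
    (hg : horMul m₁ (verMul m₂ g) = g) (x : R3) :
    ‖g x‖ₑ ≤ (∫⁻ v, ‖𝓕⁻ m₁ v‖ₑ ^ (p / (p - 1))) ^ (1 / (p / (p - 1))) *
      (∫⁻ w, ‖𝓕⁻ m₂ w‖ₑ ^ (2 : ℝ)) ^ (1 / 2 : ℝ) * mixedNorm p g := by
  have hpq : (p / (p - 1)).HolderConjugate p := by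
    have := Real.HolderConjugate.conjExponent (show 1 < p by linarith)
    exact this.symm
  set D := (∫⁻ w, ‖𝓕⁻ m₂ w‖ₑ ^ (2 : ℝ)) ^ (1 / 2 : ℝ) with hD
  set V : R2 → ℝ≥0∞ := fun v => vertSq g (x 0 - v 0, x 1 - v 1) ^ (1 / 2 : ℝ) with hV
  have hVm : Measurable V := by
    have := measurable_vertSq g.continuous
    refine (this.comp ?_).pow_const _
    fun_prop
  conv_lhs => rw [← hg]
  refine (enorm_fourierMultiplier_comp_le inner_horEmb m₁ _ x).trans ?_
  calc ∫⁻ v, ‖𝓕⁻ m₁ v‖ₑ * ‖verMul m₂ g (x - horEmb v)‖ₑ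
      ≤ ∫⁻ v, D * (‖𝓕⁻ m₁ v‖ₑ * V v) := by
        refine lintegral_mono fun v => ?_
        have h := enorm_verMul_le m₂ g (x - horEmb v)
        have h1 : ((x - horEmb v) 0, (x - horEmb v) 1) = (x 0 - v 0, x 1 - v 1) := by
          rw [sub_horEmb]; simp
        rw [h1] at h
        calc _ ≤ ‖𝓕⁻ m₁ v‖ₑ * (D * V v) := by gcongr
          _ = _ := by ring
    _ = D * ∫⁻ v, ‖𝓕⁻ m₁ v‖ₑ * V v :=
        lintegral_const_mul _ ((𝓕⁻ m₁).continuous.enorm.measurable.mul hVm)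
    _ ≤ D * ((∫⁻ v, ‖𝓕⁻ m₁ v‖ₑ ^ (p / (p - 1))) ^ (1 / (p / (p - 1))) *
          (∫⁻ v, V v ^ p) ^ (1 / p)) := by
        gcongr
        exact ENNReal.lintegral_mul_le_Lp_mul_Lq volume hpq
          (𝓕⁻ m₁).continuous.enorm.measurable.aemeasurable hVm.aemeasurable
    _ = _ := by
        have h2 : ∫⁻ v, V v ^ p = ∫⁻ y, vertSq g y ^ (p / 2) := by
          rw [← lintegral_R2_sub _ ((measurable_vertSq g.continuous).pow_const _) (x 0, x 1)]
          refine lintegral_congr fun v => ?_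
          rw [hV]
          simp only
          rw [← ENNReal.rpow_mul]
          congr 1
          ring
        rw [h2, mixedNorm_eq]
        ring

/-- The Bernstein inequality `L²_h(L²_v) → L^∞_h(L²_v)`. -/
lemma vertSq_le {m : 𝓢(R2, ℂ)} {g : 𝓢(R3, ℂ)} (hg : horMul m g = g) (y : ℝ × ℝ) :
    vertSq g y ≤ (∫⁻ v, ‖𝓕⁻ m v‖ₑ ^ (2 : ℝ)) * ∫⁻ y, vertSq g y := by
  set D := ∫⁻ v, ‖𝓕⁻ m v‖ₑ ^ (2 : ℝ) with hD
  have hgm : Measurable fun q : (ℝ × ℝ) × ℝ => ‖g (pt q.1 q.2)‖ₑ ^ 2 :=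
    ((g.continuous.comp continuous_pt).enorm.measurable).pow_const 2
  have h1 : ∀ z, ‖g (pt y z)‖ₑ ^ 2 ≤ D * ∫⁻ y', ‖g (pt y' z)‖ₑ ^ 2 := by
    intro z
    have h2 := enorm_fourierMultiplier_comp_le inner_horEmb m g (pt y z)
    have hc : Continuous fun v => ‖g (pt y z - horEmb v)‖ₑ :=
      (g.continuous.comp (continuous_const.sub horEmb.continuous)).enorm
    have h3 := h2.trans (ENNReal.lintegral_mul_le_Lp_mul_Lq volume Real.HolderConjugate.two_two
      (𝓕⁻ m).continuous.enorm.measurable.aemeasurable hc.measurable.aemeasurable)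
    have h4 : ∫⁻ v, ‖g (pt y z - horEmb v)‖ₑ ^ (2 : ℝ) = ∫⁻ y', ‖g (pt y' z)‖ₑ ^ 2 := by
      rw [← lintegral_R2_sub (fun y' => ‖g (pt y' z)‖ₑ ^ 2) (hgm.comp measurable_prodMk_right) y]
      refine lintegral_congr fun v => ?_
      rw [sub_horEmb, ENNReal.rpow_two]
      rfl
    rw [h4, ← hD] at h3
    have h5 : ‖g (pt y z)‖ₑ ≤ D ^ (1 / 2 : ℝ) * (∫⁻ y', ‖g (pt y' z)‖ₑ ^ 2) ^ (1 / 2 : ℝ) := by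
      conv_lhs => rw [← hg]
      exact h3
    calc ‖g (pt y z)‖ₑ ^ 2 ≤ (D ^ (1 / 2 : ℝ) * (∫⁻ y', ‖g (pt y' z)‖ₑ ^ 2) ^ (1 / 2 : ℝ)) ^ 2 := by
          gcongr
      _ = _ := by
          rw [mul_pow, ← ENNReal.rpow_natCast, ← ENNReal.rpow_natCast, ← ENNReal.rpow_mul,
            ← ENNReal.rpow_mul]
          norm_num
  calc vertSq g y ≤ ∫⁻ z, D * ∫⁻ y', ‖g (pt y' z)‖ₑ ^ 2 := lintegral_mono h1
    _ = D * ∫⁻ z, ∫⁻ y', ‖g (pt y' z)‖ₑ ^ 2 := lintegral_const_mul _ hgm.lintegral_prod_left'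
    _ = D * ∫⁻ y', vertSq g y' := by
        congr 1
        exact lintegral_lintegral_swap (f := fun z y' => ‖g (pt y' z)‖ₑ ^ 2)
          (hgm.comp measurable_swap).aemeasurable

/-- The Bernstein inequality `L²_h(L²_v) → L^p_h(L²_v)`. -/
lemma mixedNorm_le_two {p : ℝ} (hp : 2 ≤ p) {m : 𝓢(R2, ℂ)} {g : 𝓢(R3, ℂ)} (hg : horMul m g = g) :
    mixedNorm p g ≤ ((∫⁻ v, ‖𝓕⁻ m v‖ₑ ^ (2 : ℝ)) ^ (1 / 2 : ℝ)) ^ (1 - 2 / p) * mixedNorm 2 g := by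
  set D := ∫⁻ v, ‖𝓕⁻ m v‖ₑ ^ (2 : ℝ) with hD
  set N := ∫⁻ y, vertSq g y with hN
  have hp0 : 0 < p := by linarith
  have h1 : ∫⁻ y, vertSq g y ^ (p / 2) ≤ (D * N) ^ (p / 2 - 1) * N := by
    rw [hN, ← lintegral_const_mul _ (measurable_vertSq g.continuous)]
    refine lintegral_mono fun y => ?_
    have h2 : vertSq g y ^ (p / 2) = vertSq g y ^ (p / 2 - 1) * vertSq g y := by
      conv_rhs => rw [← ENNReal.rpow_one (vertSq g y), ← ENNReal.rpow_mul, one_mul]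
      rw [← ENNReal.rpow_add_of_nonneg _ _ (by linarith) zero_le_one]
      congr 1
      ring
    rw [h2]
    gcongr
    · linarith
    · exact vertSq_le hg y
  have h3 : mixedNorm 2 g = N ^ (1 / 2 : ℝ) := by
    rw [mixedNorm_eq, hN]
    norm_num
  rw [mixedNorm_eq, h3]
  calc _ ≤ ((D * N) ^ (p / 2 - 1) * N) ^ (1 / p) := by gcongr
    _ = _ := by
      have e1 : (p / 2 - 1) * (1 / p) = 1 / 2 * (1 - 2 / p) := by field_simp
      have e2 : 0 ≤ 1 / 2 * (1 - 2 / p) := by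
        rw [← e1]
        have : 0 ≤ p / 2 - 1 := by linarith
        positivity
      rw [ENNReal.mul_rpow_of_nonneg _ _ (by positivity), ← ENNReal.rpow_mul, e1,
        ENNReal.mul_rpow_of_nonneg _ _ e2, mul_assoc, ← ENNReal.rpow_add_of_nonneg _ _ e2 (by positivity),
        ← ENNReal.rpow_mul]
      congr 2
      field_simp
      ring

/-! ### Series of multipliers -/

lemma fourierMultiplier_apply_eq_integral_exp {g : R3 → ℂ} (hg : g.HasTemperateGrowth)
    (a : 𝓢(R3, ℂ)) (x : R3) : SchwartzMap.fourierMultiplierCLM ℂ g a x =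
      ∫ ξ, Real.fourierChar (inner ℝ ξ x) • (g ξ * 𝓕 a ξ) := by
  rw [SchwartzMap.fourierMultiplierCLM_apply, SchwartzMap.fourierInv_coe, Real.fourierInv_eq]
  refine integral_congr_ae (Eventually.of_forall fun ξ => ?_)
  simp only [SchwartzMap.smulLeftCLM_apply_apply hg, smul_eq_mul]

/-- A series of symbols that converges almost everywhere and is absolutely bounded gives a
pointwise convergent series of multipliers. An exceptional null set is allowed because the dyadic
series fail to converge to `1` on a line or a plane of frequencies. -/
lemma hasSum_fourierMultiplier {ι : Type*} [Countable ι] {f : ι → R3 → ℂ} {g : R3 → ℂ}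
    (hf : ∀ i, (f i).HasTemperateGrowth) (hg : g.HasTemperateGrowth) {B : ℝ≥0}
    (hB : ∀ᵐ ξ, ∑' i, ‖f i ξ‖ₑ ≤ B) (h : ∀ᵐ ξ, HasSum (fun i => f i ξ) (g ξ))
    (a : 𝓢(R3, ℂ)) (x : R3) :
    HasSum (fun i => SchwartzMap.fourierMultiplierCLM ℂ (f i) a x)
      (SchwartzMap.fourierMultiplierCLM ℂ g a x) := by
  set F : ι → R3 → ℂ := fun i ξ => Real.fourierChar (inner ℝ ξ x) • (f i ξ * 𝓕 a ξ) with hF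
  have hchar : Continuous fun ξ : R3 => Real.fourierChar (inner ℝ ξ x) := by fun_prop
  have hnorm : ∀ i ξ, ‖F i ξ‖ₑ = ‖f i ξ‖ₑ * ‖𝓕 a ξ‖ₑ := by
    intro i ξ
    rw [hF, ← ofReal_norm, Circle.norm_smul, ofReal_norm, enorm_mul]
  have hcont : ∀ i, Continuous (F i) := fun i =>
    hchar.smul ((hf i).1.continuous.mul (𝓕 a).continuous)
  have hint : ∀ i, Integrable (F i) := by
    intro i
    have h1 : Integrable (SchwartzMap.smulLeftCLM ℂ (f i) (𝓕 a)) := SchwartzMap.integrable _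
    refine h1.mono (hcont i).aestronglyMeasurable (Eventually.of_forall fun ξ => ?_)
    rw [SchwartzMap.smulLeftCLM_apply_apply (hf i), smul_eq_mul, hF, Circle.norm_smul]
  have hsum : Summable fun i => ∫ ξ, ‖F i ξ‖ := by
    have h1 : ∀ i, ∫ ξ, ‖F i ξ‖ = (∫⁻ ξ, ‖F i ξ‖ₑ).toReal := fun i =>
      integral_norm_eq_lintegral_enorm (hcont i).aestronglyMeasurable
    simp only [h1]
    refine ENNReal.summable_toReal ?_
    rw [← lintegral_tsum fun i => (hcont i).enorm.measurable.aemeasurable]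
    refine ne_top_of_le_ne_top (ENNReal.mul_ne_top (ENNReal.coe_ne_top (r := B))
      (lintegral_enorm_lt_top (𝓕 a)).ne) ?_
    rw [← lintegral_const_mul _ (𝓕 a).continuous.enorm.measurable]
    refine lintegral_mono_ae ?_
    filter_upwards [hB] with ξ hξ
    simp only [hnorm, ENNReal.tsum_mul_right]
    gcongr
  have h1 := hasSum_integral_of_summable_integral_norm hint hsum
  have h2 : ∫ ξ, ∑' i, F i ξ = SchwartzMap.fourierMultiplierCLM ℂ g a x := by
    rw [fourierMultiplier_apply_eq_integral_exp hg]
    refine integral_congr_ae ?_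
    filter_upwards [h] with ξ hξ
    exact ((hξ.mul_right _).const_smul _).tsum_eq
  rw [h2] at h1
  simpa only [fourierMultiplier_apply_eq_integral_exp (hf _)] using h1

lemma ae_ne_zero_of_exists_ne_zero {E : Type*} [NormedAddCommGroup E] [NormedSpace ℝ E]
    (L : R3 →L[ℝ] E) {ξ₀ : R3} (h : L ξ₀ ≠ 0) : ∀ᵐ ξ, L ξ ≠ 0 := by
  have h1 : (LinearMap.ker (L : R3 →ₗ[ℝ] E)) ≠ ⊤ := by
    intro h2
    have h3 : ξ₀ ∈ LinearMap.ker (L : R3 →ₗ[ℝ] E) := by rw [h2]; trivial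
    exact h (by simpa using h3)
  have h2 := Measure.addHaar_submodule (volume : Measure R3) _ h1
  rw [ae_iff]
  convert h2 using 2
  ext ξ
  simp

lemma ae_horizontal_ne_zero : ∀ᵐ ξ : R3, horizontal ξ ≠ 0 := by
  refine ae_ne_zero_of_exists_ne_zero horizontal (ξ₀ := !₂[1, 0, 0]) fun h => ?_
  simpa [horizontal] using congrArg (fun v : R2 => v 0) h

lemma ae_vertical_ne_zero : ∀ᵐ ξ : R3, vertical ξ ≠ 0 := by
  refine ae_ne_zero_of_exists_ne_zero vertical (ξ₀ := !₂[0, 0, 1]) ?_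
  simp [vertical]

lemma hasSum_ofReal {ι : Type*} {f : ι → ℝ} {a : ℝ} (h : HasSum f a) :
    HasSum (fun i => (f i : ℂ)) (a : ℂ) :=
  Complex.ofRealCLM.hasSum h

lemma enorm_sym {V : Type*} [NormedAddCommGroup V] [InnerProductSpace ℝ V]
    [FiniteDimensional ℝ V] [MeasurableSpace V] [BorelSpace V] {θ : ℝ → ℝ} (hθ : IsProfile θ) (k : ℤ) (v : V) :
    ‖sym V hθ k v‖ₑ = ‖θ ((2 : ℝ) ^ (-k) * (2 * Real.pi * ‖v‖))‖ₑ := by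
  rw [sym_apply, ← ofReal_norm, Complex.norm_real, ofReal_norm]

/-- The series which defines `S^h_k` is the multiplier with the low frequency profile. -/
lemma horLow_eq {φ : ℝ → ℝ} (hφ : IsDyadicCutoff φ) (k : ℤ) (a : 𝓢(R3, ℂ)) :
    horLow φ k a = horMul (sym R2 (isProfile_lowProfile hφ) k) a := by
  obtain ⟨B, hB⟩ := exists_tsum_cutoff_le hφ
  funext x
  have h := hasSum_fourierMultiplier
    (f := fun (k' : {k' : ℤ // k' ≤ k - 1}) ξ => sym R2 hφ.isProfile k' (horizontal ξ))
    (g := fun ξ => sym R2 (isProfile_lowProfile hφ) k (horizontal ξ)) (B := B)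
    (fun _ => hasTemperateGrowth_comp_horizontal _) (hasTemperateGrowth_comp_horizontal _) ?_ ?_ a x
  · rw [horLow, horMul, ← h.tsum_eq]
    refine tsum_congr fun k' => ?_
    rw [horBlock_eq hφ]
    rfl
  · filter_upwards [ae_horizontal_ne_zero] with ξ hξ
    have hpos : 0 < 2 * Real.pi * ‖horizontal ξ‖ := by
      have := norm_pos_iff.2 hξ
      positivity
    simp only [enorm_sym]
    exact (ENNReal.tsum_comp_le_tsum_of_injective Subtype.val_injective _).trans (hB _ hpos)
  · filter_upwards [ae_horizontal_ne_zero] with ξ hξ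
    have hpos : 0 < 2 * Real.pi * ‖horizontal ξ‖ := by
      have := norm_pos_iff.2 hξ
      positivity
    simp only [sym_apply]
    exact hasSum_ofReal (hasSum_lowProfile hφ hpos k)

/-! ### The embedding of `B^{0,1/2}` -/

lemma two_rpow_add (a b : ℝ) : (2 : ℝ≥0∞) ^ (a + b) = 2 ^ a * 2 ^ b :=
  ENNReal.rpow_add _ _ two_ne_zero ENNReal.ofNat_ne_top

lemma lintegral_rpow_enorm_ne_top {V : Type*} [NormedAddCommGroup V] [InnerProductSpace ℝ V]
    [FiniteDimensional ℝ V] [MeasurableSpace V] [BorelSpace V] (f : 𝓢(V, ℂ)) {q : ℝ} (hq : 0 < q) :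
    ∫⁻ x, ‖f x‖ₑ ^ q ≠ ∞ := by
  have h := lintegral_rpow_enorm_lt_top_of_eLpNorm_lt_top (p := ENNReal.ofReal q)
    (by simpa using hq) ENNReal.ofReal_ne_top (f.eLpNorm_lt_top (ENNReal.ofReal q))
  rw [ENNReal.toReal_ofReal hq.le] at h
  exact h.ne

/-- The `L^q` norms of the kernels of dyadic multipliers. -/
lemma lintegral_enorm_fourierInv_sym {V : Type*} [NormedAddCommGroup V] [InnerProductSpace ℝ V]
    [FiniteDimensional ℝ V] [MeasurableSpace V] [BorelSpace V] {θ : ℝ → ℝ} (hθ : IsProfile θ)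
    (k : ℤ) {q : ℝ} (hq : 0 < q) :
    (∫⁻ v, ‖𝓕⁻ (sym V hθ k) v‖ₑ ^ q) ^ (1 / q) =
      2 ^ ((k : ℝ) * (Module.finrank ℝ V * (1 - 1 / q))) *
        (∫⁻ v, ‖𝓕⁻ (radial V hθ) v‖ₑ ^ q) ^ (1 / q) := by
  rw [sym, lintegral_enorm_fourierInv_dilate _ _ hq.le, ENNReal.mul_rpow_of_nonneg _ _ (by positivity)]
  congr 1
  rw [← Real.rpow_intCast, ← Real.rpow_mul two_pos.le, ← ENNReal.ofReal_rpow_of_pos two_pos,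
    ENNReal.ofReal_ofNat, ← ENNReal.rpow_mul]
  congr 1
  push_cast
  field_simp
  ring

/-- `B^{0,1/2} ⊂ B^{-1+2/p,1/2}_p` on Schwartz functions. -/
lemma exists_anisoNorm_le_two {φ : ℝ → ℝ} (hφ : IsDyadicCutoff φ) {p : ℝ} (hp : 2 ≤ p) :
    ∃ C : ℝ≥0, ∀ a, anisoNorm φ p a ≤ C * anisoNorm φ 2 a := by
  have hp0 : 0 < p := by linarith
  have hp1 : 0 ≤ 1 - 2 / p := by
    rw [sub_nonneg, div_le_one hp0]; exact hp
  set c := (∫⁻ v, ‖𝓕⁻ (radial R2 (isProfile_wideProfile hφ)) v‖ₑ ^ (2 : ℝ)) ^ (1 / 2 : ℝ) with hc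
  have hctop : c ≠ ∞ := ENNReal.rpow_ne_top_of_nonneg (by norm_num)
    (lintegral_rpow_enorm_ne_top _ two_pos)
  set D := c ^ (1 - 2 / p) with hD
  have hDtop : D ≠ ∞ := ENNReal.rpow_ne_top_of_nonneg hp1 hctop
  refine ⟨1 + D.toNNReal, fun a => ?_⟩
  push_cast
  rw [ENNReal.coe_toNNReal hDtop, anisoNorm, anisoNorm, mul_add]
  have hone : (1 : ℝ≥0∞) ≤ 1 + D := le_self_add
  refine add_le_add ?_ (le_mul_of_one_le_left' hone)
  rw [← ENNReal.tsum_mul_left]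
  refine ENNReal.tsum_le_tsum fun l => ?_
  rw [mul_left_comm]
  gcongr 2 ^ ((l : ℝ) / 2) * ?_
  have hsq : ∀ s : ℝ≥0∞, (1 + D) * s ^ (1 / 2 : ℝ) = ((1 + D) ^ 2 * s) ^ (1 / 2 : ℝ) := by
    intro s
    rw [ENNReal.mul_rpow_of_nonneg _ _ (by norm_num), ← ENNReal.rpow_natCast, ← ENNReal.rpow_mul]
    norm_num
  rw [hsq, ← ENNReal.tsum_mul_left]
  refine ENNReal.rpow_le_rpow (ENNReal.tsum_le_tsum fun k => ?_) (by norm_num)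
  set g := horBlock φ k (verBlock φ l a) with hg
  have h1 : mixedNorm p g ≤ (2 ^ (((k : ℤ) : ℝ) * (1 - 2 / p)) * D) * mixedNorm 2 g := by
    refine (mixedNorm_le_two hp (horMul_wide hφ k (verBlock φ l a))).trans_eq ?_
    rw [lintegral_enorm_fourierInv_sym _ _ two_pos, finrank_euclideanSpace_fin,
      ENNReal.mul_rpow_of_nonneg _ _ hp1, ← ENNReal.rpow_mul]
    congr 4
    push_cast
    ring
  calc (2 : ℝ≥0∞) ^ ((-2 + 4 / p) * ((k : ℤ) : ℝ)) * mixedNorm p g ^ 2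
      ≤ 2 ^ ((-2 + 4 / p) * ((k : ℤ) : ℝ)) *
        ((2 ^ (((k : ℤ) : ℝ) * (1 - 2 / p)) * D) * mixedNorm 2 g) ^ 2 := by gcongr
    _ = (2 ^ ((-2 + 4 / p) * ((k : ℤ) : ℝ)) * (2 ^ (((k : ℤ) : ℝ) * (1 - 2 / p))) ^ 2) *
        (D ^ 2 * mixedNorm 2 g ^ 2) := by ring
    _ = 2 ^ ((-2 + 4 / (2 : ℝ)) * ((k : ℤ) : ℝ)) * (D ^ 2 * mixedNorm 2 g ^ 2) := by
        rw [← ENNReal.rpow_natCast (2 ^ (((k : ℤ) : ℝ) * (1 - 2 / p))), ← ENNReal.rpow_mul,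
          ← two_rpow_add]
        congr 2
        push_cast
        ring
    _ ≤ 2 ^ ((-2 + 4 / (2 : ℝ)) * ((k : ℤ) : ℝ)) * ((1 + D) ^ 2 * mixedNorm 2 g ^ 2) := by
        gcongr
        exact le_add_self
    _ = _ := by ring

/-- `B^{0,1/2} ⊂ B^{-1+2/p,1/2}_p`. -/
lemma anisoBesov_two_embedsIn {φ : ℝ → ℝ} (hφ : IsDyadicCutoff φ) {p : ℝ} (hp : 2 ≤ p) :
    (anisoBesov φ 2).EmbedsIn (anisoBesov φ p) := by
  obtain ⟨C, hC⟩ := exists_anisoNorm_le_two hφ hp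
  have hC' : ∀ a, anisoNorm φ p a ≤ ((C + 1 : ℝ≥0) : ℝ≥0∞) * anisoNorm φ 2 a := fun a =>
    (hC a).trans (by gcongr; exact le_self_add)
  have hCpos : ((C + 1 : ℝ≥0) : ℝ≥0∞) ≠ 0 := by simp
  have hcauchy : ∀ a, IsAnisoCauchy φ 2 a → IsAnisoCauchy φ p a := by
    intro a ha ε hε
    obtain ⟨N, hN⟩ := ha (ε / ((C + 1 : ℝ≥0) : ℝ≥0∞)) (ENNReal.div_pos hε.ne' ENNReal.coe_ne_top)
    refine ⟨N, fun m hm n hn => (hC' _).trans ?_⟩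
    calc _ ≤ ((C + 1 : ℝ≥0) : ℝ≥0∞) * (ε / ((C + 1 : ℝ≥0) : ℝ≥0∞)) := by
          gcongr
          exact hN m hm n hn
      _ = ε := ENNReal.mul_div_cancel hCpos ENNReal.coe_ne_top
  refine ⟨fun u hu => ?_, C + 1, fun u _ => ?_⟩
  · obtain ⟨a, ha, hau⟩ := hu
    exact ⟨a, hcauchy a ha, hau⟩
  · simp only [anisoBesov]
    rw [ENNReal.mul_iInf_of_ne hCpos ENNReal.coe_ne_top]
    refine le_iInf fun a => ?_
    rw [ENNReal.mul_iInf_of_ne hCpos ENNReal.coe_ne_top]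
    refine le_iInf fun ha => ?_
    refine (iInf₂_le a ⟨hcauchy a ha.1, ha.2⟩).trans ?_
    rw [← ENNReal.limsup_const_mul_of_ne_top ENNReal.coe_ne_top]
    exact limsup_le_limsup (Eventually.of_forall fun n => hC' (a n))

/-! ### Minkowski's inequality in `ℓ²` -/

/-- The `ℓ²` norm. -/
def l2 {ι : Type*} (f : ι → ℝ≥0∞) : ℝ≥0∞ := (∑' i, f i ^ 2) ^ (1 / 2 : ℝ)

lemma l2_sq {ι : Type*} (f : ι → ℝ≥0∞) : l2 f ^ 2 = ∑' i, f i ^ 2 := by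
  rw [l2, ← ENNReal.rpow_natCast, ← ENNReal.rpow_mul]
  norm_num

lemma l2_mono {ι : Type*} {f g : ι → ℝ≥0∞} (h : ∀ i, f i ≤ g i) : l2 f ≤ l2 g := by
  unfold l2
  gcongr with i
  exact h i

lemma l2_const_mul {ι : Type*} (c : ℝ≥0∞) (f : ι → ℝ≥0∞) : l2 (fun i => c * f i) = c * l2 f := by
  simp only [l2, mul_pow, ENNReal.tsum_mul_left]
  rw [ENNReal.mul_rpow_of_nonneg _ _ (by norm_num), ← ENNReal.rpow_natCast, ← ENNReal.rpow_mul]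
  norm_num

lemma l2_le_tsum {ι : Type*} (f : ι → ℝ≥0∞) : l2 f ≤ ∑' i, f i := by
  rw [← ENNReal.pow_le_pow_left_iff two_ne_zero, l2_sq, sq (∑' i, f i), ← ENNReal.tsum_mul_left]
  refine ENNReal.tsum_le_tsum fun i => ?_
  rw [sq]
  gcongr
  exact ENNReal.le_tsum i

lemma tsum_mul_le_l2 {ι : Type*} (f g : ι → ℝ≥0∞) : ∑' i, f i * g i ≤ l2 f * l2 g := by
  rw [← ENNReal.pow_le_pow_left_iff two_ne_zero, mul_pow, l2_sq, l2_sq]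
  exact tsum_mul_sq_le f g

/-- Minkowski's inequality, by expansion of the square. -/
lemma l2_tsum_le {ι κ : Type*} (F : κ → ι → ℝ≥0∞) :
    l2 (fun i => ∑' l, F l i) ≤ ∑' l, l2 (F l) := by
  rw [← ENNReal.pow_le_pow_left_iff two_ne_zero, l2_sq]
  calc ∑' i, (∑' l, F l i) ^ 2 = ∑' i, ∑' l, ∑' m, F l i * F m i := by
        simp only [sq, ENNReal.tsum_mul_left, ENNReal.tsum_mul_right]
    _ = ∑' l, ∑' m, ∑' i, F l i * F m i := by
        rw [ENNReal.tsum_comm]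
        exact tsum_congr fun l => ENNReal.tsum_comm
    _ ≤ ∑' l, ∑' m, l2 (F l) * l2 (F m) :=
        ENNReal.tsum_le_tsum fun l => ENNReal.tsum_le_tsum fun m => tsum_mul_le_l2 _ _
    _ = (∑' l, l2 (F l)) ^ 2 := by
        simp only [sq, ENNReal.tsum_mul_left, ENNReal.tsum_mul_right]

lemma l2_add_le {ι : Type*} (f g : ι → ℝ≥0∞) : l2 (fun i => f i + g i) ≤ l2 f + l2 g := by
  have h := l2_tsum_le (fun (b : Bool) i => if b then f i else g i)
  simpa [tsum_bool, add_comm] using h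

lemma l2_comp_add (f : ℤ → ℝ≥0∞) (d : ℤ) : l2 (fun j => f (j + d)) = l2 f := by
  unfold l2
  congr 1
  exact (Equiv.addRight d).tsum_eq fun j => f j ^ 2

/-- Young's inequality `ℓ¹ * ℓ² ⊂ ℓ²`. -/
lemma l2_convolution_le (e f : ℤ → ℝ≥0∞) :
    l2 (fun j => ∑' k, e (k - j) * f k) ≤ (∑' d, e d) * l2 f := by
  have h1 : ∀ j : ℤ, ∑' k, e (k - j) * f k = ∑' d, e d * f (j + d) := by
    intro j
    rw [← (Equiv.addLeft j).tsum_eq]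
    simp
  simp only [h1]
  refine (l2_tsum_le _).trans_eq ?_
  simp only [l2_const_mul, l2_comp_add, ENNReal.tsum_mul_right]

/-! ### Comparison of the anisotropic and isotropic decompositions -/

lemma norm_sq_eq_horizontal_vertical (ξ : R3) : ‖ξ‖ ^ 2 = ‖horizontal ξ‖ ^ 2 + ‖vertical ξ‖ ^ 2 := by
  simp [EuclideanSpace.norm_sq_eq, horizontal, vertical, Fin.sum_univ_succ]
  ring

lemma norm_horizontal_le (ξ : R3) : ‖horizontal ξ‖ ≤ ‖ξ‖ := by
  have := norm_sq_eq_horizontal_vertical ξ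
  refine (pow_le_pow_iff_left₀ (norm_nonneg _) (by positivity) two_ne_zero).1 ?_
  nlinarith [sq_nonneg ‖vertical ξ‖]

lemma norm_vertical_le (ξ : R3) : ‖vertical ξ‖ ≤ ‖ξ‖ := by
  have := norm_sq_eq_horizontal_vertical ξ
  refine (pow_le_pow_iff_left₀ (norm_nonneg _) (by positivity) two_ne_zero).1 ?_
  nlinarith [sq_nonneg ‖horizontal ξ‖]

lemma norm_le_horizontal_add_vertical (ξ : R3) : ‖ξ‖ ≤ ‖horizontal ξ‖ + ‖vertical ξ‖ := by
  have := norm_sq_eq_horizontal_vertical ξ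
  refine (pow_le_pow_iff_left₀ (norm_nonneg _) (by positivity) two_ne_zero).1 ?_
  nlinarith [mul_nonneg (norm_nonneg (horizontal ξ)) (norm_nonneg (vertical ξ))]

section Frequencies

variable {φ : ℝ → ℝ}

lemma cutoff_ne_zero (hφ : IsDyadicCutoff φ) {k : ℤ} {τ : ℝ} (h : φ ((2 : ℝ) ^ (-k) * τ) ≠ 0) :
    3 / 4 * 2 ^ k < τ ∧ τ < 8 / 3 * 2 ^ k := by
  have h2 : (0 : ℝ) < 2 ^ k := by positivity
  have h3 : (2 : ℝ) ^ (-k) * τ = τ / 2 ^ k := by rw [zpow_neg]; ring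
  rw [h3] at h
  constructor
  · by_contra hc
    push Not at hc
    exact h (hφ.eq_zero_of_le (by rwa [div_le_iff₀ h2]))
  · by_contra hc
    push Not at hc
    exact h (hφ.eq_zero_of_ge (by rwa [le_div_iff₀ h2]))

lemma lowProfile_ne_zero (hφ : IsDyadicCutoff φ) {k : ℤ} {τ : ℝ} (hτ : 0 ≤ τ)
    (h : lowProfile φ ((2 : ℝ) ^ (-k) * τ) ≠ 0) : τ < 4 / 3 * 2 ^ k := by
  have h2 : (0 : ℝ) < 2 ^ k := by positivity
  have h3 : (2 : ℝ) ^ (-k) * τ = τ / 2 ^ k := by rw [zpow_neg]; ring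
  rw [h3] at h
  by_contra hc
  push Not at hc
  refine h (lowProfile_eq_zero hφ ?_)
  rw [abs_of_nonneg (by positivity)]
  rwa [le_div_iff₀ h2]

lemma lt_add_of_two_zpow_lt {j k : ℤ} {n : ℕ} (h : (2 : ℝ) ^ j < 2 ^ n * 2 ^ k) : j < n + k := by
  rw [← zpow_natCast, ← zpow_add₀ two_ne_zero] at h
  exact (zpow_lt_zpow_iff_right₀ one_lt_two).1 h

/-- The blocks `Δ_j` and `Δ^h_k Δ^v_l` with `k ≥ l - 1` interact only if `j` and `k` are close. -/
lemma abs_sub_le_of_hor (hφ : IsDyadicCutoff φ) {j k l : ℤ} (hkl : l - 1 ≤ k) {τ σ ρ : ℝ}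
    (h1 : σ ≤ τ) (h2 : τ ≤ σ + ρ) (hj : φ ((2 : ℝ) ^ (-j) * τ) ≠ 0)
    (hk : φ ((2 : ℝ) ^ (-k) * σ) ≠ 0) (hl : φ ((2 : ℝ) ^ (-l) * ρ) ≠ 0) : |k - j| ≤ 3 := by
  obtain ⟨a1, a2⟩ := cutoff_ne_zero hφ hj
  obtain ⟨b1, b2⟩ := cutoff_ne_zero hφ hk
  obtain ⟨c1, c2⟩ := cutoff_ne_zero hφ hl
  have h3 : (2 : ℝ) ^ l ≤ 2 * 2 ^ k := by
    rw [← zpow_one_add₀ two_ne_zero]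
    exact zpow_le_zpow_right₀ one_le_two (by omega)
  have h4 := lt_add_of_two_zpow_lt (j := j) (k := k) (n := 4) (by linarith)
  have h5 := lt_add_of_two_zpow_lt (j := k) (k := j) (n := 2) (by linarith)
  rw [abs_le]
  push_cast at h4 h5
  constructor <;> linarith

/-- The blocks `Δ_j` and `S^h_{l-1} Δ^v_l` interact only if `j` and `l` are close. -/
lemma abs_sub_le_of_low (hφ : IsDyadicCutoff φ) {j l : ℤ} {τ σ ρ : ℝ} (h0 : 0 ≤ σ)
    (h1 : ρ ≤ τ) (h2 : τ ≤ σ + ρ) (hj : φ ((2 : ℝ) ^ (-j) * τ) ≠ 0)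
    (hk : lowProfile φ ((2 : ℝ) ^ (-(l - 1)) * σ) ≠ 0) (hl : φ ((2 : ℝ) ^ (-l) * ρ) ≠ 0) :
    |l - j| ≤ 3 := by
  obtain ⟨a1, a2⟩ := cutoff_ne_zero hφ hj
  have b2 := lowProfile_ne_zero hφ h0 hk
  obtain ⟨c1, c2⟩ := cutoff_ne_zero hφ hl
  have h3 : (2 : ℝ) ^ l = 2 * 2 ^ (l - 1) := by
    rw [← zpow_one_add₀ two_ne_zero]
    congr 1
    ring
  have h4 := lt_add_of_two_zpow_lt (j := j) (k := l) (n := 3) (by linarith)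
  have h5 := lt_add_of_two_zpow_lt (j := l) (k := j) (n := 2) (by linarith)
  rw [abs_le]
  push_cast at h4 h5
  constructor <;> linarith

/-- `Δ_j` on Schwartz functions. -/
def isoMul (hφ : IsDyadicCutoff φ) (j : ℤ) : 𝓢(R3, ℂ) →L[ℂ] 𝓢(R3, ℂ) :=
  SchwartzMap.fourierMultiplierCLM ℂ (sym R3 hφ.isProfile j)

lemma fourierMultiplier_three_eq_zero {g₁ g₂ g₃ : R3 → ℂ} (h₁ : g₁.HasTemperateGrowth)
    (h₂ : g₂.HasTemperateGrowth) (h₃ : g₃.HasTemperateGrowth)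
    (h : ∀ ξ, g₁ ξ * (g₂ ξ * g₃ ξ) = 0) (a : 𝓢(R3, ℂ)) :
    SchwartzMap.fourierMultiplierCLM ℂ g₁ (SchwartzMap.fourierMultiplierCLM ℂ g₂
      (SchwartzMap.fourierMultiplierCLM ℂ g₃ a)) = 0 := by
  have h₂₃ : (fun ξ => g₂ ξ * g₃ ξ).HasTemperateGrowth := h₂.mul h₃
  rw [fourierMultiplier_fourierMultiplier h₂ h₃ (g := fun ξ => g₂ ξ * g₃ ξ) (fun _ => rfl),
    fourierMultiplier_fourierMultiplier h₁ h₂₃ (g := fun ξ => 0) (fun ξ => (h ξ).symm)]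
  ext x
  rw [fourierMultiplier_apply_eq_integral_exp (Function.HasTemperateGrowth.const 0)]
  simp

/-- The indicator function of `|d| ≤ 3`. -/
def nearWeight (d : ℤ) : ℝ≥0∞ := if |d| ≤ 3 then 1 else 0

lemma tsum_nearWeight_ne_top : ∑' d, nearWeight d ≠ ∞ := by
  rw [tsum_eq_sum (s := Finset.Icc (-3) 3)]
  · refine ENNReal.sum_ne_top.2 fun d _ => ?_
    unfold nearWeight
    split_ifs <;> simp
  · intro d hd
    rw [nearWeight, if_neg]
    rwa [abs_le, ← Finset.mem_Icc]

lemma enorm_le_nearWeight_mul {d : ℤ} {z : ℂ} {A : ℝ≥0∞} (h0 : ¬ |d| ≤ 3 → z = 0) (h : ‖z‖ₑ ≤ A) :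
    ‖z‖ₑ ≤ nearWeight d * A := by
  rw [nearWeight]
  split_ifs with hd
  · rwa [one_mul]
  · simp [h0 hd]

lemma isoMul_hor_eq_zero (hφ : IsDyadicCutoff φ) {j k l : ℤ} (hkl : l - 1 ≤ k)
    (hjk : ¬ |k - j| ≤ 3) (a : 𝓢(R3, ℂ)) : isoMul hφ j (horBlock φ k (verBlock φ l a)) = 0 := by
  rw [horBlock_eq hφ, verBlock_eq hφ]
  refine fourierMultiplier_three_eq_zero (SchwartzMap.hasTemperateGrowth _)
    (hasTemperateGrowth_comp_horizontal _) (hasTemperateGrowth_comp_vertical _) (fun ξ => ?_) a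
  by_contra hne
  rw [sym_apply, sym_apply, sym_apply] at hne
  simp only [mul_ne_zero_iff, ne_eq, Complex.ofReal_eq_zero] at hne
  have hpi := Real.pi_pos
  refine hjk (abs_sub_le_of_hor hφ hkl ?_ ?_ hne.1 hne.2.1 hne.2.2)
  · gcongr
    exact norm_horizontal_le ξ
  · rw [← mul_add]
    gcongr
    exact norm_le_horizontal_add_vertical ξ

lemma isoMul_low_eq_zero (hφ : IsDyadicCutoff φ) {j l : ℤ} (hjl : ¬ |l - j| ≤ 3) (a : 𝓢(R3, ℂ)) :
    isoMul hφ j (horMul (sym R2 (isProfile_lowProfile hφ) (l - 1)) (verBlock φ l a)) = 0 := by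
  rw [verBlock_eq hφ]
  refine fourierMultiplier_three_eq_zero (SchwartzMap.hasTemperateGrowth _)
    (hasTemperateGrowth_comp_horizontal _) (hasTemperateGrowth_comp_vertical _) (fun ξ => ?_) a
  by_contra hne
  rw [sym_apply, sym_apply, sym_apply] at hne
  simp only [mul_ne_zero_iff, ne_eq, Complex.ofReal_eq_zero] at hne
  have hpi := Real.pi_pos
  refine hjl (abs_sub_le_of_low hφ (by positivity) ?_ ?_ hne.1 hne.2.1 hne.2.2)
  · gcongr
    exact norm_vertical_le ξ
  · rw [← mul_add]
    gcongr
    exact norm_le_horizontal_add_vertical ξ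

lemma enorm_isoMul_le_tsum_verBlock (hφ : IsDyadicCutoff φ) (j : ℤ) (a : 𝓢(R3, ℂ)) (x : R3) :
    ‖isoMul hφ j a x‖ₑ ≤ ∑' l : ℤ, ‖isoMul hφ j (verBlock φ l a) x‖ₑ := by
  obtain ⟨B, hB⟩ := exists_tsum_cutoff_le hφ
  obtain ⟨A, hA⟩ := exists_bound_cutoff hφ
  have h := hasSum_fourierMultiplier
    (f := fun (l : ℤ) ξ => sym R3 hφ.isProfile j ξ * sym ℝ hφ.isProfile l (vertical ξ))
    (g := sym R3 hφ.isProfile j) (B := A * B)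
    (fun _ => (SchwartzMap.hasTemperateGrowth _).mul (hasTemperateGrowth_comp_vertical _))
    (SchwartzMap.hasTemperateGrowth _) ?_ ?_ a x
  · refine (enorm_le_tsum_enorm_of_hasSum h).trans_eq (tsum_congr fun l => ?_)
    rw [isoMul, verBlock_eq hφ, verMul, fourierMultiplier_fourierMultiplier
      (SchwartzMap.hasTemperateGrowth _) (hasTemperateGrowth_comp_vertical _) (fun _ => rfl)]
  · filter_upwards [ae_vertical_ne_zero] with ξ hξ
    have hpos : 0 < 2 * Real.pi * ‖vertical ξ‖ := by
      have := norm_pos_iff.2 hξ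
      positivity
    simp only [enorm_mul, enorm_sym, ENNReal.tsum_mul_left]
    push_cast
    exact mul_le_mul' (hA _) (hB _ hpos)
  · filter_upwards [ae_vertical_ne_zero] with ξ hξ
    have hpos : 0 < 2 * Real.pi * ‖vertical ξ‖ := by
      have := norm_pos_iff.2 hξ
      positivity
    have h1 := (hasSum_ofReal (hφ.hasSum _ hpos)).mul_left (sym R3 hφ.isProfile j ξ)
    have h2 : ∀ l : ℤ, sym ℝ hφ.isProfile l (vertical ξ) =
        ((φ ((2 : ℝ) ^ (-l) * (2 * Real.pi * ‖vertical ξ‖)) : ℝ) : ℂ) :=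
      fun l => sym_apply _ _ _
    simp only [h2]
    rwa [Complex.ofReal_one, mul_one] at h1

lemma fourierMultiplier_sub {g₁ g₂ : R3 → ℂ} (h₁ : g₁.HasTemperateGrowth)
    (h₂ : g₂.HasTemperateGrowth) (a : 𝓢(R3, ℂ)) :
    SchwartzMap.fourierMultiplierCLM ℂ (g₁ - g₂) a =
      SchwartzMap.fourierMultiplierCLM ℂ g₁ a - SchwartzMap.fourierMultiplierCLM ℂ g₂ a := by
  rw [SchwartzMap.fourierMultiplierCLM_apply,
    SchwartzMap.fourierMultiplierCLM_apply, SchwartzMap.fourierMultiplierCLM_apply,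
    SchwartzMap.smulLeftCLM_sub h₁ h₂, sub_apply, sub_eq_add_neg, sub_eq_add_neg,
    FourierTransform.fourierInv_add, FourierTransform.fourierInv_neg]

lemma hasSum_high (hφ : IsDyadicCutoff φ) {τ : ℝ} (hτ : 0 < τ) (l : ℤ) :
    HasSum (fun k : {k : ℤ // l - 1 ≤ k} => φ ((2 : ℝ) ^ (-(k : ℤ)) * τ))
      (1 - lowProfile φ ((2 : ℝ) ^ (-(l - 1)) * τ)) := by
  have h1 := hφ.hasSum τ hτ
  have h2 : HasSum (Set.indicator {k : ℤ | k ≤ l - 1 - 1} fun k => φ ((2 : ℝ) ^ (-k) * τ))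
      (lowProfile φ ((2 : ℝ) ^ (-(l - 1)) * τ)) :=
    hasSum_subtype_iff_indicator.1 (hasSum_lowProfile hφ hτ (l - 1))
  refine (hasSum_subtype_iff_indicator (s := {k : ℤ | l - 1 ≤ k})
    (f := fun k => φ ((2 : ℝ) ^ (-k) * τ))).2 ?_
  have h3 := h1.sub h2
  have h4 : (fun k : ℤ => φ ((2 : ℝ) ^ (-k) * τ) -
      Set.indicator {k : ℤ | k ≤ l - 1 - 1} (fun k => φ ((2 : ℝ) ^ (-k) * τ)) k) =
      Set.indicator {k : ℤ | l - 1 ≤ k} fun k => φ ((2 : ℝ) ^ (-k) * τ) := by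
    funext k
    symm
    by_cases hk : k ≤ l - 1 - 1
    · rw [Set.indicator_of_notMem (show k ∉ {k : ℤ | l - 1 ≤ k} from fun h => by
        have : l - 1 ≤ k := h
        omega), Set.indicator_of_mem (by exact hk), sub_self]
    · rw [Set.indicator_of_mem (show k ∈ {k : ℤ | l - 1 ≤ k} from (by omega : l - 1 ≤ k)),
        Set.indicator_of_notMem (by exact hk), sub_zero]
  rw [h4] at h3
  exact h3

/-- The splitting of a function into its horizontal blocks of order at least `l - 1` and its low
horizontal frequencies. -/
lemma enorm_isoMul_le_low_add_tsum (hφ : IsDyadicCutoff φ) (j l : ℤ) (b : 𝓢(R3, ℂ)) (x : R3) :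
    ‖isoMul hφ j b x‖ₑ ≤ (∑' k : {k : ℤ // l - 1 ≤ k}, ‖isoMul hφ j (horBlock φ k b) x‖ₑ) +
      ‖isoMul hφ j (horMul (sym R2 (isProfile_lowProfile hφ) (l - 1)) b) x‖ₑ := by
  obtain ⟨B, hB⟩ := exists_tsum_cutoff_le hφ
  obtain ⟨A, hA⟩ := exists_bound_cutoff hφ
  have hj := (sym R3 hφ.isProfile j).hasTemperateGrowth
  have hlow := hasTemperateGrowth_comp_horizontal (sym R2 (isProfile_lowProfile hφ) (l - 1))
  have hjlow : (fun ξ => sym R3 hφ.isProfile j ξ *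
      sym R2 (isProfile_lowProfile hφ) (l - 1) (horizontal ξ)).HasTemperateGrowth := hj.mul hlow
  have h := hasSum_fourierMultiplier
    (f := fun (k : {k : ℤ // l - 1 ≤ k}) ξ =>
      sym R3 hφ.isProfile j ξ * sym R2 hφ.isProfile k (horizontal ξ))
    (g := (sym R3 hφ.isProfile j : R3 → ℂ) - fun ξ => sym R3 hφ.isProfile j ξ *
      sym R2 (isProfile_lowProfile hφ) (l - 1) (horizontal ξ)) (B := A * B)
    (fun _ => hj.mul (hasTemperateGrowth_comp_horizontal _)) (hj.sub hjlow) ?_ ?_ b x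
  · rw [fourierMultiplier_sub hj hjlow] at h
    have h1 := enorm_le_tsum_enorm_of_hasSum h
    have h2 : SchwartzMap.fourierMultiplierCLM ℂ (fun ξ => sym R3 hφ.isProfile j ξ *
        sym R2 (isProfile_lowProfile hφ) (l - 1) (horizontal ξ)) b =
        isoMul hφ j (horMul (sym R2 (isProfile_lowProfile hφ) (l - 1)) b) :=
      (fourierMultiplier_fourierMultiplier hj hlow (fun _ => rfl) b).symm
    have h3 : ∀ k : {k : ℤ // l - 1 ≤ k}, SchwartzMap.fourierMultiplierCLM ℂ
        (fun ξ => sym R3 hφ.isProfile j ξ * sym R2 hφ.isProfile k (horizontal ξ)) b =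
        isoMul hφ j (horBlock φ k b) := by
      intro k
      rw [horBlock_eq hφ]
      exact (fourierMultiplier_fourierMultiplier hj (hasTemperateGrowth_comp_horizontal _)
        (fun _ => rfl) b).symm
    rw [h2, sub_apply] at h1
    simp only [h3] at h1
    calc ‖isoMul hφ j b x‖ₑ = ‖(isoMul hφ j b x -
          isoMul hφ j (horMul (sym R2 (isProfile_lowProfile hφ) (l - 1)) b) x) +
          isoMul hφ j (horMul (sym R2 (isProfile_lowProfile hφ) (l - 1)) b) x‖ₑ := by
          rw [sub_add_cancel]
      _ ≤ _ := (enorm_add_le _ _).trans (add_le_add h1 le_rfl)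
  · filter_upwards [ae_horizontal_ne_zero] with ξ hξ
    have hpos : 0 < 2 * Real.pi * ‖horizontal ξ‖ := by
      have := norm_pos_iff.2 hξ
      positivity
    simp only [enorm_mul, enorm_sym, ENNReal.tsum_mul_left]
    push_cast
    exact mul_le_mul' (hA _) ((ENNReal.tsum_comp_le_tsum_of_injective Subtype.val_injective _).trans
      (hB _ hpos))
  · filter_upwards [ae_horizontal_ne_zero] with ξ hξ
    have hpos : 0 < 2 * Real.pi * ‖horizontal ξ‖ := by
      have := norm_pos_iff.2 hξ
      positivity
    have h1 := (hasSum_ofReal (hasSum_high hφ hpos l)).mul_left (sym R3 hφ.isProfile j ξ)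
    have h2 : ((1 - lowProfile φ ((2 : ℝ) ^ (-(l - 1)) * (2 * Real.pi * ‖horizontal ξ‖)) : ℝ) : ℂ) =
        1 - sym R2 (isProfile_lowProfile hφ) (l - 1) (horizontal ξ) := by
      rw [sym_apply]
      push_cast
      rfl
    rw [h2, mul_sub, mul_one] at h1
    have h3 : ∀ k : {k : ℤ // l - 1 ≤ k}, sym R2 hφ.isProfile k (horizontal ξ) =
        ((φ ((2 : ℝ) ^ (-(k : ℤ)) * (2 * Real.pi * ‖horizontal ξ‖)) : ℝ) : ℂ) :=
      fun k => sym_apply _ _ _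
    simp only [h3]
    exact h1

lemma enorm_fourierMultiplier_le_eLpNorm_two (m b : 𝓢(R3, ℂ)) (x : R3) :
    ‖SchwartzMap.fourierMultiplierCLM ℂ m b x‖ₑ ≤
      (∫⁻ v, ‖𝓕⁻ m v‖ₑ ^ (2 : ℝ)) ^ (1 / 2 : ℝ) * eLpNorm b 2 volume := by
  have hc : Continuous fun v => ‖b (x - v)‖ₑ := (b.continuous.comp (continuous_sub_left x)).enorm
  rw [fourierMultiplier_apply]
  refine (enorm_integral_le_lintegral_enorm _).trans ?_
  simp only [enorm_mul]
  refine (ENNReal.lintegral_mul_le_Lp_mul_Lq volume Real.HolderConjugate.two_two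
    (𝓕⁻ m).continuous.enorm.measurable.aemeasurable hc.measurable.aemeasurable).trans_eq ?_
  congr 1
  rw [eLpNorm_eq_lintegral_rpow_enorm_toReal two_ne_zero ENNReal.ofNat_ne_top]
  simp only [ENNReal.toReal_ofNat]
  congr 1
  exact lintegral_sub_left_eq_self (fun v => ‖b v‖ₑ ^ (2 : ℝ)) x

end Frequencies

lemma nearWeight_mul_le {d : ℤ} {X Y : ℝ≥0∞} (h : |d| ≤ 3 → X ≤ Y) :
    nearWeight d * X ≤ nearWeight d * Y := by
  rw [nearWeight]
  split_ifs with hd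
  · rw [one_mul, one_mul]
    exact h hd
  · simp

section Embedding

variable {φ : ℝ → ℝ}

/-- `‖Δ_j a‖_{L^∞}` for a Schwartz function `a`. -/
def blockSup (hφ : IsDyadicCutoff φ) (j : ℤ) (a : 𝓢(R3, ℂ)) : ℝ≥0∞ := ⨆ x, ‖isoMul hφ j a x‖ₑ

/-- The Bernstein bound for the blocks `Δ_j Δ^h_k Δ^v_l`, which vanish unless `|k - j| ≤ 3`. -/
lemma exists_enorm_isoMul_hor_le (hφ : IsDyadicCutoff φ) {p : ℝ} (hp : 2 ≤ p) :
    ∃ C : ℝ≥0, ∀ (j k l : ℤ), l - 1 ≤ k → ∀ (a : 𝓢(R3, ℂ)) (x : R3),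
      ‖isoMul hφ j (horBlock φ k (verBlock φ l a)) x‖ₑ ≤ nearWeight (k - j) *
        (C * (2 ^ (2 / p * k) * 2 ^ ((l : ℝ) / 2) * mixedNorm p (horBlock φ k (verBlock φ l a)))) := by
  have hp0 : 0 < p := by linarith
  have hp1 : 0 < p - 1 := by linarith
  set q := p / (p - 1) with hq
  have hq0 : 0 < q := by positivity
  have hq1 : 1 - 1 / q = 1 / p := by
    rw [hq]
    field_simp
    ring
  set c₁ := (∫⁻ v, ‖𝓕⁻ (radial R2 (isProfile_wideProfile hφ)) v‖ₑ ^ q) ^ (1 / q) with hc₁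
  set c₂ := (∫⁻ v, ‖𝓕⁻ (radial ℝ (isProfile_wideProfile hφ)) v‖ₑ ^ (2 : ℝ)) ^ (1 / 2 : ℝ) with hc₂
  have h₁ : c₁ ≠ ∞ := ENNReal.rpow_ne_top_of_nonneg (by positivity)
    (lintegral_rpow_enorm_ne_top _ hq0)
  have h₂ : c₂ ≠ ∞ := ENNReal.rpow_ne_top_of_nonneg (by positivity)
    (lintegral_rpow_enorm_ne_top _ two_pos)
  set D := kernelNorm (radial R3 hφ.isProfile) * (c₁ * c₂) with hD
  have hDtop : D ≠ ∞ := ENNReal.mul_ne_top (kernelNorm_lt_top _).ne (ENNReal.mul_ne_top h₁ h₂)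
  refine ⟨D.toNNReal, fun j k l hkl a x => ?_⟩
  rw [ENNReal.coe_toNNReal hDtop]
  set g := horBlock φ k (verBlock φ l a) with hg
  refine enorm_le_nearWeight_mul (fun h => by rw [hg, isoMul_hor_eq_zero hφ hkl h]; rfl) ?_
  have hb : ∀ x, ‖g x‖ₑ ≤ 2 ^ (2 / p * k) * c₁ * (2 ^ ((l : ℝ) / 2) * c₂) * mixedNorm p g := by
    intro x
    refine (enorm_le_mixedNorm hp (horMul_wide_verMul_wide hφ k l a) x).trans_eq ?_
    rw [lintegral_enorm_fourierInv_sym _ _ hq0, lintegral_enorm_fourierInv_sym _ _ two_pos,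
      finrank_euclideanSpace_fin, Module.finrank_self, hq1,
      show (k : ℝ) * (((2 : ℕ) : ℝ) * (1 / p)) = 2 / p * k by push_cast; ring,
      show (l : ℝ) * (((1 : ℕ) : ℝ) * (1 - 1 / 2)) = l / 2 by push_cast; ring]
  refine (enorm_fourierMultiplier_le _ _ hb x).trans_eq ?_
  rw [kernelNorm_sym]
  ring

/-- The Bernstein bound for the blocks `Δ_j S^h_{l-1} Δ^v_l`, which vanish unless `|l - j| ≤ 3`. -/
lemma exists_enorm_isoMul_low_le (hφ : IsDyadicCutoff φ) :
    ∃ C : ℝ≥0, ∀ (j l : ℤ) (a : 𝓢(R3, ℂ)) (x : R3),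
      ‖isoMul hφ j (horMul (sym R2 (isProfile_lowProfile hφ) (l - 1)) (verBlock φ l a)) x‖ₑ ≤
        nearWeight (l - j) * (C * (2 ^ (3 / 2 * (j : ℝ)) *
          eLpNorm (horLow φ (l - 1) (verBlock φ l a)) 2 volume)) := by
  set c := (∫⁻ v, ‖𝓕⁻ (radial R3 hφ.isProfile) v‖ₑ ^ (2 : ℝ)) ^ (1 / 2 : ℝ) with hc
  have hctop : c ≠ ∞ := ENNReal.rpow_ne_top_of_nonneg (by positivity)
    (lintegral_rpow_enorm_ne_top _ two_pos)
  refine ⟨c.toNNReal, fun j l a x => ?_⟩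
  rw [ENNReal.coe_toNNReal hctop, horLow_eq hφ]
  refine enorm_le_nearWeight_mul (fun h => by rw [isoMul_low_eq_zero hφ h]; rfl) ?_
  refine (enorm_fourierMultiplier_le_eLpNorm_two _ _ x).trans_eq ?_
  rw [lintegral_enorm_fourierInv_sym _ _ two_pos, finrank_euclideanSpace_fin, ← hc,
    mul_comm (2 ^ _ : ℝ≥0∞) c, mul_assoc]
  congr 3
  push_cast
  ring

lemma two_zpow_eq_rpow (k : ℤ) : (2 : ℝ≥0∞) ^ k = 2 ^ (k : ℝ) := (ENNReal.rpow_intCast 2 k).symm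

lemma two_rpow_mono {a b : ℝ} (h : a ≤ b) : (2 : ℝ≥0∞) ^ a ≤ 2 ^ b :=
  ENNReal.rpow_le_rpow_of_exponent_le one_le_two h

/-- `B^{-1+2/p,1/2}_p ⊂ Ḃ^{-1}_{∞,2}` on Schwartz functions. For fixed `l` the sums over `k` and `j`
are convolutions with a finitely supported weight, so that the `ℓ²` norm in `k` passes to `j`; the
sum over `l` is handled by Minkowski's inequality. -/
lemma exists_l2_blockSup_le (hφ : IsDyadicCutoff φ) {p : ℝ} (hp : 2 ≤ p) :
    ∃ C : ℝ≥0, ∀ a : 𝓢(R3, ℂ), l2 (fun j : ℤ => 2 ^ (-j) * blockSup hφ j a) ≤ C * anisoNorm φ p a := by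
  obtain ⟨K, hK⟩ := exists_enorm_isoMul_hor_le hφ hp
  obtain ⟨c, hc⟩ := exists_enorm_isoMul_low_le hφ
  have hp0 : 0 < p := by linarith
  set E := ∑' d, nearWeight d with hE
  set A : ℝ≥0∞ := K * 8 with hA
  set A' : ℝ≥0∞ := c * 4 with hA'
  have htop : (A + A') * E ≠ ∞ := ENNReal.mul_ne_top (by finiteness) tsum_nearWeight_ne_top
  refine ⟨((A + A') * E).toNNReal, fun a => ?_⟩
  rw [ENNReal.coe_toNNReal htop]
  -- The inner sums of the anisotropic norm are `l2 (f l)`, its low frequency terms are `b l`.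
  set f : ℤ → ℤ → ℝ≥0∞ := fun l => Set.indicator {k : ℤ | l - 1 ≤ k} fun k =>
    2 ^ ((2 / p - 1) * (k : ℝ)) * mixedNorm p (horBlock φ k (verBlock φ l a)) with hf
  set b : ℤ → ℝ≥0∞ := fun l =>
    2 ^ ((l : ℝ) / 2) * eLpNorm (horLow φ (l - 1) (verBlock φ l a)) 2 volume with hb
  have hpt : ∀ j x, 2 ^ (-j) * ‖isoMul hφ j a x‖ₑ ≤
      ∑' l : ℤ, (A * 2 ^ ((l : ℝ) / 2) * ∑' k : ℤ, nearWeight (k - j) * f l k +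
        A' * b l * nearWeight (l - j)) := by
    intro j x
    refine (mul_le_mul' le_rfl (enorm_isoMul_le_tsum_verBlock hφ j a x)).trans ?_
    rw [← ENNReal.tsum_mul_left]
    refine ENNReal.tsum_le_tsum fun l => ?_
    refine (mul_le_mul' le_rfl (enorm_isoMul_le_low_add_tsum hφ j l _ x)).trans ?_
    rw [mul_add]
    refine add_le_add ?_ ?_
    · have h1 : ∑' k : ℤ, nearWeight (k - j) * f l k = ∑' k : {k : ℤ // l - 1 ≤ k},
          nearWeight (k - j) * (2 ^ ((2 / p - 1) * ((k : ℤ) : ℝ)) *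
            mixedNorm p (horBlock φ k (verBlock φ l a))) := by
        rw [← tsum_subtype_eq_of_support_subset (s := {k : ℤ | l - 1 ≤ k})]
        · refine tsum_congr fun k => ?_
          rw [hf]
          simp only
          rw [Set.indicator_of_mem k.2]
        · intro k hk
          by_contra hk'
          refine hk ?_
          simp only [hf]
          rw [Set.indicator_of_notMem hk', mul_zero]
      rw [h1, ← ENNReal.tsum_mul_left, ← ENNReal.tsum_mul_left]
      refine ENNReal.tsum_le_tsum fun k => ?_
      set M := mixedNorm p (horBlock φ k (verBlock φ l a)) with hM
      calc _ ≤ 2 ^ (-j) * (nearWeight (k - j) *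
            (K * (2 ^ (2 / p * ((k : ℤ) : ℝ)) * 2 ^ ((l : ℝ) / 2) * M))) := by
            gcongr
            exact hK j k l k.2 a x
        _ = nearWeight (k - j) * ((2 ^ (-(j : ℝ)) * 2 ^ (2 / p * ((k : ℤ) : ℝ))) *
            (K * 2 ^ ((l : ℝ) / 2) * M)) := by
            rw [two_zpow_eq_rpow]
            push_cast
            ring
        _ ≤ nearWeight (k - j) * ((2 ^ (3 : ℝ) * 2 ^ ((2 / p - 1) * ((k : ℤ) : ℝ))) *
            (K * 2 ^ ((l : ℝ) / 2) * M)) := by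
            refine nearWeight_mul_le fun h => ?_
            gcongr ?_ * _
            rw [← two_rpow_add, ← two_rpow_add]
            refine two_rpow_mono ?_
            have h2 : ((k : ℤ) : ℝ) - j ≤ 3 := by exact_mod_cast (abs_le.1 h).2
            linarith
        _ = _ := by
            have h3 : (2 : ℝ≥0∞) ^ (3 : ℝ) = 8 := by
              rw [show (3 : ℝ) = ((3 : ℕ) : ℝ) by norm_num, ENNReal.rpow_natCast]
              norm_num
            rw [h3, hA]
            ring
    · set M := eLpNorm (horLow φ (l - 1) (verBlock φ l a)) 2 volume with hM
      calc _ ≤ 2 ^ (-j) * (nearWeight (l - j) * (c * (2 ^ (3 / 2 * (j : ℝ)) * M))) := by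
            gcongr
            exact hc j l a x
        _ = nearWeight (l - j) * ((2 ^ (-(j : ℝ)) * 2 ^ (3 / 2 * (j : ℝ))) * (c * M)) := by
            rw [two_zpow_eq_rpow]
            push_cast
            ring
        _ ≤ nearWeight (l - j) * ((2 ^ (2 : ℝ) * 2 ^ ((l : ℝ) / 2)) * (c * M)) := by
            refine nearWeight_mul_le fun h => ?_
            gcongr ?_ * _
            rw [← two_rpow_add, ← two_rpow_add]
            refine two_rpow_mono ?_
            have h2 : -3 ≤ (l : ℝ) - j := by exact_mod_cast (abs_le.1 h).1
            linarith
        _ = _ := by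
            have h3 : (2 : ℝ≥0∞) ^ (2 : ℝ) = 4 := by
              rw [ENNReal.rpow_two]
              norm_num
            rw [h3, hA', hb]
            ring
  have hsup : ∀ j, 2 ^ (-j) * blockSup hφ j a ≤
      ∑' l : ℤ, (A * 2 ^ ((l : ℝ) / 2) * ∑' k : ℤ, nearWeight (k - j) * f l k +
        A' * b l * nearWeight (l - j)) := by
    intro j
    rw [blockSup, ENNReal.mul_iSup]
    exact iSup_le (hpt j)
  have hnear : ∀ l : ℤ, l2 (fun j => nearWeight (l - j)) ≤ E := by
    intro l
    refine (l2_le_tsum _).trans_eq ?_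
    exact (Equiv.subLeft l).tsum_eq nearWeight
  have hfl : ∀ l, l2 (f l) = (∑' k : {k : ℤ // l - 1 ≤ k},
      (2 : ℝ≥0∞) ^ ((-2 + 4 / p) * ((k : ℤ) : ℝ)) *
        mixedNorm p (horBlock φ k (verBlock φ l a)) ^ 2) ^ (1 / 2 : ℝ) := by
    intro l
    rw [l2, ← tsum_subtype_eq_of_support_subset (s := {k : ℤ | l - 1 ≤ k})]
    · congr 1
      refine tsum_congr fun k => ?_
      rw [hf]
      simp only
      rw [Set.indicator_of_mem k.2, mul_pow, ← ENNReal.rpow_natCast (2 ^ _ : ℝ≥0∞),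
        ← ENNReal.rpow_mul]
      congr 2
      push_cast
      ring
    · intro k hk
      by_contra hk'
      refine hk ?_
      simp only [hf]
      rw [Set.indicator_of_notMem hk']
      simp
  calc l2 (fun j : ℤ => 2 ^ (-j) * blockSup hφ j a)
      ≤ ∑' l : ℤ, (A * 2 ^ ((l : ℝ) / 2) * (E * l2 (f l)) + A' * b l * E) := by
        refine (l2_mono hsup).trans ((l2_tsum_le _).trans (ENNReal.tsum_le_tsum fun l => ?_))
        refine (l2_add_le _ _).trans ?_
        rw [l2_const_mul, l2_const_mul]
        gcongr
        · exact l2_convolution_le nearWeight (f l)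
        · exact hnear l
    _ = A * E * (∑' l : ℤ, 2 ^ ((l : ℝ) / 2) * l2 (f l)) + A' * E * ∑' l, b l := by
        rw [ENNReal.tsum_add, ← ENNReal.tsum_mul_left (a := A * E),
          ← ENNReal.tsum_mul_left (a := A' * E)]
        congr 1
        · exact tsum_congr fun l => by ring
        · exact tsum_congr fun l => by ring
    _ ≤ (A + A') * E * (∑' l : ℤ, 2 ^ ((l : ℝ) / 2) * l2 (f l)) + (A + A') * E * ∑' l, b l := by
        gcongr
        · exact le_self_add
        · exact le_add_self
    _ = _ := by
        rw [anisoNorm, mul_add]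
        simp only [hfl, hb]

end Embedding

/-! ### Lower semicontinuity -/

lemma le_liminf_const_mul {x : ℝ≥0∞} {f : ℕ → ℝ≥0∞} (h : x ≤ liminf f atTop) {c : ℝ≥0∞}
    (hc : c ≠ ∞) : c * x ≤ liminf (fun n => c * f n) atTop := by
  have h1 := Monotone.map_liminf_of_continuousAt (F := atTop) (f := fun y : ℝ≥0∞ => c * y)
    (fun _ _ hab => mul_le_mul' le_rfl hab) f (ENNReal.continuous_const_mul hc).continuousAt
  exact (mul_le_mul' le_rfl h).trans_eq h1

lemma le_liminf_pow {x : ℝ≥0∞} {f : ℕ → ℝ≥0∞} (h : x ≤ liminf f atTop) (m : ℕ) :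
    x ^ m ≤ liminf (fun n => f n ^ m) atTop := by
  have h1 := Monotone.map_liminf_of_continuousAt (F := atTop) (f := fun y : ℝ≥0∞ => y ^ m)
    (fun _ _ hab => pow_le_pow_left' hab m) f (ENNReal.continuous_pow m).continuousAt
  exact (pow_le_pow_left' h m).trans_eq h1

lemma le_liminf_rpow {x : ℝ≥0∞} {f : ℕ → ℝ≥0∞} (h : x ≤ liminf f atTop) {r : ℝ} (hr : 0 ≤ r) :
    x ^ r ≤ liminf (fun n => f n ^ r) atTop := by
  have h1 := Monotone.map_liminf_of_continuousAt (F := atTop) (f := fun y : ℝ≥0∞ => y ^ r)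
    (ENNReal.monotone_rpow_of_nonneg hr) f ENNReal.continuous_rpow_const.continuousAt
  exact (ENNReal.rpow_le_rpow h hr).trans_eq h1

lemma le_liminf_lintegral {α : Type*} [MeasurableSpace α] {μ : Measure α} {F : α → ℝ≥0∞}
    {f : ℕ → α → ℝ≥0∞} (hf : ∀ n, Measurable (f n))
    (h : ∀ a, F a ≤ liminf (fun n => f n a) atTop) :
    ∫⁻ a, F a ∂μ ≤ liminf (fun n => ∫⁻ a, f n a ∂μ) atTop :=
  (lintegral_mono h).trans (lintegral_liminf_le hf)

lemma le_liminf_tsum {ι : Type*} {F : ι → ℝ≥0∞} {f : ℕ → ι → ℝ≥0∞}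
    (h : ∀ i, F i ≤ liminf (fun n => f n i) atTop) :
    ∑' i, F i ≤ liminf (fun n => ∑' i, f n i) atTop := by
  let _ : MeasurableSpace ι := ⊤
  have h1 := le_liminf_lintegral (μ := (Measure.count : Measure ι))
    (fun n => measurable_from_top (f := f n)) h
  simpa only [lintegral_count] using h1

lemma le_liminf_add_ennreal {x y : ℝ≥0∞} {f g : ℕ → ℝ≥0∞} (hf : x ≤ liminf f atTop)
    (hg : y ≤ liminf g atTop) : x + y ≤ liminf (fun n => f n + g n) atTop := by
  have h := le_liminf_tsum (F := fun b : Bool => cond b y x)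
    (f := fun n b => cond b (g n) (f n)) (by rintro (_ | _) <;> assumption)
  simpa only [tsum_bool, cond_true, cond_false] using h

lemma le_liminf_enorm {z : ℂ} {f : ℕ → ℂ} (h : Tendsto f atTop (𝓝 z)) :
    ‖z‖ₑ ≤ liminf (fun n => ‖f n‖ₑ) atTop :=
  h.enorm.liminf_eq.ge

lemma le_liminf_l2 {ι : Type*} {F : ι → ℝ≥0∞} {f : ℕ → ι → ℝ≥0∞}
    (h : ∀ i, F i ≤ liminf (fun n => f n i) atTop) :
    l2 F ≤ liminf (fun n => l2 (f n)) atTop :=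
  le_liminf_rpow (le_liminf_tsum fun i => le_liminf_pow (h i) 2) (by norm_num)

lemma mixedNorm_le_liminf {p : ℝ} (hp : 0 ≤ p) {g : R3 → ℂ} {f : ℕ → R3 → ℂ}
    (hf : ∀ n, Continuous (f n)) (h : ∀ x, Tendsto (fun n => f n x) atTop (𝓝 (g x))) :
    mixedNorm p g ≤ liminf (fun n => mixedNorm p (f n)) atTop := by
  refine le_liminf_rpow ?_ (by positivity)
  refine le_liminf_lintegral (fun n => (measurable_vertSq (hf n)).pow_const _) fun y => ?_
  refine le_liminf_rpow ?_ (by positivity)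
  refine le_liminf_lintegral (fun n => ?_) fun z => ?_
  · exact ((hf n).comp (continuous_pt.comp (continuous_const.prodMk continuous_id))).enorm.measurable.pow_const 2
  · exact le_liminf_pow (le_liminf_enorm (h _)) 2

section Limits

variable {φ : ℝ → ℝ}

lemma tendsto_apply {a : ℕ → 𝓢(R3, ℂ)} {u : 𝓢'(R3, ℂ)} (h : TendstoDist a u) (ψ : 𝓢(R3, ℂ)) :
    Tendsto (fun n => (a n : 𝓢'(R3, ℂ)) ψ) atTop (𝓝 (u ψ)) := by
  rw [TendstoDist, PointwiseConvergenceCLM.tendsto_iff_forall_tendsto] at h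
  exact h ψ

/-- The blocks of a limit are limits of the blocks. -/
lemma supNorm_isoBlock_le_liminf (hφ : IsDyadicCutoff φ) {a : ℕ → 𝓢(R3, ℂ)} {u : 𝓢'(R3, ℂ)}
    (h : TendstoDist a u) (j : ℤ) :
    supNorm (isoBlock φ j u) ≤ liminf (fun n => blockSup hφ j (a n)) atTop := by
  rw [isoBlock, isoSymbol_eq hφ]
  refine supNorm_fourierMultiplier_le (sym_even _ _) u fun y => ?_
  refine (le_liminf_enorm (tendsto_apply h _)).trans (liminf_le_liminf (Eventually.of_forall fun n => ?_))
  rw [coe_apply_translate (sym_even _ _)]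
  exact le_iSup (fun x => ‖isoMul hφ j (a n) x‖ₑ) y

lemma besovNorm_two_le_liminf (hφ : IsDyadicCutoff φ) {a : ℕ → 𝓢(R3, ℂ)} {u : 𝓢'(R3, ℂ)}
    (h : TendstoDist a u) : besovNorm φ 2 u ≤
      liminf (fun n => l2 fun j : ℤ => 2 ^ (-j) * blockSup hφ j (a n)) atTop := by
  rw [besovNorm_two]
  exact le_liminf_l2 fun j => le_liminf_const_mul (supNorm_isoBlock_le_liminf hφ h j) (two_zpow_ne_top _)

lemma besovNorm_two_coe_le (hφ : IsDyadicCutoff φ) (a : 𝓢(R3, ℂ)) :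
    besovNorm φ 2 (a : 𝓢'(R3, ℂ)) ≤ l2 fun j : ℤ => 2 ^ (-j) * blockSup hφ j a := by
  have h : TendstoDist (fun _ => a) (a : 𝓢'(R3, ℂ)) := tendsto_const_nhds
  simpa using besovNorm_two_le_liminf hφ h

/-- The blocks of an integrable function decay at low frequencies. -/
lemma exists_enorm_fourierMultiplier_sym_le {θ : ℝ → ℝ} (hθ : IsProfile θ) :
    ∃ C : ℝ≥0, ∀ (k : ℤ) (a : 𝓢(R3, ℂ)) (x : R3),
      ‖SchwartzMap.fourierMultiplierCLM ℂ (sym R3 hθ k) a x‖ₑ ≤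
        2 ^ (k * 3) * (C * ∫⁻ x, ‖a x‖ₑ) := by
  obtain ⟨C, hC⟩ := exists_enorm_fourierInv_sym_le (V := R3) hθ
  refine ⟨C, fun k a x => ?_⟩
  have h := enorm_fourierMultiplier_le_lintegral (sym R3 hθ k) a (hC k) x
  rw [finrank_euclideanSpace_fin, mul_assoc] at h
  exact h

/-- Schwartz functions belong to `Ḃ^{-1}_{∞,2}`. -/
lemma l2_blockSup_lt_top (hφ : IsDyadicCutoff φ) (a : 𝓢(R3, ℂ)) :
    l2 (fun j : ℤ => 2 ^ (-j) * blockSup hφ j a) < ∞ := by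
  obtain ⟨C, hC⟩ := exists_enorm_fourierMultiplier_sym_le hφ.isProfile
  obtain ⟨S, -, hS⟩ := a.decay 0 0
  have hS' : ∀ x, ‖a x‖ₑ ≤ ENNReal.ofReal S := fun x => by
    rw [← ofReal_norm]
    exact ENNReal.ofReal_le_ofReal (by simpa using hS x)
  set D := kernelNorm (radial R3 hφ.isProfile) * ENNReal.ofReal S + C * ∫⁻ x, ‖a x‖ₑ with hD
  have hDtop : D < ∞ := ENNReal.add_lt_top.2
    ⟨ENNReal.mul_lt_top (kernelNorm_lt_top _) ENNReal.ofReal_lt_top,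
      ENNReal.mul_lt_top ENNReal.coe_lt_top (lintegral_enorm_lt_top a)⟩
  have hj : ∀ j : ℤ, 2 ^ (-j) * blockSup hφ j a ≤ D * dyadicWeight j := by
    intro j
    have h1 : blockSup hφ j a ≤ D := iSup_le fun x =>
      (enorm_fourierMultiplier_le _ a hS' x).trans (by rw [kernelNorm_sym]; exact le_self_add)
    have h2 : blockSup hφ j a ≤ 2 ^ (j * 3) * D := iSup_le fun x =>
      (hC j a x).trans (by gcongr; exact le_add_self)
    rw [dyadicWeight]
    rcases le_total 0 j with h0 | h0
    · rw [min_eq_right (ENNReal.zpow_le_of_le one_le_two (by omega)), mul_comm D]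
      gcongr
    · rw [min_eq_left (ENNReal.zpow_le_of_le one_le_two (by omega))]
      calc _ ≤ 2 ^ (-j) * (2 ^ (j * 3) * D) := by gcongr
        _ = D * 2 ^ (-j + j * 3) := by rw [two_zpow_add]; ring
        _ ≤ D * 2 ^ j :=
          mul_le_mul' le_rfl (ENNReal.zpow_le_of_le one_le_two (by omega))
  refine ((l2_mono hj).trans (l2_le_tsum _)).trans_lt ?_
  rw [ENNReal.tsum_mul_left]
  exact ENNReal.mul_lt_top hDtop (tsum_dyadicWeight_le.trans_lt ENNReal.ofNat_lt_top)

/-- Schwartz functions have no low frequency part. -/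
lemma tendsto_coe_lowMul (hφ : IsDyadicCutoff φ) (b ψ : 𝓢(R3, ℂ)) :
    Tendsto (fun n : ℕ => (b : 𝓢'(R3, ℂ)) (lowMul hφ (-n) ψ)) atTop (𝓝 0) := by
  obtain ⟨C, hC⟩ := exists_enorm_fourierMultiplier_sym_le (isProfile_lowProfile hφ)
  have htop : (C * ∫⁻ x, ‖ψ x‖ₑ) * ∫⁻ x, ‖b x‖ₑ ≠ ∞ := ENNReal.mul_ne_top
    (ENNReal.mul_ne_top ENNReal.coe_ne_top (lintegral_enorm_lt_top ψ).ne) (lintegral_enorm_lt_top b).ne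
  refine tendsto_zero_of_enorm_le_two_zpow htop fun n => ?_
  have hsymm : (b : 𝓢'(R3, ℂ)) (lowMul hφ (-n) ψ) = (lowMul hφ (-n) ψ : 𝓢'(R3, ℂ)) b := by
    rw [SchwartzMap.coe_apply, SchwartzMap.coe_apply]
    simp only [smul_eq_mul, mul_comm]
  rw [hsymm]
  refine (enorm_coe_apply_le _ _ fun x => hC (-n) ψ x).trans ?_
  rw [mul_assoc]
  gcongr ?_ * _
  exact ENNReal.zpow_le_of_le one_le_two (by omega)

/-- The size of a test function in the pairing with `Ḃ^{-1}_{∞,∞}`. -/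
def testNorm (ψ : 𝓢(R3, ℂ)) : ℝ≥0∞ := (∫⁻ x, ‖ψ x‖ₑ) + ∫⁻ x, ‖negLaplacian ψ x‖ₑ

lemma testNorm_lt_top (ψ : 𝓢(R3, ℂ)) : testNorm ψ < ∞ :=
  ENNReal.add_lt_top.2 ⟨lintegral_enorm_lt_top _, lintegral_enorm_lt_top _⟩

lemma tendsto_testNorm : Tendsto testNorm (𝓝 0) (𝓝 0) := by
  have h1 : Continuous fun ψ : 𝓢(R3, ℂ) => ∫⁻ x, ‖ψ x‖ₑ := by
    have h2 : Continuous fun ψ : 𝓢(R3, ℂ) => ‖ψ.toLp 1 volume‖ₑ :=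
      (SchwartzMap.continuous_toLp (p := 1)).enorm
    refine h2.congr fun ψ => ?_
    rw [← ofReal_norm, SchwartzMap.norm_toLp, ENNReal.ofReal_toReal (ψ.eLpNorm_lt_top 1 volume).ne,
      eLpNorm_one_eq_lintegral_enorm]
  have h3 : Continuous testNorm := h1.add (h1.comp negLaplacian.continuous)
  simpa [testNorm] using h3.tendsto 0

lemma testNorm_lowMul_le (hφ : IsDyadicCutoff φ) (k : ℤ) (ψ : 𝓢(R3, ℂ)) :
    testNorm (lowMul hφ k ψ) ≤ kernelNorm (radial R3 (isProfile_lowProfile hφ)) * testNorm ψ := by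
  have h1 : negLaplacian (lowMul hφ k ψ) = lowMul hφ k (negLaplacian ψ) :=
    fourierMultiplier_comm hasTemperateGrowth_negLaplacian (SchwartzMap.hasTemperateGrowth _) ψ
  rw [testNorm, testNorm, h1, mul_add, ← kernelNorm_sym _ k]
  exact add_le_add (lintegral_enorm_fourierMultiplier_le _ _) (lintegral_enorm_fourierMultiplier_le _ _)

/-- The norm of `B^{-1+2/p,1/2}_p` controls the pairing with test functions, through the norm of
`Ḃ^{-1}_{∞,∞}` and the convergence of the dyadic series. -/
lemma exists_enorm_coe_apply_le (hφ : IsDyadicCutoff φ) {p : ℝ} (hp : 2 ≤ p) :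
    ∃ C : ℝ≥0, ∀ b ψ : 𝓢(R3, ℂ), ‖(b : 𝓢'(R3, ℂ)) ψ‖ₑ ≤ C * anisoNorm φ p b * testNorm ψ := by
  obtain ⟨C, hC⟩ := exists_tsum_enorm_isoBlock_le hφ
  obtain ⟨D, hD⟩ := exists_l2_blockSup_le hφ hp
  refine ⟨C * D, fun b ψ => ?_⟩
  have h1 : besovNorm φ ∞ (b : 𝓢'(R3, ℂ)) ≤ l2 fun j : ℤ => 2 ^ (-j) * blockSup hφ j b :=
    (besovNorm_top_le_two _ _).trans (besovNorm_two_coe_le hφ b)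
  have h2 := hasSum_isoBlock_of_tendsto hφ (h1.trans_lt (l2_blockSup_lt_top hφ b))
    (tendsto_coe_lowMul hφ b)
  have h3 : HasSum (fun k : ℤ => isoBlock φ k (b : 𝓢'(R3, ℂ)) ψ) ((b : 𝓢'(R3, ℂ)) ψ) := by
    rw [HasSum, PointwiseConvergenceCLM.tendsto_iff_forall_tendsto] at h2
    simpa [HasSum] using h2 ψ
  calc _ ≤ ∑' k : ℤ, ‖isoBlock φ k (b : 𝓢'(R3, ℂ)) ψ‖ₑ := enorm_le_tsum_enorm_of_hasSum h3
    _ ≤ C * besovNorm φ ∞ (b : 𝓢'(R3, ℂ)) * testNorm ψ := hC _ ψ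
    _ ≤ C * (D * anisoNorm φ p b) * testNorm ψ := by
        gcongr
        exact h1.trans (hD b)
    _ = _ := by push_cast; ring

lemma coe_sub_apply (a b ψ : 𝓢(R3, ℂ)) : ((a - b : 𝓢(R3, ℂ)) : 𝓢'(R3, ℂ)) ψ =
    (a : 𝓢'(R3, ℂ)) ψ - (b : 𝓢'(R3, ℂ)) ψ := by
  have h := map_sub (SchwartzMap.toTemperedDistributionCLM R3 ℂ volume) a b
  exact DFunLike.congr_fun h ψ

end Limits

/-! ### Completeness and lower semicontinuity of the anisotropic norm -/

section Limits

variable {φ : ℝ → ℝ}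

/-- A sequence of Schwartz functions that is Cauchy for the anisotropic norm converges in the
sense of distributions: the pairings converge by the duality bound, and the limit is continuous
because it differs from the pairing with one term of the sequence by a multiple of `testNorm`. -/
lemma exists_tendstoDist (hφ : IsDyadicCutoff φ) {p : ℝ} (hp : 2 ≤ p) {a : ℕ → 𝓢(R3, ℂ)}
    (ha : IsAnisoCauchy φ p a) : ∃ u : 𝓢'(R3, ℂ), TendstoDist a u := by
  obtain ⟨C, hC⟩ := exists_enorm_coe_apply_le hφ hp
  have hlim : ∀ ψ : 𝓢(R3, ℂ), ∃ z : ℂ, Tendsto (fun n => (a n : 𝓢'(R3, ℂ)) ψ) atTop (𝓝 z) := by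
    intro ψ
    refine cauchySeq_tendsto_of_complete (EMetric.cauchySeq_iff.2 fun ε hε => ?_)
    have hK : (C : ℝ≥0∞) * testNorm ψ + 1 ≠ ∞ :=
      ENNReal.add_ne_top.2 ⟨(ENNReal.mul_lt_top ENNReal.coe_lt_top (testNorm_lt_top ψ)).ne, by simp⟩
    obtain ⟨ε', hε', hlt⟩ := exists_between hε
    obtain ⟨N, hN⟩ := ha (ε' / ((C : ℝ≥0∞) * testNorm ψ + 1)) (ENNReal.div_pos hε'.ne' hK)
    refine ⟨N, fun m hm n hn => lt_of_le_of_lt ?_ hlt⟩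
    rw [edist_eq_enorm_sub, ← coe_sub_apply]
    calc _ ≤ C * anisoNorm φ p (a m - a n) * testNorm ψ := hC _ ψ
      _ = (C * testNorm ψ) * anisoNorm φ p (a m - a n) := by ring
      _ ≤ (C * testNorm ψ + 1) * (ε' / (C * testNorm ψ + 1)) :=
          mul_le_mul' le_self_add (hN m hm n hn)
      _ = ε' := ENNReal.mul_div_cancel (by simp) hK
  choose z hz using hlim
  let L : 𝓢(R3, ℂ) →ₗ[ℂ] ℂ :=
    linearMapOfTendsto z (fun n => ((a n : 𝓢'(R3, ℂ)) : 𝓢(R3, ℂ) →ₗ[ℂ] ℂ)) (tendsto_pi_nhds.2 hz)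
  obtain ⟨N, hN⟩ := ha 1 one_pos
  have hbound : ∀ ψ, ‖(L - ((a N : 𝓢'(R3, ℂ)) : 𝓢(R3, ℂ) →ₗ[ℂ] ℂ)) ψ‖ₑ ≤ C * testNorm ψ := by
    intro ψ
    have h1 : Tendsto (fun n => ‖(a n : 𝓢'(R3, ℂ)) ψ - (a N : 𝓢'(R3, ℂ)) ψ‖ₑ) atTop
        (𝓝 ‖z ψ - (a N : 𝓢'(R3, ℂ)) ψ‖ₑ) := ((hz ψ).sub_const _).enorm
    refine le_of_tendsto h1 ?_
    filter_upwards [eventually_ge_atTop N] with n hn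
    rw [← coe_sub_apply]
    calc _ ≤ C * anisoNorm φ p (a n - a N) * testNorm ψ := hC _ ψ
      _ ≤ C * 1 * testNorm ψ := by
          gcongr
          exact hN n hn N le_rfl
      _ = _ := by rw [mul_one]
  have hcont : Continuous (L - ((a N : 𝓢'(R3, ℂ)) : 𝓢(R3, ℂ) →ₗ[ℂ] ℂ)) := by
    refine continuous_of_continuousAt_zero _ ?_
    rw [ContinuousAt, map_zero, tendsto_zero_iff_enorm_tendsto_zero]
    have h2 : Tendsto (fun ψ => (C : ℝ≥0∞) * testNorm ψ) (𝓝 0) (𝓝 0) := by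
      simpa using ENNReal.Tendsto.const_mul tendsto_testNorm (Or.inr ENNReal.coe_ne_top)
    exact tendsto_of_tendsto_of_tendsto_of_le_of_le tendsto_const_nhds h2 (fun _ => zero_le) hbound
  have hLcont : Continuous L := by
    have h3 := hcont.add (a N : 𝓢'(R3, ℂ)).continuous
    exact h3.congr fun ψ => sub_add_cancel (L ψ) ((a N : 𝓢'(R3, ℂ)) ψ)
  refine ⟨ContinuousLinearMap.toPointwiseConvergenceCLM _ _ _ _ ⟨L, hLcont⟩, ?_⟩
  rw [TendstoDist, PointwiseConvergenceCLM.tendsto_iff_forall_tendsto]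
  exact hz

/-- A compactly supported smooth symbol in the product of horizontal and vertical profiles. -/
def prodSym {θ₁ θ₂ : ℝ → ℝ} (h₁ : IsProfile θ₁) (h₂ : IsProfile θ₂) (k l : ℤ) : 𝓢(R3, ℂ) :=
  HasCompactSupport.toSchwartzMap
    (f := fun ξ : R3 => sym R2 h₁ k (horizontal ξ) * sym ℝ h₂ l (vertical ξ))
    (by
      obtain ⟨R, hR⟩ := h₁.hasCompactSupport.isBounded.subset_closedBall 0
      obtain ⟨S, hS⟩ := h₂.hasCompactSupport.isBounded.subset_closedBall 0
      refine HasCompactSupport.of_support_subset_isCompact (isCompact_closedBall (0 : R3)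
        (R / (2 ^ (-k) * (2 * Real.pi)) + S / (2 ^ (-l) * (2 * Real.pi)))) fun ξ hξ => ?_
      obtain ⟨hξ₁, hξ₂⟩ := mul_ne_zero_iff.1 hξ
      rw [sym_apply] at hξ₁ hξ₂
      have e₁ := hR (subset_tsupport θ₁ (Complex.ofReal_ne_zero.1 hξ₁))
      have e₂ := hS (subset_tsupport θ₂ (Complex.ofReal_ne_zero.1 hξ₂))
      rw [mem_closedBall_zero_iff, Real.norm_of_nonneg (by positivity)] at e₁ e₂
      rw [mem_closedBall_zero_iff]
      refine (norm_le_horizontal_add_vertical ξ).trans (add_le_add ?_ ?_)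
      · rw [le_div_iff₀ (by positivity)]
        linarith
      · rw [le_div_iff₀ (by positivity)]
        linarith)
    (((sym R2 h₁ k).smooth _).comp horizontal.contDiff |>.mul
      (((sym ℝ h₂ l).smooth _).comp vertical.contDiff))

lemma prodSym_apply {θ₁ θ₂ : ℝ → ℝ} (h₁ : IsProfile θ₁) (h₂ : IsProfile θ₂) (k l : ℤ) (ξ : R3) :
    prodSym h₁ h₂ k l ξ = sym R2 h₁ k (horizontal ξ) * sym ℝ h₂ l (vertical ξ) := rfl

lemma tendsto_horMul_verMul {θ₁ θ₂ : ℝ → ℝ} (h₁ : IsProfile θ₁) (h₂ : IsProfile θ₂) (k l : ℤ)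
    {a : ℕ → 𝓢(R3, ℂ)} {b : 𝓢(R3, ℂ)} (h : TendstoDist a b) (x : R3) :
    Tendsto (fun n => horMul (sym R2 h₁ k) (verMul (sym ℝ h₂ l) (a n)) x) atTop
      (𝓝 (horMul (sym R2 h₁ k) (verMul (sym ℝ h₂ l) b) x)) := by
  have heven : ∀ ξ, prodSym h₁ h₂ k l (-ξ) = prodSym h₁ h₂ k l ξ := fun ξ => by
    rw [prodSym_apply, prodSym_apply, map_neg horizontal, map_neg vertical, sym_even, sym_even]
  have heq : ∀ c : 𝓢(R3, ℂ), horMul (sym R2 h₁ k) (verMul (sym ℝ h₂ l) c) x =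
      (c : 𝓢'(R3, ℂ)) ((𝓕⁻ (prodSym h₁ h₂ k l)).compSubConstCLM ℂ x) := by
    intro c
    rw [coe_apply_translate heven]
    exact DFunLike.congr_fun (fourierMultiplier_fourierMultiplier
      (hasTemperateGrowth_comp_horizontal _) (hasTemperateGrowth_comp_vertical _)
      (prodSym_apply h₁ h₂ k l) c) x
  simp only [heq]
  exact tendsto_apply h _

/-- Fatou's lemma for the anisotropic norm: convergence in `𝓢'` implies pointwise convergence of the
blocks, whose symbols are test functions. -/
lemma anisoNorm_le_liminf (hφ : IsDyadicCutoff φ) {p : ℝ} (hp : 0 ≤ p) {a : ℕ → 𝓢(R3, ℂ)}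
    {b : 𝓢(R3, ℂ)} (h : TendstoDist a b) :
    anisoNorm φ p b ≤ liminf (fun n => anisoNorm φ p (a n)) atTop := by
  have hne : ∀ r : ℝ, (2 : ℝ≥0∞) ^ r ≠ ∞ := fun r =>
    ENNReal.rpow_ne_top_of_ne_zero two_ne_zero ENNReal.ofNat_ne_top
  have hhigh := le_liminf_tsum (fun l : ℤ => le_liminf_const_mul (le_liminf_rpow (r := 1 / 2)
    (le_liminf_tsum fun k : {k : ℤ // l - 1 ≤ k} => le_liminf_const_mul (le_liminf_pow
      (mixedNorm_le_liminf hp (g := horBlock φ k (verBlock φ l b))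
        (f := fun n => horBlock φ k (verBlock φ l (a n)))
        (fun n => SchwartzMap.continuous _) fun x => by
          rw [horBlock_eq hφ, verBlock_eq hφ]
          exact tendsto_horMul_verMul _ _ _ _ h x) 2)
      (hne ((-2 + 4 / p) * ((k : ℤ) : ℝ)))) (by norm_num)) (hne ((l : ℝ) / 2)))
  have hlow := le_liminf_tsum (fun j : ℤ => le_liminf_const_mul
    (Lp.eLpNorm_lim_le_liminf_eLpNorm (μ := volume) (p := 2)
      (f := fun n => horLow φ (j - 1) (verBlock φ j (a n)))
      (fun n => by
        rw [horLow_eq hφ]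
        exact (SchwartzMap.continuous _).aestronglyMeasurable)
      (horLow φ (j - 1) (verBlock φ j b))
      (Eventually.of_forall fun x => by
        simp only [horLow_eq hφ, verBlock_eq hφ]
        exact tendsto_horMul_verMul _ _ _ _ h x)) (hne ((j : ℝ) / 2)))
  exact le_liminf_add_ennreal hhigh hlow

/-- The completion for the anisotropic norm is a space of distributions. If `a → 0` in `𝓢'` then
`a n - a m → a n` as `m → ∞`, and the norm is lower semicontinuous. -/
lemma anisoCompletionIsDistributional (hφ : IsDyadicCutoff φ) {p : ℝ} (hp : 2 ≤ p) :
    AnisoCompletionIsDistributional φ p := by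
  refine fun a ha => ⟨exists_tendstoDist hφ hp ha, fun h0 => ?_⟩
  rw [ENNReal.tendsto_atTop_zero]
  intro ε hε
  obtain ⟨N, hN⟩ := ha ε hε
  refine ⟨N, fun n hn => ?_⟩
  have h1 : TendstoDist (fun m => a n - a m) (a n) := by
    rw [TendstoDist, PointwiseConvergenceCLM.tendsto_iff_forall_tendsto]
    intro ψ
    simp only [coe_sub_apply]
    simpa using (tendsto_apply h0 ψ).const_sub ((a n : 𝓢'(R3, ℂ)) ψ)
  refine (anisoNorm_le_liminf hφ (by linarith) h1).trans ?_
  refine le_trans liminf_le_limsup (limsup_le_of_le (by isBoundedDefault) ?_)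
  filter_upwards [eventually_ge_atTop N] with m hm using hN n hn m hm

lemma l2_blockSup_le_add (hφ : IsDyadicCutoff φ) (a b : 𝓢(R3, ℂ)) :
    l2 (fun j : ℤ => 2 ^ (-j) * blockSup hφ j a) ≤
      l2 (fun j : ℤ => 2 ^ (-j) * blockSup hφ j b) +
        l2 fun j : ℤ => 2 ^ (-j) * blockSup hφ j (a - b) := by
  refine (l2_mono fun j => ?_).trans (l2_add_le _ _)
  rw [← mul_add]
  refine mul_le_mul' le_rfl (iSup_le fun x => ?_)
  have h : isoMul hφ j a x = isoMul hφ j b x + isoMul hφ j (a - b) x := by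
    rw [map_sub, sub_apply]
    ring
  rw [h]
  exact (enorm_add_le _ _).trans (add_le_add (le_iSup (fun x => ‖isoMul hφ j b x‖ₑ) x)
    (le_iSup (fun x => ‖isoMul hφ j (a - b) x‖ₑ) x))

/-- `B^{-1+2/p,1/2}_p ⊂ Ḃ^{-1}_{∞,2}`. -/
lemma anisoBesov_embedsIn_besov_two (hφ : IsDyadicCutoff φ) {p : ℝ} (hp : 2 ≤ p) :
    (anisoBesov φ p).EmbedsIn (besov φ 2) := by
  obtain ⟨C, hC⟩ := exists_l2_blockSup_le hφ hp
  obtain ⟨D, hD⟩ := exists_enorm_coe_apply_le hφ hp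
  refine ⟨?_, C + 1, fun u _ => ?_⟩
  · rintro u ⟨a, ha, hau⟩
    have hfin : besovNorm φ 2 u < ∞ := by
      obtain ⟨N, hN⟩ := ha 1 one_pos
      have h1 : besovNorm φ 2 u ≤ l2 (fun j : ℤ => 2 ^ (-j) * blockSup hφ j (a N)) + C * 1 := by
        refine (besovNorm_two_le_liminf hφ hau).trans
          (le_trans liminf_le_limsup (limsup_le_of_le (by isBoundedDefault) ?_))
        filter_upwards [eventually_ge_atTop N] with n hn
        refine (l2_blockSup_le_add hφ (a n) (a N)).trans (add_le_add le_rfl ((hC _).trans ?_))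
        exact mul_le_mul' le_rfl (hN n hn N le_rfl)
      refine h1.trans_lt (ENNReal.add_lt_top.2 ⟨l2_blockSup_lt_top hφ _, ?_⟩)
      simp
    refine ⟨hasSum_isoBlock_of_tendsto hφ ((besovNorm_top_le_two φ u).trans_lt hfin)
      fun ψ => ?_, hfin⟩
    rw [tendsto_zero_iff_enorm_tendsto_zero, ENNReal.tendsto_atTop_zero]
    intro ε hε
    set T := kernelNorm (radial R3 (isProfile_lowProfile hφ)) * testNorm ψ with hT
    have hK : (D : ℝ≥0∞) * T + 1 ≠ ∞ := ENNReal.add_ne_top.2 ⟨(ENNReal.mul_lt_top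
      ENNReal.coe_lt_top (ENNReal.mul_lt_top (kernelNorm_lt_top _) (testNorm_lt_top ψ))).ne, by simp⟩
    have hε2 : ε / 2 ≠ 0 := (ENNReal.half_pos hε.ne').ne'
    obtain ⟨N, hN⟩ := ha (ε / 2 / (D * T + 1)) (ENNReal.div_pos hε2 hK)
    have hlow : ∀ᶠ n : ℕ in atTop, ‖(a N : 𝓢'(R3, ℂ)) (lowMul hφ (-n) ψ)‖ₑ ≤ ε / 2 := by
      have h2 := (tendsto_coe_lowMul hφ (a N) ψ).enorm
      rw [enorm_zero] at h2
      exact h2.eventually_le_const (ENNReal.half_pos hε.ne')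
    obtain ⟨M, hM⟩ := eventually_atTop.1 hlow
    refine ⟨M, fun n hn => ?_⟩
    -- Approximate `u` by `a N`, uniformly in the low frequency cutoff of the test function.
    refine le_of_tendsto (tendsto_apply hau (lowMul hφ (-n) ψ)).enorm ?_
    filter_upwards [eventually_ge_atTop N] with m hm
    have h3 : (a m : 𝓢'(R3, ℂ)) (lowMul hφ (-n) ψ) = (a N : 𝓢'(R3, ℂ)) (lowMul hφ (-n) ψ) +
        ((a m - a N : 𝓢(R3, ℂ)) : 𝓢'(R3, ℂ)) (lowMul hφ (-n) ψ) := by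
      rw [coe_sub_apply]
      ring
    rw [h3]
    refine (enorm_add_le _ _).trans ?_
    rw [← ENNReal.add_halves ε]
    refine add_le_add (hM n hn) ?_
    calc _ ≤ D * anisoNorm φ p (a m - a N) * testNorm (lowMul hφ (-n) ψ) := hD _ _
      _ ≤ D * (ε / 2 / (D * T + 1)) * T :=
          mul_le_mul' (mul_le_mul' le_rfl (hN m hm N le_rfl)) (testNorm_lowMul_le hφ _ ψ)
      _ = (D * T) * (ε / 2 / (D * T + 1)) := by ring
      _ ≤ (D * T + 1) * (ε / 2 / (D * T + 1)) := mul_le_mul' le_self_add le_rfl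
      _ = ε / 2 := ENNReal.mul_div_cancel (by simp) hK
  · have hC0 : ((C + 1 : ℝ≥0) : ℝ≥0∞) ≠ 0 := by simp
    simp only [anisoBesov, besov]
    rw [ENNReal.mul_iInf_of_ne hC0 ENNReal.coe_ne_top]
    refine le_iInf fun a => ?_
    rw [ENNReal.mul_iInf_of_ne hC0 ENNReal.coe_ne_top]
    refine le_iInf fun ha => ?_
    refine (besovNorm_two_le_liminf hφ ha.2).trans (le_trans liminf_le_limsup ?_)
    rw [← ENNReal.limsup_const_mul_of_ne_top ENNReal.coe_ne_top]
    exact limsup_le_limsup (Eventually.of_forall fun n => (hC (a n)).trans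
      (mul_le_mul' (by push_cast; exact le_self_add) le_rfl))

end Limits

end AnisoNS

end

theorem mainTheorem4 (φ : ℝ → ℝ) (hφ : AnisoNS.IsDyadicCutoff φ) (p : ℝ) (hp : 2 ≤ p) :
    AnisoNS.AnisoCompletionIsDistributional φ p ∧
    (AnisoNS.anisoBesov φ 2).EmbedsIn (AnisoNS.anisoBesov φ p) ∧
    (AnisoNS.anisoBesov φ p).EmbedsIn (AnisoNS.besov φ 2) ∧
    (AnisoNS.besov φ 2).EmbedsIn (AnisoNS.bmoInv φ) ∧
    (AnisoNS.bmoInv φ).EmbedsIn (AnisoNS.besov φ ∞) ∧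
    (AnisoNS.besov φ ∞).Equivalent AnisoNS.holderInv :=
  ⟨AnisoNS.anisoCompletionIsDistributional hφ hp, AnisoNS.anisoBesov_two_embedsIn hφ hp,
    AnisoNS.anisoBesov_embedsIn_besov_two hφ hp, AnisoNS.besov_two_embedsIn_bmoInv hφ,
    AnisoNS.bmoInv_embedsIn_besov_top hφ, AnisoNS.besov_top_embedsIn_holderInv hφ,
    AnisoNS.holderInv_embedsIn_besov_top hφ⟩
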